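/- Consider the massively parallel computation (MPC) model with $p\ge 1$ servers. Computation proceeds in rounds; in each round every server sends a message to every server (itself included), each message depending only on the identity of the sender, its part of the input and the messages it received in earlier rounds; local computation is free. A message is a sequence of units, each of which is either a tuple or a non-negative integer of $O(\log \mathrm{IN})$ bits (i.e. at most $\mathrm{IN}^{c}$ for a constant $c$), and the load is the maximum, over all servers and rounds, of the total number of units that a server receives in a round. Algorithms are deterministic and tuple-based: a server can send only (copies of) tuples that it holds, i.e. that are in its part of the input or that it has received. An instance of the line-3 join $R_1(A,B)\Join R_2(B,C)\Join R_3(C,D)$ consists of finite relations $R_1\subseteq \mathrm{dom}(A)\times\mathrm{dom}(B)$, $R_2\subseteq \mathrm{dom}(B)\times\mathrm{dom}(C)$, $R_3\subseteq \mathrm{dom}(C)\times\mathrm{dom}(D)$; its input size is $\mathrm{IN}=|R_1|+|R_2|+|R_3|$, its join results are the triples $((a,b),(b,c),(c,d))\in R_1\times R_2\times R_3$, and $\mathrm{OUT}$ is their number. Initially each input tuple is on exactly one server and each server has at most $\lceil \mathrm{IN}/p\rceil$ tuples. An algorithm computes the join if for each join result $(t_1,t_2,t_3)$ some server holds (copies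 of) $t_1,t_2,t_3$ at the end. Theorem. For every $\epsilon>0$ there are constants $r$, $c$, $K$, depending only on $\epsilon$, such that for all domains $\mathrm{dom}(A),\mathrm{dom}(B),\mathrm{dom}(C),\mathrm{dom}(D)$ and all $p\ge 1$ there is an algorithm which, on every instance with $\mathrm{IN}\ge p^{1+\epsilon}$ and from every such initial distribution, computes the line-3 join in $r=O(1)$ rounds, sends only tuples and integers at most $\mathrm{IN}^c$, and has load at most $$K\left(\frac{\mathrm{IN}}{p}+\frac{\sqrt{\mathrm{IN}\cdot\mathrm{OUT}}}{p}\right).$$ -/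

import Mathlib

/-! ## The massively parallel computation (MPC) model, tuple-based algorithms -/

namespace MPC

/-- One unit of communication: a copy of an (atomic) tuple, or an integer.
The size of the integers is limited by `Algorithm.IntsBounded` below. -/
inductive Word (T : Type*) where
  | tuple (t : T) : Word T
  | int (n : ℕ) : Word T

/-- What one server receives in one round: from every server a (possibly empty) message. -/
abbrev Inbox (p : ℕ) (T : Type*) := Fin p → List (Word T)

/-- Everything a server has seen: its part of the input and, in chronological order, what it
received in each of the previous rounds. -/
structure View (p : ℕ) (T : Type*) where
  init : Finset T
  received : List (Inbox p T)

/-- The server with view `v` holds the tuple `t` or a copy of it. -/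
def View.Holds {p : ℕ} {T : Type*} (v : View p T) (t : T) : Prop :=
  t ∈ v.init ∨ ∃ box ∈ v.received, ∃ s, Word.tuple t ∈ box s

/-- A deterministic tuple-based MPC algorithm for `p` servers. In every round the server `s`
with view `v` sends the message `send s v d` to the server `d`; local computation is free and
the number of the round is the length of `v.received`. The only way to create a tuple is to
copy one that the server holds. -/
structure Algorithm (p : ℕ) (T : Type*) where
  send : Fin p → View p T → Fin p → List (Word T)
  tupleBased : ∀ s v d t, Word.tuple t ∈ send s v d → v.Holds t

namespace Algorithm

variable {p : ℕ} {T : Type*} (alg : Algorithm p T) (init : Fin p → Finset T)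

/-- The view of every server after `k` rounds, if the input is distributed as `init`. -/
def view : ℕ → Fin p → View p T
  | 0, s => ⟨init s, []⟩
  | k + 1, s => ⟨init s, (view k s).received ++ [fun s' => alg.send s' (view k s') s]⟩

/-- The message that `s` sends to `d` in round `k` (rounds are numbered from `0`). -/
def message (k : ℕ) (s d : Fin p) : List (Word T) :=
  alg.send s (alg.view init k s) d

/-- The number of units that server `d` receives in round `k`. -/
def loadAt (k : ℕ) (d : Fin p) : ℕ :=
  ∑ s : Fin p, (alg.message init k s d).length

/-- The load of the first `r` rounds: the maximum number of units that any server receives in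
any of these rounds. -/
def load (r : ℕ) : ℕ :=
  (Finset.range r).sup fun k => Finset.univ.sup fun d => alg.loadAt init k d

/-- All integers sent in the first `r` rounds are at most `M`. -/
def IntsBounded (r M : ℕ) : Prop :=
  ∀ k < r, ∀ s d n, Word.int n ∈ alg.message init k s d → n ≤ M

end Algorithm

/-- `init` is an even initial distribution of the set `S` of tuples: every tuple is on exactly
one server and every server has at most `⌈|S| / p⌉` tuples. -/
structure IsEvenDistribution {p : ℕ} {T : Type*} (S : Finset T) (init : Fin p → Finset T) :
    Prop where
  cover : ∀ t, t ∈ S ↔ ∃ s, t ∈ init s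
  disjoint : ∀ s s', s ≠ s' → Disjoint (init s) (init s')
  even : ∀ s, (init s).card ≤ ⌈(S.card : ℝ) / (p : ℝ)⌉₊

/-! ## The line-3 join `R₁(A, B) ⋈ R₂(B, C) ⋈ R₃(C, D)` -/

/-- Tuples of the three relations; a tuple knows to which relation it belongs. -/
abbrev LineTuple (A B C D : Type*) := (A × B) ⊕ (B × C) ⊕ (C × D)

/-- An instance of the line-3 join. -/
structure LineInstance (A B C D : Type*) where
  R₁ : Finset (A × B)
  R₂ : Finset (B × C)
  R₃ : Finset (C × D)

namespace LineInstance

variable {A B C D : Type*} (I : LineInstance A B C D)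

/-- All input tuples. -/
def tuples : Finset (LineTuple A B C D) := I.R₁.disjSum (I.R₂.disjSum I.R₃)

/-- The input size. -/
def IN : ℕ := I.R₁.card + I.R₂.card + I.R₃.card

open Classical in
/-- The join results: combinations of three tuples, one from each relation, that agree on the
common attributes. -/
noncomputable def results : Finset ((A × B) × (B × C) × (C × D)) :=
  (I.R₁ ×ˢ I.R₂ ×ˢ I.R₃).filter fun t => t.1.2 = t.2.1.1 ∧ t.2.1.2 = t.2.2.1

/-- The output size. -/
noncomputable def OUT : ℕ := I.results.card

end LineInstance

/-- In `r` rounds from the initial distribution `init`, the algorithm computes the line-3 join of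
`I`: for every join result, its three tuples (or copies) are all present on one server. As servers
keep what they received, it is enough to look at the views after the last round. -/
def ComputesLineJoin {A B C D : Type*} {p : ℕ} (alg : Algorithm p (LineTuple A B C D))
    (I : LineInstance A B C D) (init : Fin p → Finset (LineTuple A B C D)) (r : ℕ) : Prop :=
  ∀ t ∈ I.results, ∃ s : Fin p,
    (alg.view init r s).Holds (Sum.inl t.1) ∧
    (alg.view init r s).Holds (Sum.inr (Sum.inl t.2.1)) ∧
    (alg.view init r s).Holds (Sum.inr (Sum.inr t.2.2))

end MPC

/-! The obstacle for a join in two steps is the size of the intermediate result. Put N = IN, let O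
be the number of join results, and let t in R₂ have a(t) partners in R₁ and d(t) in R₃, so that Σ
a(t) d(t) = O. Call t heavy if a(t) > 0 and a(t) ≥ √(O/N). Over the heavy tuples Σ d(t) ≤ √(N/O) · O
= √(NO); over the light ones Σ a(t) ≤ N √(O/N) = √(NO). Hence heavy tuples are joined with R₃ first
and light tuples with R₁ first, and both intermediate results have size at most √(NO)
(`sq_sum_le_of_heavy`, `sq_sum_le_of_light`, `fits_heavy_light`).

A binary join is done on P = q ^ m ≤ p servers with a load unit l of about N/P + √(NO)/P. Both sides
are ordered by the join key and their positions are cut into blocks of length l. Each key owns an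
interval on either side; a pair of blocks meeting these intervals is a cell, where the tuples or
pairs of the two blocks with that key meet. There may be far more keys than servers, so the first
cell of a key is shared: its number is the sum of its two block indices, and as the intervals of
successive keys advance on both sides, equal sums mean equal blocks (`cell_ne_of_before`). The
remaining cells are at most 6P in total (`Fits.sum_cellWeight`), because intervals cross few block
boundaries and the result has size at most P l². So there are fewer than 9P cells, nine per server,
each receiving at most one block from either side.

Positions, degrees and the numbers N and O come from sorting and prefix sums in O(1) rounds. Prefix
sums use a butterfly with m levels of degree q. Sorting is recursive: sort the blocks, deal them
round-robin, sort again, collect. Every element is then within 2q² of its place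
(`IsPlacement.collect_near`), and this is repaired by looking at adjacent servers
(`IsPlacement.nearPos_eq`) when each server has room for at least 4q² elements.

The exponent ε enters only through the choice m ≥ 2/ε and q = ⌊p^(1/m)⌋: then q² ≤ p^ε ≤ IN/p pays
for the sorting, and p ≤ 2^m q^m, so that leaving the other servers idle costs a constant factor.

Algorithms are built as a `Run` over all inputs at once. To know a quantity means that it is
determined by the view, and `Run.step` appends one round to a run. -/

namespace MPC

/-! ### Runs, knowledge, and appending a round -/

/-- A communication protocol observed from outside: an algorithm together with a number of rounds
in which, on every input `ω`, the load is at most `L ω` and the integers are at most `Bd ω`. -/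
structure Run {p : ℕ} {T Ω : Type*} (init : Ω → Fin p → Finset T) (L Bd : Ω → ℕ) where
  alg : Algorithm p T
  rounds : ℕ
  load_le : ∀ ω, ∀ k < rounds, ∀ d, alg.loadAt (init ω) k d ≤ L ω
  ints_le : ∀ ω, alg.IntsBounded (init ω) rounds (Bd ω)

namespace Run

variable {p : ℕ} {T Ω : Type*} {init : Ω → Fin p → Finset T} {L Bd : Ω → ℕ}

/-- The view of server `v` at the end of the run on input `ω`. -/
def vw (R : Run init L Bd) (ω : Ω) (v : ℕ) : View p T :=
  if h : v < p then R.alg.view (init ω) R.rounds ⟨v, h⟩ else ⟨∅, []⟩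

/-- At the end of the run, server `v` can compute `X`. -/
def Knows {α : Sort*} (R : Run init L Bd) (v : ℕ) (X : Ω → α) : Prop :=
  ∀ ω₁ ω₂, R.vw ω₁ v = R.vw ω₂ v → X ω₁ = X ω₂

/-- At the end of the run on input `ω`, server `v` holds the tuple `t`. -/
def Has (R : Run init L Bd) (ω : Ω) (v : ℕ) (t : T) : Prop := (R.vw ω v).Holds t

/-- The second run continues the first one by `c` rounds. -/
structure Ext (R : Run init L Bd) (c : ℕ) (R' : Run init L Bd) : Prop where
  rounds_eq : R'.rounds = R.rounds + c
  know : ∀ v ω ω', R'.vw ω v = R'.vw ω' v → R.vw ω v = R.vw ω' v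
  has : ∀ ω v t, R.Has ω v t → R'.Has ω v t

theorem Ext.refl (R : Run init L Bd) : R.Ext 0 R :=
  ⟨rfl, fun _ _ _ h => h, fun _ _ _ h => h⟩

theorem Ext.trans {R R' R'' : Run init L Bd} {c c' : ℕ} (h : R.Ext c R') (h' : R'.Ext c' R'') :
    R.Ext (c + c') R'' :=
  ⟨by rw [h'.rounds_eq, h.rounds_eq, add_assoc],
    fun v ω ω' e => h.know v ω ω' (h'.know v ω ω' e),
    fun ω v t e => h'.has ω v t (h.has ω v t e)⟩

theorem Knows.mono {α : Sort*} {R R' : Run init L Bd} {c v : ℕ} {X : Ω → α} (h : R.Knows v X)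
    (e : R.Ext c R') : R'.Knows v X :=
  fun ω₁ ω₂ he => h ω₁ ω₂ (e.know v ω₁ ω₂ he)

/-- The run without any round. -/
def start (init : Ω → Fin p → Finset T) (L Bd : Ω → ℕ) : Run init L Bd where
  alg := ⟨fun _ _ _ => [], by simp⟩
  rounds := 0
  load_le := by simp
  ints_le := by intro ω k hk; simp at hk

theorem received_length (alg : Algorithm p T) (i : Fin p → Finset T) (k : ℕ) (s : Fin p) :
    (alg.view i k s).received.length = k := by
  induction k generalizing s with
  | zero => rfl
  | succ k ih => simp [Algorithm.view, ih]

/-- The view before round `k` has exactly `k` entries, so the first `n` rounds never consult the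
algorithm on longer views. This allows a further round to be defined freely on views of length `n`.
-/
theorem view_congr {alg alg' : Algorithm p T} {i : Fin p → Finset T} {n : ℕ}
    (h : ∀ s v d, v.received.length < n → alg.send s v d = alg'.send s v d) :
    ∀ k ≤ n, ∀ s, alg.view i k s = alg'.view i k s := by
  intro k
  induction k with
  | zero => intro _ s; rfl
  | succ k ih =>
    intro hk s
    have ih' := ih (by omega)
    simp only [Algorithm.view, ih']
    congr 2
    simp only [List.cons.injEq, and_true]
    funext s'
    exact h _ _ _ (by rw [received_length]; omega)

open Classical in
/-- One more round: every server may send messages that depend on what it knows and use tuples that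
it holds. -/
theorem step (R : Run init L Bd) (M : ℕ → ℕ → Ω → List (Word T))
    (hk : ∀ v < p, ∀ d < p, R.Knows v (M v d))
    (ht : ∀ v < p, ∀ d < p, ∀ ω t, Word.tuple t ∈ M v d ω → R.Has ω v t)
    (hb : ∀ v < p, ∀ d < p, ∀ ω n, Word.int n ∈ M v d ω → n ≤ Bd ω)
    (hl : ∀ d < p, ∀ ω, ∑ v ∈ Finset.range p, (M v d ω).length ≤ L ω) :
    ∃ R' : Run init L Bd, R.Ext 1 R' ∧ (∀ v < p, ∀ d < p, R'.Knows d (M v d)) ∧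
      ∀ v < p, ∀ d < p, ∀ ω t, Word.tuple t ∈ M v d ω → R'.Has ω d t := by
  -- The message is prescribed as a function of the input, but a server only sees its view. Some
  -- input with this view is chosen, and `hk` makes the message independent of the choice.
  let snd : Fin p → View p T → Fin p → List (Word T) := fun s v d =>
    if v.received.length = R.rounds then
      if h : ∃ ω, R.vw ω s = v then M s d h.choose else []
    else R.alg.send s v d
  have vw_fin : ∀ ω (s : Fin p), R.vw ω s = R.alg.view (init ω) R.rounds s := by
    intro ω s; simp [vw]
  let alg' : Algorithm p T := ⟨snd, by
    intro s v d t hm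
    simp only [snd] at hm
    split_ifs at hm with h1 h2
    · have := ht s s.2 d d.2 _ _ hm
      rw [Has, h2.choose_spec] at this
      exact this
    · simp at hm
    · exact R.alg.tupleBased _ _ _ _ hm⟩
  have agree : ∀ s v d, v.received.length < R.rounds → alg'.send s v d = R.alg.send s v d := by
    intro s v d h
    simp only [alg', snd]
    rw [if_neg (by omega)]
  have hview : ∀ ω, ∀ k ≤ R.rounds, ∀ s, alg'.view (init ω) k s = R.alg.view (init ω) k s :=
    fun ω => view_congr agree
  have hmsg_old : ∀ ω, ∀ k < R.rounds, ∀ s d,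
      alg'.message (init ω) k s d = R.alg.message (init ω) k s d := by
    intro ω k hk s d
    simp only [Algorithm.message]
    rw [hview ω k hk.le, agree _ _ _ (by rw [received_length]; exact hk)]
  have hmsg_new : ∀ ω s d, alg'.message (init ω) R.rounds s d = M s d ω := by
    intro ω s d
    simp only [Algorithm.message]
    rw [hview ω _ le_rfl]
    simp only [alg', snd]
    have hex : ∃ ω', R.vw ω' s = R.alg.view (init ω) R.rounds s := ⟨ω, vw_fin ω s⟩
    rw [if_pos (received_length ..), dif_pos hex]
    exact hk s s.2 d d.2 _ _ (by rw [hex.choose_spec, vw_fin])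
  let R' : Run init L Bd :=
    { alg := alg'
      rounds := R.rounds + 1
      load_le := by
        intro ω k hk' d
        rcases Nat.lt_succ_iff_lt_or_eq.mp hk' with h | rfl
        · have := R.load_le ω k h d
          simpa only [Algorithm.loadAt, hmsg_old ω k h] using this
        · simp only [Algorithm.loadAt, hmsg_new]
          have := hl d d.2 ω
          rwa [Finset.sum_range (fun v => (M v d ω).length)] at this
      ints_le := by
        intro ω k hk' s d n hn
        rcases Nat.lt_succ_iff_lt_or_eq.mp hk' with h | rfl
        · rw [hmsg_old ω k h] at hn
          exact R.ints_le ω k h s d n hn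
        · rw [hmsg_new] at hn
          exact hb s s.2 d d.2 ω n hn }
  have hvw : ∀ ω v (h : v < p), R'.vw ω v =
      ⟨init ω ⟨v, h⟩, (R.vw ω v).received ++ [((fun s' => M s' v ω) : Inbox p T)]⟩ := by
    intro ω v h
    have : R'.vw ω v = alg'.view (init ω) (R.rounds + 1) ⟨v, h⟩ := by simp [vw, h, R']
    rw [this]
    simp only [Algorithm.view]
    have h2 := fun s' => hmsg_new ω s' ⟨v, h⟩
    simp only [Algorithm.message] at h2
    simp only [h2]
    rw [hview ω _ le_rfl]
    simp [vw, h]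
  have vw_init : ∀ ω v (h : v < p), (R.vw ω v).init = init ω ⟨v, h⟩ := by
    intro ω v h
    simp only [vw, h, dif_pos]
    cases R.rounds <;> rfl
  refine ⟨R', ⟨rfl, ?_, ?_⟩, ?_, ?_⟩
  · intro v ω ω' h
    by_cases hv : v < p
    · rw [hvw ω v hv, hvw ω' v hv, View.mk.injEq] at h
      have h2 := List.append_inj_left' h.2 rfl
      have h3 : ∀ x y : View p T, x.init = y.init → x.received = y.received → x = y := by
        rintro ⟨⟩ ⟨⟩ rfl rfl; rfl
      exact h3 _ _ (by rw [vw_init ω v hv, vw_init ω' v hv]; exact h.1) h2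
    · simp [vw, hv]
  · intro ω v t h
    by_cases hv : v < p
    · rw [Has, hvw ω v hv]
      rcases h with h | ⟨box, hbox, h⟩
      · exact Or.inl (by rw [vw_init ω v hv] at h; exact h)
      · exact Or.inr ⟨box, by simp [hbox], h⟩
    · simp only [Has, vw, hv, dif_neg, not_false_eq_true] at h ⊢
      exact h
  · intro v hv d hd ω ω' h
    rw [hvw ω d hd, hvw ω' d hd, View.mk.injEq] at h
    have h2 := List.append_inj_right' h.2 rfl
    simp only [List.cons.injEq, and_true] at h2
    exact congrFun h2 ⟨v, hv⟩
  · intro v hv d hd ω t h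
    rw [Has, hvw ω d hd]
    exact Or.inr ⟨((fun s' => M s' d ω) : Inbox p T), by simp, ⟨v, hv⟩, h⟩

end Run

end MPC

/-! ### Families distributed over the servers -/

namespace MPC

namespace Run

variable {p : ℕ} {T Ω : Type*} {init : Ω → Fin p → Finset T} {L Bd : Ω → ℕ}
variable {ι α β : Type*}

/-- A distributed family: the elements `i` of `S` are spread over the first `P` servers. The server
`o ω i` knows that it owns `i`, knows the value `f ω i`, and holds the tuples in `car i`. -/
structure Own (R : Run init L Bd) (P : ℕ) (car : ι → Set T) (S : Ω → Finset ι) (o : Ω → ι → ℕ)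
    (f : Ω → ι → α) : Prop where
  lt : ∀ ω, ∀ i ∈ S ω, o ω i < P
  know : ∀ v < P, ∀ ω ω', R.vw ω v = R.vw ω' v → ∀ i ∈ S ω, o ω i = v →
    i ∈ S ω' ∧ o ω' i = v ∧ f ω i = f ω' i
  has : ∀ ω, ∀ i ∈ S ω, ∀ t ∈ car i, R.Has ω (o ω i) t

variable {R R' : Run init L Bd} {P : ℕ} {car : ι → Set T} {S : Ω → Finset ι}
  {o : Ω → ι → ℕ} {f : Ω → ι → α}

theorem Own.mono {c : ℕ} (h : R.Own P car S o f) (e : R.Ext c R') : R'.Own P car S o f where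
  lt := h.lt
  know v hv ω ω' he := h.know v hv ω ω' (e.know v ω ω' he)
  has ω i hi t ht := e.has _ _ _ (h.has ω i hi t ht)

/-- Local computation is free: a value is known to the owner if it is determined by the owner's view
together with what is already known about the element. Hence two inputs with equal views may be
compared under the assumption that membership, owner and old value agree. -/
theorem Own.map (h : R.Own P car S o f) (g : Ω → ι → β)
    (hg : ∀ v < P, ∀ ω ω', R.vw ω v = R.vw ω' v → ∀ i ∈ S ω, i ∈ S ω' → o ω i = v → o ω' i = v →
      f ω i = f ω' i → g ω i = g ω' i) : R.Own P car S o g where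
  lt := h.lt
  know v hv ω ω' he i hi ho := by
    obtain ⟨h1, h2, h3⟩ := h.know v hv ω ω' he i hi ho
    exact ⟨h1, h2, hg v hv ω ω' he i hi h1 ho h2 h3⟩
  has := h.has

theorem Own.prod {g : Ω → ι → β} (h : R.Own P car S o f) (h' : R.Own P car S o g) :
    R.Own P car S o (fun ω i => (f ω i, g ω i)) :=
  h.map _ fun v hv ω ω' he i hi _ ho _ hf => by
    rw [hf, (h'.know v hv ω ω' he i hi ho).2.2]

theorem Own.congr {o' : Ω → ι → ℕ} {f' : Ω → ι → α} (h : R.Own P car S o f)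
    (ho : ∀ ω, ∀ i ∈ S ω, o' ω i = o ω i) (hf : ∀ ω, ∀ i ∈ S ω, f' ω i = f ω i) :
    R.Own P car S o' f' where
  lt ω i hi := by rw [ho ω i hi]; exact h.lt ω i hi
  know v hv ω ω' he i hi hv' := by
    rw [ho ω i hi] at hv'
    obtain ⟨h1, h2, h3⟩ := h.know v hv ω ω' he i hi hv'
    exact ⟨h1, by rw [ho ω' i h1, h2], by rw [hf ω i hi, hf ω' i h1, h3]⟩
  has ω i hi t ht := by rw [ho ω i hi]; exact h.has ω i hi t ht

/-- The part of a distributed family on one server is known to this server. -/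
theorem Own.filter_eq (h : R.Own P car S o f) {v : ℕ} (hv : v < P) {ω ω' : Ω}
    (he : R.vw ω v = R.vw ω' v) :
    (S ω).filter (fun i => o ω i = v) = (S ω').filter (fun i => o ω' i = v) := by
  ext i
  simp only [Finset.mem_filter]
  constructor
  · rintro ⟨h1, h2⟩
    exact ⟨(h.know v hv ω ω' he i h1 h2).1, (h.know v hv ω ω' he i h1 h2).2.1⟩
  · rintro ⟨h1, h2⟩
    exact ⟨(h.know v hv ω' ω he.symm i h1 h2).1, (h.know v hv ω' ω he.symm i h1 h2).2.1⟩

/-- Codewords of one fixed length need no separators. Positivity of the length is needed to recover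
their number. -/
theorem flatten_injective {β : Type*} {b : ℕ} (hb : 0 < b) : ∀ l l' : List (List β),
    (∀ x ∈ l, x.length = b) → (∀ x ∈ l', x.length = b) → l.flatten = l'.flatten → l = l'
  | [], [], _, _, _ => rfl
  | [], x :: l', _, h', e => by
    have := h' x (by simp)
    have h2 := congrArg List.length e
    simp only [List.flatten_nil, List.flatten_cons, List.length_append, List.length_nil] at h2
    omega
  | x :: l, [], h, _, e => by
    have := h x (by simp)
    have h2 := congrArg List.length e
    simp only [List.flatten_nil, List.flatten_cons, List.length_append, List.length_nil] at h2
    omega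
  | x :: l, y :: l', h, h', e => by
    simp only [List.flatten_cons] at e
    obtain ⟨h1, h2⟩ := List.append_inj e (by rw [h x (by simp), h' y (by simp)])
    rw [h1, flatten_injective hb l l' (fun z hz => h z (by simp [hz]))
      (fun z hz => h' z (by simp [hz])) h2]

/-- A description of pairs by messages of length `b` that contain the tuples that belong to the
first component, and no others. -/
structure IsCodec (car : ι → Set T) (enc : ι → α → List (Word T)) (b : ℕ) : Prop where
  pos : 0 < b
  len : ∀ i a, (enc i a).length = b
  inj : ∀ i a i' a', enc i a = enc i' a' → i = i' ∧ a = a'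
  tup : ∀ i a t, Word.tuple t ∈ enc i a ↔ t ∈ car i

open Classical in
/-- A distributed family is sent to new owners in one round. -/
theorem Own.move {b : ℕ} (h : R.Own P car S o f) (hP : P ≤ p) (dst : Ω → ι → ℕ)
    (hdst : ∀ ω, ∀ i ∈ S ω, dst ω i < P)
    (hd : ∀ v < P, ∀ ω ω', R.vw ω v = R.vw ω' v → ∀ i ∈ S ω, i ∈ S ω' → o ω i = v → o ω' i = v →
      f ω i = f ω' i → dst ω i = dst ω' i)
    {enc : ι → α → List (Word T)} (henc : IsCodec car enc b)
    (hsmall : ∀ ω, ∀ i ∈ S ω, ∀ n, Word.int n ∈ enc i (f ω i) → n ≤ Bd ω)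
    (hload : ∀ ω, ∀ d < P, b * ((S ω).filter (fun i => dst ω i = d)).card ≤ L ω) :
    ∃ R' : Run init L Bd, R.Ext 1 R' ∧ R'.Own P car S dst f := by
  -- The message lists the codewords in the order of `Finset.toList`, which depends on the set
  -- alone. So a sender that knows the set knows the message, and the receiver can cut it back into
  -- codewords.
  let F : ℕ → ℕ → Ω → Finset (List (Word T)) := fun v d ω =>
    ((S ω).filter (fun i => o ω i = v ∧ dst ω i = d)).image (fun i => enc i (f ω i))
  have memF : ∀ v d ω x, x ∈ F v d ω ↔ ∃ i ∈ S ω, o ω i = v ∧ dst ω i = d ∧ enc i (f ω i) = x := by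
    intro v d ω x
    simp [F, and_assoc]
  have hlenF : ∀ v d ω, ∀ x ∈ F v d ω, x.length = b := by
    intro v d ω x hx
    obtain ⟨i, _, _, _, rfl⟩ := (memF v d ω x).1 hx
    exact henc.len _ _
  have knowF : ∀ v, ∀ d, ∀ ω ω', R.vw ω v = R.vw ω' v → F v d ω ⊆ F v d ω' := by
    intro v d ω ω' he x hx
    obtain ⟨i, hi, ho, hdi, rfl⟩ := (memF v d ω x).1 hx
    have hv : v < P := ho ▸ h.lt ω i hi
    obtain ⟨h1, h2, h3⟩ := h.know v hv ω ω' he i hi ho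
    refine (memF v d ω' _).2 ⟨i, h1, h2, ?_, by rw [h3]⟩
    rw [← hd v hv ω ω' he i hi h1 ho h2 h3, hdi]
  have memM : ∀ v d ω (w : Word T), w ∈ (F v d ω).toList.flatten ↔
      ∃ i ∈ S ω, o ω i = v ∧ dst ω i = d ∧ w ∈ enc i (f ω i) := by
    intro v d ω w
    simp only [List.mem_flatten, Finset.mem_toList, memF]
    constructor
    · rintro ⟨x, ⟨i, h1, h2, h3, rfl⟩, hw⟩
      exact ⟨i, h1, h2, h3, hw⟩
    · rintro ⟨i, h1, h2, h3, hw⟩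
      exact ⟨_, ⟨i, h1, h2, h3, rfl⟩, hw⟩
  obtain ⟨R', hext, hknow, hhas⟩ := R.step (fun v d ω => (F v d ω).toList.flatten)
    (by
      intro v _ d _ ω ω' he
      show (F v d ω).toList.flatten = (F v d ω').toList.flatten
      rw [(knowF v d ω ω' he).antisymm (knowF v d ω' ω he.symm)])
    (by
      intro v _ d _ ω t ht
      obtain ⟨i, hi, ho, _, hw⟩ := (memM v d ω _).1 ht
      exact ho ▸ h.has ω i hi t ((henc.tup _ _ _).1 hw))
    (by
      intro v _ d _ ω n hn
      obtain ⟨i, hi, ho, _, hw⟩ := (memM v d ω _).1 hn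
      exact hsmall ω i hi n hw)
    (by
      intro d hd ω
      have h1 : ∀ v, (F v d ω).toList.flatten.length ≤
          b * ((S ω).filter (fun i => o ω i = v ∧ dst ω i = d)).card := by
        intro v
        rw [List.length_flatten, List.sum_eq_card_nsmul _ b]
        · simp only [List.length_map, Finset.length_toList, smul_eq_mul]
          rw [mul_comm]
          exact Nat.mul_le_mul_left _ Finset.card_image_le
        · intro x hx
          simp only [List.mem_map, Finset.mem_toList] at hx
          obtain ⟨y, hy, rfl⟩ := hx
          exact hlenF v d ω y hy
      refine (Finset.sum_le_sum fun v _ => h1 v).trans ?_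
      rw [← Finset.mul_sum]
      by_cases hdP : d < P
      · refine le_trans (Nat.mul_le_mul_left _ (le_of_eq ?_)) (hload ω d hdP)
        rw [Finset.card_eq_sum_card_fiberwise (f := fun i => o ω i) (t := Finset.range p)]
        · refine Finset.sum_congr rfl fun v _ => ?_
          rw [Finset.filter_filter]
          simp only [and_comm]
        · intro i hi
          simp only [Finset.coe_filter, Set.mem_ofPred_eq] at hi
          simpa using (h.lt ω i hi.1).trans_le hP
      · rw [Finset.sum_eq_zero]
        · simp
        · intro v _
          rw [Finset.card_eq_zero, Finset.filter_eq_empty_iff]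
          rintro i hi ⟨_, h2⟩
          exact hdP (h2 ▸ hdst ω i hi))
  refine ⟨R', hext, ⟨hdst, ?_, ?_⟩⟩
  · intro d hdP ω ω' he i hi hdi
    have ho := h.lt ω i hi
    have h1 : (F (o ω i) d ω).toList.flatten = (F (o ω i) d ω').toList.flatten :=
      hknow (o ω i) (ho.trans_le hP) d (hdP.trans_le hP) ω ω' he
    have h2 := flatten_injective henc.pos _ _ (fun x hx => hlenF _ _ _ x (Finset.mem_toList.1 hx))
      (fun x hx => hlenF _ _ _ x (Finset.mem_toList.1 hx)) h1
    have h3 : enc i (f ω i) ∈ F (o ω i) d ω' := by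
      rw [← Finset.mem_toList, ← h2, Finset.mem_toList, memF]
      exact ⟨i, hi, rfl, hdi, rfl⟩
    obtain ⟨i', hi', _, hdi', e⟩ := (memF _ _ _ _).1 h3
    obtain ⟨rfl, e2⟩ := henc.inj _ _ _ _ e
    exact ⟨hi', hdi', e2.symm⟩
  · intro ω i hi t ht
    exact hhas (o ω i) ((h.lt ω i hi).trans_le hP) (dst ω i) ((hdst ω i hi).trans_le hP) ω t
      ((memM _ _ _ _).2 ⟨i, hi, rfl, rfl, (henc.tup _ _ _).2 ht⟩)

end Run

end MPC

/-! ### Prefix sums by a butterfly network -/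

namespace MPC

namespace Run

variable {p : ℕ} {T Ω : Type*} {init : Ω → Fin p → Finset T} {L Bd : Ω → ℕ}

theorem sum_Ico_blocks (w : ℕ → ℕ) (a Q k : ℕ) :
    ∑ i ∈ Finset.range k, ∑ u ∈ Finset.Ico (a + i * Q) (a + (i + 1) * Q), w u =
      ∑ u ∈ Finset.Ico a (a + k * Q), w u := by
  induction k with
  | zero => simp
  | succ k ih =>
    rw [Finset.sum_range_succ, ih, Finset.sum_Ico_consecutive]
    · omega
    · exact Nat.add_le_add_left (Nat.mul_le_mul_right _ (Nat.le_succ k)) _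

/-- The `i`-th of the `q` servers that agree with `d` outside digit number `j`. -/
def digitMate (q j d i : ℕ) : ℕ := (d / q ^ (j + 1) * q + i) * q ^ j + d % q ^ j

theorem digitMate_div {q j d i : ℕ} (hq : 0 < q) : digitMate q j d i / q ^ j =
    d / q ^ (j + 1) * q + i := by
  unfold digitMate
  rw [mul_comm, Nat.mul_add_div (by positivity), Nat.div_eq_of_lt (Nat.mod_lt _ (by positivity)),
    add_zero]

theorem digitMate_mod {q j d i : ℕ} : digitMate q j d i % q ^ j = d % q ^ j := by
  unfold digitMate
  rw [Nat.mul_add_mod_self_right, Nat.mod_mod]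

theorem digitMate_div_succ {q j d i : ℕ} (hi : i < q) : digitMate q j d i / q ^ (j + 1) =
    d / q ^ (j + 1) := by
  have hq : 0 < q := by omega
  rw [pow_succ q j, ← Nat.div_div_eq_div_mul, digitMate_div hq, ← pow_succ, mul_comm,
    Nat.mul_add_div hq, Nat.div_eq_of_lt hi, add_zero]

theorem lt_pow_of_div_eq {q j m d e : ℕ} (hq : 0 < q) (hj : j ≤ m) (hd : d < q ^ m)
    (h : e / q ^ j = d / q ^ j) : e < q ^ m := by
  obtain ⟨k, rfl⟩ := Nat.exists_eq_add_of_le hj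
  rw [pow_add] at hd ⊢
  rw [mul_comm, ← Nat.div_lt_iff_lt_mul (by positivity)] at hd ⊢
  omega

/-- Prefix sums over the servers, by a butterfly network of degree `q`. -/
theorem cumulative_sums (R : Run init L Bd) {q m : ℕ} (hq : 0 < q) (hP : q ^ m ≤ p) (w : Ω → ℕ → ℕ)
    (hw : ∀ v < q ^ m, R.Knows v (fun ω => w ω v)) (hL : ∀ ω, q ≤ L ω)
    (hBd : ∀ ω, ∑ v ∈ Finset.range (q ^ m), w ω v ≤ Bd ω) :
    ∃ R' : Run init L Bd, R.Ext m R' ∧ ∀ v < q ^ m,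
      R'.Knows v (fun ω => ∑ u ∈ Finset.range v, w ω u) ∧
      R'.Knows v (fun ω => ∑ u ∈ Finset.range (q ^ m), w ω u) := by
  -- Invariant after `j` rounds: a server knows the total of its aligned block of `q ^ j` servers
  -- and the sum over the servers before it in this block.
  have main : ∀ j ≤ m, ∃ R' : Run init L Bd, R.Ext j R' ∧ ∀ v < q ^ m,
      R'.Knows v (fun ω => ∑ u ∈ Finset.Ico (v / q ^ j * q ^ j) v, w ω u) ∧
      R'.Knows v (fun ω =>
        ∑ u ∈ Finset.Ico (v / q ^ j * q ^ j) (v / q ^ j * q ^ j + q ^ j), w ω u) := by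
    intro j
    induction j with
    | zero =>
      intro _
      refine ⟨R, Ext.refl R, fun v hv => ⟨?_, ?_⟩⟩
      · intro ω ω' _; simp
      · intro ω ω' h; simpa using hw v hv ω ω' h
    | succ j ih =>
      intro hj
      obtain ⟨R₁, e₁, h₁⟩ := ih (by omega)
      -- Servers that differ at most in digit `j` to base `q` exchange their block totals. A server
      -- thus hears once from each of the `q` sub-blocks of its next larger block, and its load is
      -- `q`.
      let cond : ℕ → ℕ → Prop := fun v d => v < q ^ m ∧ d < q ^ m ∧
        v / q ^ (j + 1) = d / q ^ (j + 1) ∧ v % q ^ j = d % q ^ j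
      let blk : ℕ → Ω → ℕ := fun v ω =>
        ∑ u ∈ Finset.Ico (v / q ^ j * q ^ j) (v / q ^ j * q ^ j + q ^ j), w ω u
      classical
      obtain ⟨R₂, e₂, h₂, -⟩ := R₁.step
        (fun v d ω => if cond v d then [Word.int (blk v ω)] else [])
        (by
          intro v _ d _ ω ω' he
          by_cases hc : cond v d
          · simp only [hc, if_true]
            rw [show blk v ω = blk v ω' from (h₁ v hc.1).2 ω ω' he]
          · simp [hc])
        (by intro v _ d _ ω t; by_cases hc : cond v d <;> simp [hc])
        (by
          intro v _ d _ ω n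
          by_cases hc : cond v d
          · simp only [hc, if_true, List.mem_singleton, Word.int.injEq]
            rintro rfl
            refine le_trans (Finset.sum_le_sum_of_subset ?_) (hBd ω)
            intro u hu
            simp only [Finset.mem_Ico] at hu
            rw [Finset.mem_range]
            refine lt_pow_of_div_eq (j := j) hq (by omega) hc.1 ?_
            exact Nat.div_eq_of_lt_le hu.1 (by rw [add_mul, one_mul]; exact hu.2)
          · simp [hc])
        (by
          intro d hd ω
          refine le_trans ?_ (hL ω)
          have : ∀ v, (if cond v d then [Word.int (T := T) (blk v ω)] else []).length =
              if cond v d then 1 else 0 := by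
            intro v; split_ifs <;> rfl
          simp only [this]
          rw [← Finset.card_filter]
          refine (Finset.card_le_card_of_injOn (t := Finset.range q) (fun v => v / q ^ j % q) ?_ ?_).trans
            (Finset.card_range q).le
          · intro v _
            simpa using Nat.mod_lt _ hq
          · intro v hv v' hv' heq
            simp only [Finset.coe_filter, Finset.mem_range, Set.mem_ofPred_eq] at hv hv'
            simp only at heq
            have a1 := hv.2.2.2.1
            have a2 := hv'.2.2.2.1
            rw [pow_succ, ← Nat.div_div_eq_div_mul, ← Nat.div_div_eq_div_mul] at a1 a2
            have b1 := Nat.div_add_mod (v / q ^ j) q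
            have b2 := Nat.div_add_mod (v' / q ^ j) q
            have c1 : v / q ^ j = v' / q ^ j := by rw [← b1, ← b2, a1, a2, heq]
            rw [← Nat.div_add_mod v (q ^ j), ← Nat.div_add_mod v' (q ^ j), c1, hv.2.2.2.2,
              hv'.2.2.2.2])
      refine ⟨R₂, e₁.trans e₂, fun d hd => ?_⟩
      have mate : ∀ i < q, R₂.Knows d (fun ω =>
          ∑ u ∈ Finset.Ico (d / q ^ (j + 1) * q ^ (j + 1) + i * q ^ j)
            (d / q ^ (j + 1) * q ^ (j + 1) + (i + 1) * q ^ j), w ω u) := by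
        intro i hi ω ω' he
        have hlt : digitMate q j d i < q ^ m :=
          lt_pow_of_div_eq hq hj hd (digitMate_div_succ hi)
        have hc : cond (digitMate q j d i) d :=
          ⟨hlt, hd, digitMate_div_succ hi, digitMate_mod⟩
        have := h₂ _ (hlt.trans_le hP) d (hd.trans_le hP) ω ω' he
        simp only [hc, if_true, List.cons.injEq, Word.int.injEq, and_true, blk,
          digitMate_div hq] at this
        have e1 : (d / q ^ (j + 1) * q + i) * q ^ j =
            d / q ^ (j + 1) * q ^ (j + 1) + i * q ^ j := by ring
        have e2 : d / q ^ (j + 1) * q ^ (j + 1) + i * q ^ j + q ^ j =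
            d / q ^ (j + 1) * q ^ (j + 1) + (i + 1) * q ^ j := by ring
        rwa [e1, e2] at this
      have hdiv : d / q ^ j * q ^ j =
          d / q ^ (j + 1) * q ^ (j + 1) + d / q ^ j % q * q ^ j := by
        have := Nat.div_add_mod (d / q ^ j) q
        rw [Nat.div_div_eq_div_mul, ← pow_succ] at this
        nth_rewrite 1 [← this]
        ring
      constructor
      · intro ω ω' he
        -- The new prefix consists of the complete sub-blocks with a smaller digit `j`, followed by
        -- the old prefix.
        have key : ∀ ω, ∑ u ∈ Finset.Ico (d / q ^ (j + 1) * q ^ (j + 1)) d, w ω u =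
            (∑ i ∈ Finset.range (d / q ^ j % q),
              ∑ u ∈ Finset.Ico (d / q ^ (j + 1) * q ^ (j + 1) + i * q ^ j)
                (d / q ^ (j + 1) * q ^ (j + 1) + (i + 1) * q ^ j), w ω u) +
            ∑ u ∈ Finset.Ico (d / q ^ j * q ^ j) d, w ω u := by
          intro ω
          rw [sum_Ico_blocks, ← hdiv, Finset.sum_Ico_consecutive]
          · rw [hdiv]; exact Nat.le_add_right _ _
          · exact Nat.div_mul_le_self _ _
        simp only [key]
        refine congrArg₂ _ ?_ ((h₁ d hd).1 ω ω' (e₂.know d ω ω' he))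
        refine Finset.sum_congr rfl fun i hi => ?_
        rw [Finset.mem_range] at hi
        exact mate i (hi.trans (Nat.mod_lt _ hq)) ω ω' he
      · intro ω ω' he
        have e3 : d / q ^ (j + 1) * q ^ (j + 1) + q ^ (j + 1) =
            d / q ^ (j + 1) * q ^ (j + 1) + q * q ^ j := by ring
        simp only [e3, ← sum_Ico_blocks]
        refine Finset.sum_congr rfl fun i hi => ?_
        exact mate i (Finset.mem_range.1 hi) ω ω' he
  obtain ⟨R', e, h⟩ := main m le_rfl
  refine ⟨R', e, fun v hv => ?_⟩
  have := h v hv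
  simpa [Nat.div_eq_of_lt hv] using this

end Run

end MPC

/-! ### Combinatorics of sorting: placements, dealing and collecting -/

namespace MPC

section Positions

theorem mul_add_div_of_lt {q a b : ℕ} (hb : b < q) : (a * q + b) / q = a := by
  rw [mul_comm, Nat.mul_add_div (by omega), Nat.div_eq_of_lt hb, add_zero]

theorem mul_add_mod_of_lt {q a b : ℕ} (hb : b < q) : (a * q + b) % q = b := by
  rw [mul_comm, Nat.mul_add_mod, Nat.mod_eq_of_lt hb]

variable {U : Type*}

/-- `pos` places the elements of `S` at distinct positions below `tot`. -/
structure IsPlacement (S : Finset U) (tot : ℕ) (pos : U → ℕ) : Prop where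
  inj : Set.InjOn pos S
  lt : ∀ u ∈ S, pos u < tot

variable {S : Finset U} {tot N : ℕ} {pos : U → ℕ}

theorem IsPlacement.card_block_le (h : IsPlacement S tot pos) (hN : 0 < N) (B : ℕ) :
    (S.filter (fun u => pos u / N = B)).card ≤ N := by
  refine (Finset.card_le_card_of_injOn (t := Finset.range N) (fun u => pos u % N) ?_ ?_).trans
    (Finset.card_range N).le
  · intro u _
    simpa using Nat.mod_lt _ hN
  · intro u hu u' hu' e
    simp only [Finset.coe_filter, Set.mem_ofPred_eq] at hu hu'
    apply h.inj hu.1 hu'.1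
    rw [← Nat.div_add_mod (pos u) N, ← Nat.div_add_mod (pos u') N, hu.2, hu'.2]
    simp only at e
    rw [e]

/-- With as many elements as positions, `pos` is onto, so counting elements is counting positions.
This is why free slots are later filled with padding. -/
theorem IsPlacement.card_Ico (h : IsPlacement S tot pos) (hc : S.card = tot) {a b : ℕ}
    (hb : b ≤ tot) : (S.filter (fun u => a ≤ pos u ∧ pos u < b)).card = b - a := by
  have himg : S.image pos = Finset.range tot := by
    apply Finset.eq_of_subset_of_card_le
    · intro x hx
      obtain ⟨u, hu, rfl⟩ := Finset.mem_image.1 hx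
      exact Finset.mem_range.2 (h.lt u hu)
    · rw [Finset.card_image_of_injOn h.inj, hc, Finset.card_range]
  rw [← Nat.card_Ico a b, ← Finset.card_image_of_injOn (f := pos)
    (h.inj.mono (by intro u hu; simp at hu; exact hu.1))]
  congr 1
  ext x
  simp only [Finset.mem_image, Finset.mem_filter, Finset.mem_Ico]
  constructor
  · rintro ⟨u, ⟨_, h1⟩, rfl⟩; exact h1
  · intro hx
    have : x ∈ S.image pos := by rw [himg, Finset.mem_range]; omega
    obtain ⟨u, hu, rfl⟩ := Finset.mem_image.1 this
    exact ⟨u, ⟨hu, hx⟩, rfl⟩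

/-- An injection that preserves aligned blocks whose length divides `tot` cannot lead out of the
range. -/
theorem IsPlacement.comp (h : IsPlacement S tot pos) {σ : ℕ → ℕ} (hσ : Function.Injective σ)
    {M : ℕ} (hM : 0 < M) (hd : M ∣ tot) (hB : ∀ x, σ x / M = x / M) :
    IsPlacement S tot (fun u => σ (pos u)) where
  inj := fun _ hu _ hu' e => h.inj hu hu' (hσ e)
  lt := by
    intro u hu
    obtain ⟨k, rfl⟩ := hd
    rw [mul_comm, ← Nat.div_lt_iff_lt_mul hM, hB, Nat.div_lt_iff_lt_mul hM, mul_comm]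
    exact h.lt u hu

theorem card_split_columns {q B : ℕ} (hq : 0 < q) (f : U → ℕ) (A : Finset U) :
    (A.filter (fun u => f u / q = B)).card =
      ∑ c ∈ Finset.range q, (A.filter (fun u => f u = B * q + c)).card := by
  rw [Finset.card_eq_sum_card_fiberwise (f := fun u => f u % q) (t := Finset.range q)]
  · refine Finset.sum_congr rfl fun c hc => ?_
    rw [Finset.mem_range] at hc
    rw [Finset.filter_filter]
    congr 1
    refine Finset.filter_congr fun u _ => ?_
    constructor
    · rintro ⟨h1, h2⟩
      rw [← Nat.div_add_mod (f u) q, h1, h2, mul_comm]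
    · intro h
      rw [h]
      exact ⟨mul_add_div_of_lt hc, mul_add_mod_of_lt hc⟩
  · intro u _
    simpa using Nat.mod_lt _ hq

variable [LinearOrder U]



/-- The positions after sorting every block of `N` consecutive positions. -/
def sortPos (S : Finset U) (N : ℕ) (pos : U → ℕ) (u : U) : ℕ :=
  pos u / N * N + (S.filter (fun u' => pos u' / N = pos u / N ∧ u' < u)).card

theorem IsPlacement.count_lt (h : IsPlacement S tot pos) (hN : 0 < N) {u : U} (hu : u ∈ S) :
    (S.filter (fun u' => pos u' / N = pos u / N ∧ u' < u)).card < N := by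
  refine lt_of_lt_of_le (Finset.card_lt_card ?_) (h.card_block_le hN (pos u / N))
  refine ⟨fun u' hu' => ?_, fun hs => ?_⟩
  · simp only [Finset.mem_filter] at hu' ⊢
    exact ⟨hu'.1, hu'.2.1⟩
  · have : u ∈ S.filter (fun u' => pos u' / N = pos u / N ∧ u' < u) :=
      hs (by simp [hu])
    simp at this

theorem IsPlacement.sortPos_div (h : IsPlacement S tot pos) (hN : 0 < N) {u : U} (hu : u ∈ S) :
    sortPos S N pos u / N = pos u / N := by
  rw [sortPos, mul_comm, Nat.mul_add_div hN, Nat.div_eq_of_lt (h.count_lt hN hu), add_zero]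

theorem IsPlacement.sortPos_mod (h : IsPlacement S tot pos) (hN : 0 < N) {u : U} (hu : u ∈ S) :
    sortPos S N pos u % N = (S.filter (fun u' => pos u' / N = pos u / N ∧ u' < u)).card := by
  rw [sortPos, mul_comm, Nat.mul_add_mod, Nat.mod_eq_of_lt (h.count_lt hN hu)]

theorem sortPos_lt_sortPos {u u' : U} (hu : u ∈ S) (hB : pos u / N = pos u' / N) (hlt : u < u') :
    sortPos S N pos u < sortPos S N pos u' := by
  rw [sortPos, sortPos, hB]
  refine Nat.add_lt_add_left (Finset.card_lt_card ⟨fun x hx => ?_, fun hs => ?_⟩) _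
  · simp only [Finset.mem_filter] at hx ⊢
    exact ⟨hx.1, hx.2.1, hx.2.2.trans hlt⟩
  · have : u ∈ S.filter (fun x => pos x / N = pos u' / N ∧ x < u) := hs (by simp [hu, hB, hlt])
    simp at this

theorem IsPlacement.sortPos (h : IsPlacement S tot pos) (hN : 0 < N) (hd : N ∣ tot) :
    IsPlacement S tot (sortPos S N pos) where
  inj := by
    intro u hu u' hu' e
    have hB : pos u / N = pos u' / N := by
      rw [← h.sortPos_div hN hu, ← h.sortPos_div hN hu', e]
    rcases lt_trichotomy u u' with hl | rfl | hl
    · exact absurd e (sortPos_lt_sortPos hu hB hl).ne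
    · rfl
    · exact absurd e (sortPos_lt_sortPos hu' hB.symm hl).ne'
  lt := by
    intro u hu
    obtain ⟨k, rfl⟩ := hd
    rw [mul_comm, ← Nat.div_lt_iff_lt_mul hN, h.sortPos_div hN hu, Nat.div_lt_iff_lt_mul hN,
      mul_comm]
    exact h.lt u hu

/-- Deal the elements of every block of `N = q * K` positions round-robin to the `q` blocks of the
same block of `q * N` positions. -/
def dealPos (q K x : ℕ) : ℕ :=
  (x / (q * K) / q * q + x % (q * K) % q) * (q * K) + (x / (q * K) % q * K + x % (q * K) / q)

/-- Collect the elements of the `q` blocks of a block of `q * N` positions row by row. -/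
def collectPos (q N x : ℕ) : ℕ := x / N / q * (q * N) + (x % N * q + x / N % q)

theorem dealPos_snd_lt {q K x : ℕ} (hq : 0 < q) (hK : 0 < K) :
    x / (q * K) % q * K + x % (q * K) / q < q * K := by
  have h1 : x / (q * K) % q < q := Nat.mod_lt _ hq
  have h2 : x % (q * K) / q < K := by
    rw [Nat.div_lt_iff_lt_mul hq, mul_comm K q]; exact Nat.mod_lt _ (by positivity)
  calc _ < x / (q * K) % q * K + K := by omega
    _ = (x / (q * K) % q + 1) * K := by ring
    _ ≤ q * K := Nat.mul_le_mul_right _ h1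

theorem dealPos_div {q K x : ℕ} (hq : 0 < q) (hK : 0 < K) :
    dealPos q K x / (q * K) = x / (q * K) / q * q + x % (q * K) % q := by
  rw [dealPos, mul_comm _ (q * K), Nat.mul_add_div (by positivity),
    Nat.div_eq_of_lt (dealPos_snd_lt hq hK), add_zero]

theorem dealPos_mod {q K x : ℕ} (hq : 0 < q) (hK : 0 < K) :
    dealPos q K x % (q * K) = x / (q * K) % q * K + x % (q * K) / q := by
  rw [dealPos, mul_comm _ (q * K), Nat.mul_add_mod,
    Nat.mod_eq_of_lt (dealPos_snd_lt hq hK)]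

theorem mul_add_inj {q a b a' b' : ℕ} (hb : b < q) (hb' : b' < q)
    (h : a * q + b = a' * q + b') : a = a' ∧ b = b' := by
  constructor
  · rw [← mul_add_div_of_lt (a := a) hb, h, mul_add_div_of_lt hb']
  · rw [← mul_add_mod_of_lt (a := a) hb, h, mul_add_mod_of_lt hb']

theorem dealPos_injective {q K : ℕ} (hq : 0 < q) (hK : 0 < K) :
    Function.Injective (dealPos q K) := by
  intro x y h
  have hN : 0 < q * K := by positivity
  have h1 := congrArg (· / (q * K)) h
  have h2 := congrArg (· % (q * K)) h
  simp only [dealPos_div hq hK, dealPos_mod hq hK] at h1 h2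
  obtain ⟨a1, a2⟩ := mul_add_inj (Nat.mod_lt _ hq) (Nat.mod_lt _ hq) h1
  have hlt : ∀ x, x % (q * K) / q < K := fun x => by
    rw [Nat.div_lt_iff_lt_mul hq, mul_comm K q]; exact Nat.mod_lt _ hN
  obtain ⟨b1, b2⟩ := mul_add_inj (hlt x) (hlt y) h2
  have c1 : x / (q * K) = y / (q * K) := by
    rw [← Nat.div_add_mod (x / (q * K)) q, a1, b1, Nat.div_add_mod]
  have c2 : x % (q * K) = y % (q * K) := by
    rw [← Nat.div_add_mod (x % (q * K)) q, a2, b2, Nat.div_add_mod]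
  rw [← Nat.div_add_mod x (q * K), c1, c2, Nat.div_add_mod]

theorem collectPos_snd_lt {q N x : ℕ} (hq : 0 < q) (hN : 0 < N) :
    x % N * q + x / N % q < q * N := by
  have h1 := Nat.mod_lt x hN
  have h2 := Nat.mod_lt (x / N) hq
  calc _ < x % N * q + q := by omega
    _ = q * (x % N + 1) := by ring
    _ ≤ q * N := Nat.mul_le_mul_left _ h1

theorem collectPos_div {q N x : ℕ} (hq : 0 < q) (hN : 0 < N) :
    collectPos q N x / (q * N) = x / N / q := by
  rw [collectPos, mul_add_div_of_lt (collectPos_snd_lt hq hN)]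

theorem collectPos_injective {q N : ℕ} (hq : 0 < q) (hN : 0 < N) :
    Function.Injective (collectPos q N) := by
  intro x y h
  obtain ⟨a1, a2⟩ := mul_add_inj (collectPos_snd_lt hq hN) (collectPos_snd_lt hq hN) h
  obtain ⟨b1, b2⟩ := mul_add_inj (Nat.mod_lt _ hq) (Nat.mod_lt _ hq) a2
  have c1 : x / N = y / N := by
    rw [← Nat.div_add_mod (x / N) q, a1, b2, Nat.div_add_mod]
  rw [← Nat.div_add_mod x N, c1, b1, Nat.div_add_mod]

theorem card_filter_mod_bounds {q c : ℕ} (hq : 0 < q) (hc : c < q) (z : ℕ) :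
    q * ((Finset.range z).filter (fun i => i % q = c)).card ≤ z + q ∧
      z ≤ q * ((Finset.range z).filter (fun i => i % q = c)).card + q := by
  have h := Nat.count_modEq_card z hq c
  rw [Nat.count_eq_card_filter_range] at h
  have e : (Finset.range z).filter (fun i => i ≡ c [MOD q]) =
      (Finset.range z).filter (fun i => i % q = c) := by
    refine Finset.filter_congr fun i _ => ?_
    rw [Nat.ModEq, Nat.mod_eq_of_lt hc]
  rw [e] at h
  rw [h]
  have h1 := Nat.div_add_mod z q
  have h2 := Nat.mod_lt z hq
  split_ifs <;> rw [mul_add] <;> constructor <;> omega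

/-- In a sorted block, the elements below `u` whose index has residue `c` modulo `q` are about one
`q`-th of the elements below `u`. -/
theorem IsPlacement.card_residue (h : IsPlacement S tot pos) (hN : 0 < N) {q c : ℕ} (hq : 0 < q)
    (hc : c < q) (B : ℕ) (u : U) :
    let y := (S.filter (fun u' => pos u' / N = B ∧ u' < u ∧ MPC.sortPos S N pos u' % N % q = c)).card
    let z := (S.filter (fun u' => pos u' / N = B ∧ u' < u)).card
    q * y ≤ z + q ∧ z ≤ q * y + q := by
  intro y z
  set Z := S.filter (fun u' => pos u' / N = B ∧ u' < u) with hZ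
  have hinj : Set.InjOn (fun u' => MPC.sortPos S N pos u' % N) Z := by
    intro a ha b hb e
    simp only [hZ, Finset.coe_filter, Set.mem_ofPred_eq] at ha hb
    simp only at e
    have hBab : pos a / N = pos b / N := by rw [ha.2.1, hb.2.1]
    have hdiv : MPC.sortPos S N pos a / N = MPC.sortPos S N pos b / N := by
      rw [h.sortPos_div hN ha.1, h.sortPos_div hN hb.1, hBab]
    have he : MPC.sortPos S N pos a = MPC.sortPos S N pos b := by
      rw [← Nat.div_add_mod (MPC.sortPos S N pos a) N, hdiv, e, Nat.div_add_mod]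
    rcases lt_trichotomy a b with hl | rfl | hl
    · exact absurd he (sortPos_lt_sortPos ha.1 hBab hl).ne
    · rfl
    · exact absurd he (sortPos_lt_sortPos hb.1 hBab.symm hl).ne'
  have himg : Z.image (fun u' => MPC.sortPos S N pos u' % N) = Finset.range z := by
    apply Finset.eq_of_subset_of_card_le
    · intro x hx
      obtain ⟨a, ha, rfl⟩ := Finset.mem_image.1 hx
      have ha' := ha
      simp only [hZ, Finset.mem_filter] at ha
      rw [Finset.mem_range, h.sortPos_mod hN ha.1]
      refine Finset.card_lt_card ⟨fun b hb => ?_, fun hs => ?_⟩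
      · simp only [Finset.mem_filter] at hb ⊢
        exact ⟨hb.1, by rw [hb.2.1, ha.2.1], hb.2.2.trans ha.2.2⟩
      · have := hs ha'
        simp at this
    · rw [Finset.card_image_of_injOn hinj, Finset.card_range]
  have hy : y = ((Finset.range z).filter (fun i => i % q = c)).card := by
    rw [← himg, Finset.filter_image, Finset.card_image_of_injOn
      (hinj.mono (by intro a ha; simp only [Finset.coe_filter, Set.mem_ofPred_eq] at ha; exact ha.1)),
      hZ, Finset.filter_filter]
    simp only [y, and_assoc]
  rw [hy]
  exact card_filter_mod_bounds hq hc z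

/-- After sorting the blocks of size `N`, dealing, sorting again and collecting, every element is
close to its place in the sorted block of size `q * N`. -/
theorem IsPlacement.collect_near {q K : ℕ} (h : IsPlacement S tot pos) (hq : 0 < q) (hK : 0 < K)
    (hd : q * (q * K) ∣ tot) :
    let pos₂ := fun u => dealPos q K (MPC.sortPos S (q * K) pos u)
    let pos₄ := fun u => collectPos q (q * K) (MPC.sortPos S (q * K) pos₂ u)
    IsPlacement S tot pos₂ ∧ IsPlacement S tot pos₄ ∧
    ∀ u ∈ S, pos₄ u / (q * (q * K)) = pos u / (q * (q * K)) ∧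
      pos₄ u ≤ MPC.sortPos S (q * (q * K)) pos u + 2 * q ^ 2 ∧
      MPC.sortPos S (q * (q * K)) pos u ≤ pos₄ u + 2 * q ^ 2 := by
  intro pos₂ pos₄
  set N := q * K with hNdef
  have hN : 0 < N := by positivity
  have hdN : N ∣ tot := (Dvd.intro_left q rfl).trans hd
  have h1 := h.sortPos hN hdN
  have hdiv2 : ∀ u ∈ S, pos₂ u / N = pos u / N / q * q + MPC.sortPos S N pos u % N % q := by
    intro u hu
    simp only [pos₂]
    rw [hNdef, dealPos_div hq hK, ← hNdef, h.sortPos_div hN hu]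
  have h2 : IsPlacement S tot pos₂ := by
    refine h1.comp (dealPos_injective hq hK) (M := q * N) (by positivity) hd fun x => ?_
    have e := dealPos_div (x := x) hq hK
    rw [← hNdef] at e
    rw [mul_comm q N, ← Nat.div_div_eq_div_mul _ N q, ← Nat.div_div_eq_div_mul x N q, e,
      mul_add_div_of_lt (Nat.mod_lt _ hq)]
  have h3 := h2.sortPos hN hdN
  have h4 : IsPlacement S tot pos₄ := by
    refine h3.comp (collectPos_injective hq hN) (M := q * N) (by positivity) hd fun x => ?_
    rw [collectPos_div hq hN, Nat.div_div_eq_div_mul, mul_comm]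
  refine ⟨h2, h4, fun u hu => ?_⟩
  -- Dealing sends the element to block `c'` of its big block `B`, and `i` is its rank there after
  -- the second sort. Collecting row by row puts it at offset `i * q + c'`, to be compared with its
  -- true rank `R` in the big block.
  set c' := MPC.sortPos S N pos u % N % q with hc'
  have hc'q : c' < q := Nat.mod_lt _ hq
  set B := pos u / N / q with hB
  have hBM : pos u / (q * N) = B := by rw [mul_comm, ← Nat.div_div_eq_div_mul]
  have hdiv3 : MPC.sortPos S N pos₂ u / N = B * q + c' := by
    rw [h2.sortPos_div hN hu, hdiv2 u hu]
  set i := MPC.sortPos S N pos₂ u % N with hi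
  have hpos4 : pos₄ u = B * (q * N) + (i * q + c') := by
    simp only [pos₄, collectPos]
    rw [hdiv3, mul_add_div_of_lt hc'q, mul_add_mod_of_lt hc'q]
  have hdiv4 : pos₄ u / (q * N) = B := by
    simp only [pos₄]
    rw [collectPos_div hq hN, hdiv3, mul_add_div_of_lt hc'q]
  set R := (S.filter (fun u' => pos u' / (q * N) = pos u / (q * N) ∧ u' < u)).card with hR
  have hsort : MPC.sortPos S (q * N) pos u = B * (q * N) + R := by
    rw [MPC.sortPos, hR, hBM]
  have hRsum : R = ∑ c ∈ Finset.range q,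
      (S.filter (fun u' => pos u' / N = B * q + c ∧ u' < u)).card := by
    have := card_split_columns (B := B) hq (fun u' => pos u' / N) (S.filter (fun u' => u' < u))
    simp only [Finset.filter_filter] at this
    rw [hR, hBM]
    simp only [mul_comm q N, ← Nat.div_div_eq_div_mul]
    simpa only [and_comm] using this
  -- `R` counts the smaller elements in the `q` blocks of the big block, `i` only those whose index
  -- in their sorted block has residue `c'`. By `card_residue` every block contributes to `q * i`
  -- its share of `R` up to `q`, so the two differ by at most `q ^ 2`.
  have hisum : i = ∑ c ∈ Finset.range q, (S.filter (fun u' => pos u' / N = B * q + c ∧ u' < u ∧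
      MPC.sortPos S N pos u' % N % q = c')).card := by
    have := card_split_columns (B := B) hq (fun u' => pos u' / N)
      (S.filter (fun u' => u' < u ∧ MPC.sortPos S N pos u' % N % q = c'))
    simp only [Finset.filter_filter] at this
    rw [hi, h2.sortPos_mod hN hu, hdiv2 u hu]
    refine Eq.trans ?_ (this.trans (Finset.sum_congr rfl fun c _ => ?_))
    · congr 1
      refine Finset.filter_congr fun u' hu' => ?_
      rw [hdiv2 u' hu']
      constructor
      · rintro ⟨e, hl⟩
        obtain ⟨e1, e2⟩ := mul_add_inj (Nat.mod_lt _ hq) (Nat.mod_lt _ hq) e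
        exact ⟨⟨hl, e2⟩, e1⟩
      · rintro ⟨⟨hl, e2⟩, e1⟩
        exact ⟨by rw [e1, e2], hl⟩
    · congr 1
      refine Finset.filter_congr fun u' _ => ?_
      tauto
  have hb1 : q * i ≤ R + q * q := by
    rw [hisum, hRsum, Finset.mul_sum]
    calc _ ≤ ∑ c ∈ Finset.range q,
        ((S.filter (fun u' => pos u' / N = B * q + c ∧ u' < u)).card + q) :=
          Finset.sum_le_sum fun c _ => (h.card_residue hN hq hc'q (B * q + c) u).1
      _ = _ := by rw [Finset.sum_add_distrib]; simp
  have hb2 : R ≤ q * i + q * q := by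
    rw [hisum, hRsum, Finset.mul_sum]
    calc _ ≤ ∑ c ∈ Finset.range q, (q * (S.filter (fun u' => pos u' / N = B * q + c ∧ u' < u ∧
        MPC.sortPos S N pos u' % N % q = c')).card + q) :=
          Finset.sum_le_sum fun c _ => (h.card_residue hN hq hc'q (B * q + c) u).2
      _ = _ := by rw [Finset.sum_add_distrib]; simp
  have hqq : q ≤ q * q := Nat.le_mul_self q
  rw [hdiv4, hBM, hpos4, hsort]
  -- As `c' < q`, the total error is at most `q ^ 2 + q ≤ 2 * q ^ 2`.
  refine ⟨rfl, ?_, ?_⟩ <;> nlinarith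

/-- The place in the sorted block, computed from the elements on the neighbouring servers. -/
def nearPos (S : Finset U) (n M : ℕ) (pos : U → ℕ) (u : U) : ℕ :=
  max (pos u / M * M) ((pos u / n - 1) * n) +
    (S.filter (fun u' => (pos u' / M = pos u / M ∧ u' < u) ∧
      pos u / n ≤ pos u' / n + 1 ∧ pos u' / n ≤ pos u / n + 1)).card

/-- If every element is at most `E` from its place, two elements of a block that sit at least two
servers apart are more than `n ≥ 2 * E` positions apart and hence in the right order. So only the
elements on the own and the two adjacent servers need to be compared; all earlier ones in the block
are smaller and all later ones larger. -/
theorem IsPlacement.nearPos_eq (h : IsPlacement S tot pos) (hc : S.card = tot) {n M E : ℕ}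
    (hn : 0 < n) (hM : 0 < M) (hE : 2 * E ≤ n)
    (hlo : ∀ u ∈ S, pos u ≤ MPC.sortPos S M pos u + E)
    (hhi : ∀ u ∈ S, MPC.sortPos S M pos u ≤ pos u + E) {u : U} (hu : u ∈ S) :
    nearPos S n M pos u = MPC.sortPos S M pos u := by
  have hord : ∀ a ∈ S, ∀ b ∈ S, pos a / M = pos b / M → pos a / n + 1 < pos b / n → a < b := by
    intro a ha b hb hab hlt
    by_contra hcon
    have hle : MPC.sortPos S M pos b ≤ MPC.sortPos S M pos a := by
      rcases (not_lt.1 hcon).lt_or_eq with hl | rfl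
      · exact (sortPos_lt_sortPos hb hab.symm hl).le
      · exact le_rfl
    have e1 := hlo b hb
    have e2 := hhi a ha
    have e3 := Nat.lt_div_mul_add (a := pos a) hn
    have e4 := Nat.div_mul_le_self (pos b) n
    have e5 : (pos a / n + 2) * n ≤ pos b / n * n := Nat.mul_le_mul_right _ hlt
    rw [add_mul] at e5
    omega
  set v := pos u / n with hv
  set B := pos u / M with hB
  rw [nearPos, MPC.sortPos, ← hv, ← hB,
    ← Finset.card_filter_add_card_filter_not (s := S.filter (fun u' => pos u' / M = B ∧ u' < u))
      (fun u' => v ≤ pos u' / n + 1 ∧ pos u' / n ≤ v + 1)]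
  rw [Finset.filter_filter, Finset.filter_filter]
  -- The smaller elements beyond the neighbours fill exactly the positions of the block before
  -- server `v - 1`. Truncated subtraction covers server 0 and blocks that start later, and produces
  -- the `max` in `nearPos`.
  have key : (S.filter (fun u' => (pos u' / M = B ∧ u' < u) ∧
      ¬ (v ≤ pos u' / n + 1 ∧ pos u' / n ≤ v + 1))).card = (v - 1) * n - B * M := by
    have hvt : (v - 1) * n ≤ tot := by
      have h1 : (v - 1) * n ≤ v * n := Nat.mul_le_mul_right _ (Nat.sub_le _ _)
      have h2 := Nat.div_mul_le_self (pos u) n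
      have h3 := h.lt u hu
      rw [← hv] at h2
      omega
    rw [← h.card_Ico hc hvt]
    congr 1
    refine Finset.filter_congr fun a ha => ?_
    constructor
    · rintro ⟨⟨h1, h2⟩, h3⟩
      rw [not_and_or, not_le, not_le] at h3
      rcases h3 with h3 | h3
      · refine ⟨by rw [← h1]; exact Nat.div_mul_le_self _ _, ?_⟩
        rw [← Nat.div_lt_iff_lt_mul hn]
        exact Nat.lt_sub_of_add_lt h3
      · exact absurd h2 (hord u hu a ha (by rw [h1]) h3).not_gt
    · rintro ⟨h1, h2⟩
      rw [← Nat.div_lt_iff_lt_mul hn] at h2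
      have h2' : pos a / n + 1 < v := Nat.add_lt_of_lt_sub h2
      have h3 : pos a / M = B := by
        refine Nat.div_eq_of_lt_le h1 ?_
        have e1 : pos a < v * n := by
          rw [← Nat.div_lt_iff_lt_mul hn]; exact (Nat.lt_succ_self _).trans h2'
        have e2 := Nat.div_mul_le_self (pos u) n
        have e3 := Nat.lt_div_mul_add (a := pos u) hM
        rw [← hB] at e3
        rw [add_mul, one_mul]
        rw [← hv] at e2
        omega
      exact ⟨⟨h3, hord a ha u hu (by rw [h3]) h2'⟩, fun hh => hh.1.not_gt h2'⟩
  rw [key]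
  omega

end Positions

end MPC

/-! ### Sorting in a constant number of rounds -/

namespace MPC

namespace Run

variable {p : ℕ} {T Ω : Type*} {init : Ω → Fin p → Finset T} {L Bd : Ω → ℕ}
variable {U : Type*} [LinearOrder U]
set_option linter.unusedSectionVars false

/-- The number of rounds for sorting blocks of `q ^ j` servers. -/
def sortRounds : ℕ → ℕ
  | 0 => 0
  | j + 1 => sortRounds j + 1 + sortRounds j + 1 + 1 + 1

/-- Everything fixed during sorting: every one of `q ^ m` servers has room for `n` elements. -/
structure SortSetting (p : ℕ) (L Bd : Ω → ℕ) (q m b : ℕ) (n : Ω → ℕ) (S : Ω → Finset U)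
    (car : U → Set T) (enc : U → ℕ → List (Word T)) : Prop where
  hq : 0 < q
  hP : q ^ m ≤ p
  codec : IsCodec car enc b
  four_sq_le : ∀ ω, 4 * q ^ 2 ≤ n ω
  dvd : ∀ ω, q ∣ n ω
  card : ∀ ω, (S ω).card = q ^ m * n ω
  ints : ∀ ω, ∀ u ∈ S ω, ∀ x < q ^ m * n ω, ∀ k, Word.int k ∈ enc u x → k ≤ Bd ω
  two_le : ∀ ω, 2 ≤ Bd ω
  load : ∀ ω, (b + 1) * (3 * n ω) ≤ L ω

variable {q m b : ℕ} {n : Ω → ℕ} {S : Ω → Finset U} {car : U → Set T}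
  {enc : U → ℕ → List (Word T)} {R : Run init L Bd}

theorem SortSetting.n_pos (s : SortSetting p L Bd q m b n S car enc) (ω : Ω) : 0 < n ω := by
  have h1 := s.four_sq_le ω
  have h2 : 0 < q ^ 2 := by have := s.hq; positivity
  omega

theorem SortSetting.move (s : SortSetting p L Bd q m b n S car enc) {o pos : Ω → U → ℕ}
    (hn : ∀ v < q ^ m, R.Knows v n)
    (hpos : ∀ ω, IsPlacement (S ω) (q ^ m * n ω) (pos ω)) (h : R.Own (q ^ m) car S o pos) :
    ∃ R', R.Ext 1 R' ∧ R'.Own (q ^ m) car S (fun ω u => pos ω u / n ω) pos := by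
  refine h.move s.hP _ ?_ ?_ s.codec ?_ ?_
  · intro ω u hu
    rw [Nat.div_lt_iff_lt_mul (s.n_pos ω)]
    exact (hpos ω).lt u hu
  · intro v hv ω ω' he u _ _ _ _ hf
    rw [hf, hn v hv ω ω' he]
  · intro ω u hu k hk
    exact s.ints ω u hu _ ((hpos ω).lt u hu) k hk
  · intro ω d _
    refine le_trans ?_ (s.load ω)
    exact Nat.mul_le_mul (by omega) (((hpos ω).card_block_le (s.n_pos ω) d).trans (by omega))

/-- Every element is copied to the server of its position and to the two adjacent servers. Since
`nearPos` inspects only elements at most one server away, it then becomes a local computation. -/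
theorem SortSetting.neighbours (s : SortSetting p L Bd q m b n S car enc) {pos : Ω → U → ℕ}
    (hn : ∀ v < q ^ m, R.Knows v n)
    (hpos : ∀ ω, IsPlacement (S ω) (q ^ m * n ω) (pos ω))
    (h : R.Own (q ^ m) car S (fun ω u => pos ω u / n ω) pos) (k : ℕ) :
    ∃ R', R.Ext 1 R' ∧ R'.Own (q ^ m) car S (fun ω u => pos ω u / n ω)
      (fun ω u => nearPos (S ω) (n ω) (k * n ω) (pos ω) u) := by
  -- The second component 0, 1, 2 stands for the shift -1, 0, 1; copies for servers outside the
  -- range are dropped.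
  let S' : Ω → Finset (U × ℕ) := fun ω => (S ω ×ˢ Finset.range 3).filter
    (fun x => 1 ≤ pos ω x.1 / n ω + x.2 ∧ pos ω x.1 / n ω + x.2 ≤ q ^ m)
  have memS' : ∀ ω x, x ∈ S' ω ↔ (x.1 ∈ S ω ∧ x.2 < 3) ∧
      1 ≤ pos ω x.1 / n ω + x.2 ∧ pos ω x.1 / n ω + x.2 ≤ q ^ m := by
    intro ω x
    simp [S']
  have hown : R.Own (q ^ m) (fun x : U × ℕ => car x.1) S' (fun ω x => pos ω x.1 / n ω)
      (fun ω x => pos ω x.1) := by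
    refine ⟨fun ω x hx => h.lt ω x.1 ((memS' ω x).1 hx).1.1, ?_, ?_⟩
    · intro v hv ω ω' he x hx ho
      rw [memS'] at hx
      obtain ⟨h1, h2, h3⟩ := h.know v hv ω ω' he x.1 hx.1.1 ho
      refine ⟨?_, h2, h3⟩
      rw [memS', h2, ← ho]
      exact ⟨⟨h1, hx.1.2⟩, hx.2⟩
    · intro ω x hx t ht
      exact h.has ω x.1 ((memS' ω x).1 hx).1.1 t ht
  have hcodec : IsCodec (fun x : U × ℕ => car x.1)
      (fun x a => enc x.1 a ++ [Word.int x.2]) (b + 1) := by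
    refine ⟨by omega, ?_, ?_, ?_⟩
    · intro i a
      simp [s.codec.len]
    · rintro ⟨i, k⟩ a ⟨i', k'⟩ a' e
      obtain ⟨e1, e2⟩ := List.append_inj' e rfl
      obtain ⟨rfl, rfl⟩ := s.codec.inj _ _ _ _ e1
      simp only [List.cons.injEq, Word.int.injEq, and_true] at e2
      simp [e2]
    · intro i a t
      simp [s.codec.tup]
  obtain ⟨R', e, h'⟩ := hown.move s.hP (fun ω x => pos ω x.1 / n ω + x.2 - 1)
    (by
      intro ω x hx
      rw [memS'] at hx
      omega)
    (by
      intro v hv ω ω' he u _ _ _ _ hf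
      rw [hf, hn v hv ω ω' he]) hcodec
    (by
      intro ω x hx k hk
      rw [memS'] at hx
      simp only [List.mem_append, List.mem_singleton, Word.int.injEq] at hk
      rcases hk with hk | rfl
      · exact s.ints ω x.1 hx.1.1 _ ((hpos ω).lt _ hx.1.1) k hk
      · have := s.two_le ω; omega)
    (by
      intro ω d _
      refine le_trans (Nat.mul_le_mul_left _ ?_) (s.load ω)
      rw [Finset.card_eq_sum_card_fiberwise (f := fun x => x.2) (t := Finset.range 3)]
      · refine (Finset.sum_le_card_nsmul _ _ (n ω) ?_).trans (by simp)
        intro δ _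
        refine le_trans ?_ ((hpos ω).card_block_le (s.n_pos ω) (d + 1 - δ))
        refine Finset.card_le_card_of_injOn (fun x => x.1) ?_ ?_
        · intro x hx
          simp only [Finset.coe_filter, Finset.mem_filter, Set.mem_ofPred_eq, memS'] at hx ⊢
          refine ⟨hx.1.1.1.1, ?_⟩
          generalize pos ω x.1 / n ω = y at *
          omega
        · intro x hx y hy hxy
          simp only [Finset.coe_filter, Finset.mem_filter, Set.mem_ofPred_eq] at hx hy
          exact Prod.ext hxy (hx.2.trans hy.2.symm)
      · intro x hx
        simp only [Finset.coe_filter, Set.mem_ofPred_eq, memS'] at hx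
        simpa using hx.1.1.2)
  refine ⟨R', e, (h.mono e).map _ ?_⟩
  intro v hv ω ω' he u hu hu' ho ho' hf
  have hnn : n ω = n ω' := (hn v hv).mono e ω ω' he
  have sub : ∀ ω ω', R'.vw ω v = R'.vw ω' v → pos ω u / n ω = v → pos ω' u / n ω' = v →
      pos ω u = pos ω' u → n ω = n ω' →
      (S ω).filter (fun u' => (pos ω u' / (k * n ω) = pos ω u / (k * n ω) ∧ u' < u) ∧
        pos ω u / n ω ≤ pos ω u' / n ω + 1 ∧ pos ω u' / n ω ≤ pos ω u / n ω + 1) ⊆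
      (S ω').filter (fun u' => (pos ω' u' / (k * n ω') = pos ω' u / (k * n ω') ∧ u' < u) ∧
        pos ω' u / n ω' ≤ pos ω' u' / n ω' + 1 ∧ pos ω' u' / n ω' ≤ pos ω' u / n ω' + 1) := by
    intro ω ω' he ho ho' hf hnn a ha
    rw [Finset.mem_filter] at ha ⊢
    obtain ⟨haS, ha1, ha2, ha3⟩ := ha
    have hx : (a, v + 1 - pos ω a / n ω) ∈ S' ω := by
      rw [memS']
      rw [ho] at ha2 ha3
      refine ⟨⟨haS, ?_⟩, ?_, ?_⟩ <;> simp only <;> omega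
    obtain ⟨h1, h2, h3⟩ := h'.know v hv ω ω' he _ hx (by
      rw [ho] at ha2 ha3
      simp only
      omega)
    simp only at h3
    rw [← hnn, ← hf, ← h3]
    exact ⟨((memS' _ _).1 h1).1.1, ha1, ha2, ha3⟩
  unfold nearPos
  rw [(sub ω ω' he ho ho' hf hnn).antisymm (sub ω' ω he.symm ho' ho hf.symm hnn.symm), hf, hnn]

/-- Sorting the blocks of `q ^ j` servers. -/
theorem SortSetting.sort_blocks (s : SortSetting p L Bd q m b n S car enc) :
    ∀ j ≤ m, ∀ (R : Run init L Bd) (pos : Ω → U → ℕ), (∀ v < q ^ m, R.Knows v n) →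
      (∀ ω, IsPlacement (S ω) (q ^ m * n ω) (pos ω)) →
      R.Own (q ^ m) car S (fun ω u => pos ω u / n ω) pos →
      ∃ R', R.Ext (sortRounds j) R' ∧
        R'.Own (q ^ m) car S (fun ω u => sortPos (S ω) (q ^ j * n ω) (pos ω) u / n ω)
          (fun ω u => sortPos (S ω) (q ^ j * n ω) (pos ω) u) := by
  intro j
  induction j with
  | zero =>
    intro _ R pos hn hpos h
    -- A block of one server is sorted locally, without communication.
    refine ⟨R, Ext.refl R, ?_⟩
    have h1 : R.Own (q ^ m) car S (fun ω u => pos ω u / n ω)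
        (fun ω u => sortPos (S ω) (q ^ 0 * n ω) (pos ω) u) := by
      refine h.map _ ?_
      intro v hv ω ω' he u hu hu' ho ho' hf
      have hnn := hn v hv ω ω' he
      have sub : ∀ ω ω', R.vw ω v = R.vw ω' v → pos ω u / n ω = v → pos ω' u / n ω' = v →
          (S ω).filter (fun u' => pos ω u' / n ω = pos ω u / n ω ∧ u' < u) ⊆
          (S ω').filter (fun u' => pos ω' u' / n ω' = pos ω' u / n ω' ∧ u' < u) := by
        intro ω ω' he ho ho' a ha
        rw [Finset.mem_filter] at ha ⊢
        rw [ho] at ha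
        obtain ⟨h1, h2, -⟩ := h.know v hv ω ω' he a ha.1 ha.2.1
        exact ⟨h1, by rw [ho']; exact h2, ha.2.2⟩
      simp only [sortPos, pow_zero, one_mul]
      rw [(sub ω ω' he ho ho').antisymm (sub ω' ω he.symm ho' ho), hf, hnn]
    refine h1.congr ?_ (fun _ _ _ => rfl)
    intro ω u hu
    rw [pow_zero, one_mul]
    exact (hpos ω).sortPos_div (s.n_pos ω) hu
  | succ j ih =>
    -- Two recursive sorts and four more rounds: deal, collect, consult the neighbours, and move to
    -- the corrected place. The number of rounds depends on `j` alone.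
    intro hj R pos hn hpos h
    have hq := s.hq
    have hK : ∀ ω, q ^ j * n ω = q * (q ^ j * (n ω / q)) := by
      intro ω
      obtain ⟨k, hk⟩ := s.dvd ω
      rw [hk, Nat.mul_div_cancel_left _ hq]; ring
    have hKpos : ∀ ω, 0 < q ^ j * (n ω / q) := by
      intro ω
      have := s.n_pos ω
      have h2 : 0 < n ω / q := Nat.div_pos (Nat.le_of_dvd this (s.dvd ω)) hq
      positivity
    have hNpos : ∀ i ω, 0 < q ^ i * n ω := fun i ω => by
      have := s.n_pos ω; positivity
    have hdvd : ∀ i ≤ m, ∀ ω, q ^ i * n ω ∣ q ^ m * n ω := fun i hi ω =>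
      Nat.mul_dvd_mul_right (pow_dvd_pow q hi) _
    have hM : ∀ ω, q ^ (j + 1) * n ω = q * (q * (q ^ j * (n ω / q))) := by
      intro ω; rw [← hK]; ring
    obtain ⟨R₁, e₁, h₁⟩ := ih (by omega) R pos hn hpos h
    have hn₁ : ∀ v < q ^ m, R₁.Knows v n := fun v hv => (hn v hv).mono e₁
    let pos₂ : Ω → U → ℕ := fun ω u =>
      dealPos q (q ^ j * (n ω / q)) (sortPos (S ω) (q ^ j * n ω) (pos ω) u)
    let pos₄ : Ω → U → ℕ := fun ω u =>
      collectPos q (q ^ j * n ω) (sortPos (S ω) (q ^ j * n ω) (pos₂ ω) u)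
    have near : ∀ ω, IsPlacement (S ω) (q ^ m * n ω) (pos₂ ω) ∧
        IsPlacement (S ω) (q ^ m * n ω) (pos₄ ω) ∧
        ∀ u ∈ S ω, pos₄ ω u / (q ^ (j + 1) * n ω) = pos ω u / (q ^ (j + 1) * n ω) ∧
          pos₄ ω u ≤ sortPos (S ω) (q ^ (j + 1) * n ω) (pos ω) u + 2 * q ^ 2 ∧
          sortPos (S ω) (q ^ (j + 1) * n ω) (pos ω) u ≤ pos₄ ω u + 2 * q ^ 2 := by
      intro ω
      have := (hpos ω).collect_near hq (hKpos ω) (by rw [← hM]; exact hdvd _ hj ω)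
      rw [← hM] at this
      simp only [pos₄, pos₂]
      simpa only [← hK] using this
    obtain ⟨R₂, e₂, h₂⟩ := s.move (pos := pos₂) hn₁ (fun ω => (near ω).1)
      (h₁.map pos₂ (by
        intro v hv ω ω' he u _ _ _ _ hf
        simp only [pos₂]
        rw [hf, hn₁ v hv ω ω' he]))
    have hn₂ : ∀ v < q ^ m, R₂.Knows v n := fun v hv => (hn₁ v hv).mono e₂
    obtain ⟨R₃, e₃, h₃⟩ := ih (by omega) R₂ pos₂ hn₂ (fun ω => (near ω).1) h₂
    have hn₃ : ∀ v < q ^ m, R₃.Knows v n := fun v hv => (hn₂ v hv).mono e₃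
    obtain ⟨R₄, e₄, h₄⟩ := s.move (pos := pos₄) hn₃ (fun ω => (near ω).2.1)
      (h₃.map pos₄ (by
        intro v hv ω ω' he u _ _ _ _ hf
        simp only [pos₄]
        rw [hf, hn₃ v hv ω ω' he]))
    have hn₄ : ∀ v < q ^ m, R₄.Knows v n := fun v hv => (hn₃ v hv).mono e₄
    obtain ⟨R₅, e₅, h₅⟩ := s.neighbours hn₄ (fun ω => (near ω).2.1) h₄ (q ^ (j + 1))
    -- Dealing and collecting never leave a block of `q ^ (j + 1)` servers, so sorting the collected
    -- placement is the same as sorting the original one.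
    have hsame : ∀ ω, ∀ u ∈ S ω, sortPos (S ω) (q ^ (j + 1) * n ω) (pos₄ ω) u =
        sortPos (S ω) (q ^ (j + 1) * n ω) (pos ω) u := by
      intro ω u hu
      unfold sortPos
      rw [((near ω).2.2 u hu).1]
      congr 2
      refine Finset.filter_congr fun a ha => ?_
      rw [((near ω).2.2 a ha).1]
    have hfin : ∀ ω, ∀ u ∈ S ω, nearPos (S ω) (n ω) (q ^ (j + 1) * n ω) (pos₄ ω) u =
        sortPos (S ω) (q ^ (j + 1) * n ω) (pos ω) u := by
      intro ω u hu
      rw [← hsame ω u hu]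
      refine (near ω).2.1.nearPos_eq (s.card ω) (E := 2 * q ^ 2) (s.n_pos ω) (hNpos _ ω) ?_ ?_ ?_ hu
      · have := s.four_sq_le ω; omega
      · intro a ha
        rw [hsame ω a ha]
        exact ((near ω).2.2 a ha).2.1
      · intro a ha
        rw [hsame ω a ha]
        exact ((near ω).2.2 a ha).2.2
    have h₅' := h₅.congr (f' := fun ω u => sortPos (S ω) (q ^ (j + 1) * n ω) (pos ω) u)
      (fun _ _ _ => rfl) (fun ω u hu => (hfin ω u hu).symm)
    obtain ⟨R₆, e₆, h₆⟩ := s.move (fun v hv => (hn₄ v hv).mono e₅)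
      (fun ω => (hpos ω).sortPos (hNpos _ ω) (hdvd _ hj ω)) h₅'
    exact ⟨R₆, ((((e₁.trans e₂).trans e₃).trans e₄).trans e₅).trans e₆, h₆⟩

end Run

end MPC

/-! ### Ranks of the tuples from sorting flagged copies -/

namespace MPC

set_option linter.unusedSectionVars false

/-- What is sorted: three copies of every tuple, with a flag and the owner, and padding. -/
inductive Item (T : Type*) where
  | real (t : T) (flag home : ℕ) : Item T
  | pad (x : ℕ) : Item T

namespace Item

variable {T κ : Type*}

/-- The sort key of a copy of a tuple. -/
def rankKey (k : T → κ) (x : T × ℕ) : κ ×ₗ ℕ ×ₗ T := toLex (k x.1, toLex (x.2, x.1))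

/-- The sort key of an item. -/
def key (k : T → κ) : Item T → ((κ ×ₗ ℕ ×ₗ T) ×ₗ ℕ) ⊕ₗ ℕ
  | real t f h => toLex (.inl (toLex (rankKey k (t, f), h)))
  | pad x => toLex (.inr x)

theorem rankKey_injective (k : T → κ) : Function.Injective (rankKey k) := by
  rintro ⟨t, f⟩ ⟨t', f'⟩ h
  simp only [rankKey, EmbeddingLike.apply_eq_iff_eq, Prod.mk.injEq] at h
  simp [h]

theorem key_injective (k : T → κ) : Function.Injective (key k) := by
  rintro (⟨t, f, h⟩ | x) (⟨t', f', h'⟩ | x') e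
  · simp only [key, EmbeddingLike.apply_eq_iff_eq, Sum.inl.injEq, Prod.mk.injEq] at e
    have := rankKey_injective k e.1
    simp only [Prod.mk.injEq] at this
    simp [this, e.2]
  · simp [key] at e
  · simp [key] at e
  · simpa [key] using e

/-- The order of the items by a key of the tuples, the flag and the tuple. -/
noncomputable abbrev order [LinearOrder T] [LinearOrder κ] (k : T → κ) : LinearOrder (Item T) :=
  LinearOrder.lift' (key k) (key_injective k)

/-- The tuple of an item. -/
def car : Item T → Set T
  | real t _ _ => {t}
  | pad _ => ∅

/-- The message that describes an item and a number. -/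
def enc : Item T → ℕ → List (Word T)
  | real t f h, x => [.tuple t, .int f, .int h, .int x]
  | pad y, x => [.int y, .int 0, .int 0, .int x]

theorem isCodec : Run.IsCodec (car (T := T)) enc 4 where
  pos := by norm_num
  len := by rintro (_ | _) _ <;> rfl
  inj := by
    rintro (⟨t, f, h⟩ | y) a (⟨t', f', h'⟩ | y') a' e <;> simp_all [enc]
  tup := by rintro (_ | _) a t <;> simp [enc, car]

end Item

section Queries

variable {T κ : Type*} [LinearOrder T] [LinearOrder κ]

/-- The total weight of the tuples whose key is less than `g`. -/
def below (S : Finset T) (k : T → κ) (w : T → ℕ) (g : κ) : ℕ := ∑ u ∈ S with k u < g, w u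

/-- The total weight of the tuples whose key is at most `g`. -/
def upto (S : Finset T) (k : T → κ) (w : T → ℕ) (g : κ) : ℕ := ∑ u ∈ S with k u ≤ g, w u

/-- The total weight of the tuples that precede `t`. -/
def before (S : Finset T) (k : T → κ) (w : T → ℕ) (t : T) : ℕ :=
  ∑ u ∈ S with k u < k t ∨ k u = k t ∧ u < t, w u

/-- The rank of a copy of a tuple. -/
def rank (S : Finset T) (k : T → κ) (x : T × ℕ) : ℕ :=
  ((S ×ˢ Finset.range 3).filter (fun y => Item.rankKey k y < Item.rankKey k x)).card

variable {S : Finset T} {k : T → κ}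

theorem rank_lt_rank {x y : T × ℕ} (hx : x ∈ S ×ˢ Finset.range 3)
    (h : Item.rankKey k x < Item.rankKey k y) : rank S k x < rank S k y := by
  refine Finset.card_lt_card ⟨fun z hz => ?_, fun hs => ?_⟩
  · simp only [Finset.mem_filter] at hz ⊢
    exact ⟨hz.1, hz.2.trans h⟩
  · have : x ∈ (S ×ˢ Finset.range 3).filter (fun y => Item.rankKey k y < Item.rankKey k x) :=
      hs (Finset.mem_filter.2 ⟨hx, h⟩)
    simp at this

theorem rank_lt_rank_iff {x y : T × ℕ} (hx : x ∈ S ×ˢ Finset.range 3)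
    (hy : y ∈ S ×ˢ Finset.range 3) :
    rank S k x < rank S k y ↔ Item.rankKey k x < Item.rankKey k y := by
  refine ⟨fun h => ?_, rank_lt_rank hx⟩
  by_contra hc
  rcases (not_lt.1 hc).lt_or_eq with h1 | h1
  · exact h.not_gt (rank_lt_rank hy h1)
  · rw [Item.rankKey_injective k h1] at h
    exact lt_irrefl _ h

theorem rank_injOn : Set.InjOn (rank S k) (S ×ˢ Finset.range 3 : Finset (T × ℕ)) := by
  intro x hx y hy e
  rcases lt_trichotomy (Item.rankKey k x) (Item.rankKey k y) with h | h | h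
  · exact absurd e (rank_lt_rank hx h).ne
  · exact Item.rankKey_injective k h
  · exact absurd e (rank_lt_rank hy h).ne'

theorem rank_lt {x : T × ℕ} (hx : x ∈ S ×ˢ Finset.range 3) : rank S k x < 3 * S.card := by
  have : (S ×ˢ Finset.range 3).card = 3 * S.card := by
    rw [Finset.card_product, Finset.card_range, mul_comm]
  rw [← this]
  refine Finset.card_lt_card ⟨Finset.filter_subset _ _, fun hs => ?_⟩
  have := hs hx
  simp at this

/-- The flag is compared between the key and the tuple. If the weights sit on the copies with flag
1, the weight preceding the copies of `t` with flags 0, 1, 2 is what `below`, `before` and `upto`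
ask for. -/
theorem rankKey_lt_iff {u t : T} {f f' : ℕ} : Item.rankKey k (u, f) < Item.rankKey k (t, f') ↔
    k u < k t ∨ k u = k t ∧ (f < f' ∨ f = f' ∧ u < t) := by
  simp [Item.rankKey, Prod.Lex.toLex_lt_toLex]

/-- Only the middle copy of a tuple carries its weight; the other two merely pose questions. -/
theorem sum_flag_one (w : T → ℕ) (Q : T × ℕ → Prop) [DecidablePred Q] :
    ∑ y ∈ (S ×ˢ Finset.range 3).filter Q, (if y.2 = 1 then w y.1 else 0) =
      ∑ u ∈ S with Q (u, 1), w u := by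
  rw [Finset.sum_filter, Finset.sum_product, Finset.sum_filter]
  refine Finset.sum_congr rfl fun u _ => ?_
  simp [Finset.sum_range_succ]

end Queries

namespace Run

variable {p : ℕ} {T Ω : Type*} {init : Ω → Fin p → Finset T} {L Bd : Ω → ℕ}
variable {κ : Type*} [LinearOrder T] [LinearOrder κ]

/-- The tuples of the instance and their owners, for computations on `q ^ m` servers in which every
server has room for `n` elements. -/
structure Env (p : ℕ) (L Bd : Ω → ℕ) (q m : ℕ) (n : Ω → ℕ) (tuples : Ω → Finset T)
    (home : Ω → T → ℕ) : Prop where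
  hq : 0 < q
  hP : q ^ m ≤ p
  four_sq_le : ∀ ω, 4 * q ^ 2 ≤ n ω
  dvd : ∀ ω, q ∣ n ω
  lt : ∀ ω, ∀ t ∈ tuples ω, home ω t < q ^ m
  card : ∀ ω v, 3 * ((tuples ω).filter (fun t => home ω t = v)).card ≤ n ω
  bd : ∀ ω, q ^ m * n ω ≤ Bd ω
  load : ∀ ω, 15 * n ω ≤ L ω

variable {q m : ℕ} {n : Ω → ℕ} {tuples : Ω → Finset T} {home : Ω → T → ℕ} {R R' : Run init L Bd}

/-- The owners of the tuples hold them, and `n` is known. -/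
structure Ready (R : Run init L Bd) (q m : ℕ) (n : Ω → ℕ) (tuples : Ω → Finset T)
    (home : Ω → T → ℕ) : Prop where
  own : R.Own (q ^ m) (fun t => {t}) tuples home (fun _ _ => ())
  n : ∀ v < q ^ m, R.Knows v n

theorem Ready.mono {c : ℕ} (h : R.Ready q m n tuples home) (e : R.Ext c R') :
    R'.Ready q m n tuples home :=
  ⟨h.own.mono e, fun v hv => (h.n v hv).mono e⟩

theorem Env.n_pos (E : Env p L Bd q m n tuples home) (ω : Ω) : 4 ≤ n ω := by
  have h1 := E.four_sq_le ω
  have h2 : 0 < q ^ 2 := by have := E.hq; positivity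
  omega

theorem Env.le_bd (E : Env p L Bd q m n tuples home) (ω : Ω) : n ω ≤ Bd ω ∧ q ^ m ≤ Bd ω := by
  have h1 := E.bd ω
  have h2 : 0 < q ^ m := by have := E.hq; positivity
  have h3 := E.n_pos ω
  exact ⟨le_trans (Nat.le_mul_of_pos_left _ h2) h1,
    le_trans (Nat.le_mul_of_pos_right _ (by omega)) h1⟩

theorem Env.card_tuples (E : Env p L Bd q m n tuples home) (ω : Ω) :
    3 * (tuples ω).card ≤ q ^ m * n ω := by
  rw [Finset.card_eq_sum_card_fiberwise (f := home ω) (t := Finset.range (q ^ m))]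
  · rw [Finset.mul_sum]
    refine (Finset.sum_le_card_nsmul _ _ (n ω) fun v _ => E.card ω v).trans (by simp)
  · intro t ht
    simpa using E.lt ω t ht

/-- The index of a tuple among those with the same owner. -/
def localIndex (tuples : Finset T) (home : T → ℕ) (t : T) (h : ℕ) : ℕ :=
  (tuples.filter (fun t' => home t' = h ∧ t' < t)).card

theorem localIndex_lt_localIndex {tuples : Finset T} {home : T → ℕ} {t t' : T} {h : ℕ}
    (ht : t ∈ tuples) (hh : home t = h) (hl : t < t') :
    localIndex tuples home t h < localIndex tuples home t' h := by
  refine Finset.card_lt_card ⟨fun x hx => ?_, fun hs => ?_⟩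
  · simp only [Finset.mem_filter] at hx ⊢
    exact ⟨hx.1, hx.2.1, hx.2.2.trans hl⟩
  · have : t ∈ tuples.filter (fun x => home x = h ∧ x < t) := hs (by simp [ht, hh, hl])
    simp at this

theorem localIndex_lt {tuples : Finset T} {home : T → ℕ} {t : T} {h : ℕ}
    (ht : t ∈ tuples) (hh : home t = h) :
    localIndex tuples home t h < (tuples.filter (fun t' => home t' = h)).card := by
  refine Finset.card_lt_card ⟨fun x hx => ?_, fun hs => ?_⟩
  · simp only [Finset.mem_filter] at hx ⊢
    exact ⟨hx.1, hx.2.1⟩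
  · have : t ∈ tuples.filter (fun x => home x = h ∧ x < t) := hs (by simp [ht, hh])
    simp at this

/-- The position of an item before sorting. -/
def startPos (n : ℕ) (tuples : Finset T) (home : T → ℕ) : Item T → ℕ
  | .real t f h => h * n + (3 * localIndex tuples home t h + f)
  | .pad x => x

open Classical in
/-- The copies of the tuples. -/
noncomputable def copies (tuples : Finset T) (home : T → ℕ) : Finset (Item T) :=
  (tuples ×ˢ Finset.range 3).image (fun x => Item.real x.1 x.2 (home x.1))

open Classical in
/-- All items on `P` servers: the copies of the tuples, and padding for the free positions. -/
noncomputable def items (P n : ℕ) (tuples : Finset T) (home : T → ℕ) : Finset (Item T) :=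
  copies tuples home ∪
    (Finset.range (P * n) \ (copies tuples home).image (startPos n tuples home)).image Item.pad

theorem mem_copies {tuples : Finset T} {home : T → ℕ} {t : T} {f h : ℕ} :
    Item.real t f h ∈ copies tuples home ↔ t ∈ tuples ∧ f < 3 ∧ h = home t := by
  simp only [copies, Finset.mem_image, Finset.mem_product, Finset.mem_range, Prod.exists,
    Item.real.injEq]
  constructor
  · rintro ⟨a, b, ⟨h1, h2⟩, rfl, rfl, rfl⟩; exact ⟨h1, h2, rfl⟩
  · rintro ⟨h1, h2, rfl⟩; exact ⟨t, f, ⟨h1, h2⟩, rfl, rfl, rfl⟩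

theorem pad_notMem_copies {tuples : Finset T} {home : T → ℕ} {x : ℕ} :
    Item.pad x ∉ copies tuples home := by
  simp [copies]

theorem real_mem_items {P n : ℕ} {tuples : Finset T} {home : T → ℕ} {t : T} {f h : ℕ} :
    Item.real t f h ∈ items P n tuples home ↔ t ∈ tuples ∧ f < 3 ∧ h = home t := by
  simp [items, mem_copies]

theorem pad_mem_items {P n : ℕ} {tuples : Finset T} {home : T → ℕ} {x : ℕ} :
    Item.pad x ∈ items P n tuples home ↔
      x < P * n ∧ ∀ t ∈ tuples, ∀ f < 3, startPos n tuples home (.real t f (home t)) ≠ x := by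
  simp only [items, Finset.mem_union, pad_notMem_copies, false_or, Finset.mem_image,
    Finset.mem_sdiff, Finset.mem_range, Item.pad.injEq, exists_eq_right]
  refine and_congr_right fun _ => ?_
  constructor
  · intro h t ht f hf he
    exact h ⟨_, mem_copies.2 ⟨ht, hf, rfl⟩, he⟩
  · rintro h ⟨a, ha, he⟩
    cases a with
    | real t f g =>
      obtain ⟨h1, h2, rfl⟩ := mem_copies.1 ha
      exact h t h1 f h2 he
    | pad y => exact pad_notMem_copies ha

theorem Env.startPos_snd_lt (E : Env p L Bd q m n tuples home) {ω : Ω} {t : T} {f : ℕ}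
    (ht : t ∈ tuples ω) (hf : f < 3) :
    3 * localIndex (tuples ω) (home ω) t (home ω t) + f < n ω := by
  have h1 := localIndex_lt (tuples := tuples ω) (home := home ω) ht rfl
  have h2 := E.card ω (home ω t)
  omega

theorem Env.startPos_div (E : Env p L Bd q m n tuples home) {ω : Ω} {t : T} {f : ℕ}
    (ht : t ∈ tuples ω) (hf : f < 3) :
    startPos (n ω) (tuples ω) (home ω) (.real t f (home ω t)) / n ω = home ω t :=
  mul_add_div_of_lt (E.startPos_snd_lt ht hf)

theorem Env.startPos_injective (E : Env p L Bd q m n tuples home) {ω : Ω} {t t' : T} {f f' : ℕ}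
    (ht : t ∈ tuples ω) (hf : f < 3) (ht' : t' ∈ tuples ω) (hf' : f' < 3)
    (e : startPos (n ω) (tuples ω) (home ω) (.real t f (home ω t)) =
      startPos (n ω) (tuples ω) (home ω) (.real t' f' (home ω t'))) : t = t' ∧ f = f' := by
  obtain ⟨h1, h2⟩ := mul_add_inj (E.startPos_snd_lt ht hf) (E.startPos_snd_lt ht' hf') e
  rw [← h1] at h2
  have h3 : localIndex (tuples ω) (home ω) t (home ω t) =
      localIndex (tuples ω) (home ω) t' (home ω t) := by omega
  refine ⟨?_, by omega⟩
  rcases lt_trichotomy t t' with h | h | h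
  · exact absurd h3 (localIndex_lt_localIndex ht rfl h).ne
  · exact h
  · exact absurd h3 (localIndex_lt_localIndex ht' h1.symm h).ne'

theorem Env.startPos_lt (E : Env p L Bd q m n tuples home) {ω : Ω} {t : T} {f : ℕ}
    (ht : t ∈ tuples ω) (hf : f < 3) :
    startPos (n ω) (tuples ω) (home ω) (.real t f (home ω t)) < q ^ m * n ω := by
  have := E.n_pos ω
  rw [← Nat.div_lt_iff_lt_mul (by omega), E.startPos_div ht hf]
  exact E.lt ω t ht

theorem Env.placement (E : Env p L Bd q m n tuples home) (ω : Ω) :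
    IsPlacement (items (q ^ m) (n ω) (tuples ω) (home ω)) (q ^ m * n ω)
      (startPos (n ω) (tuples ω) (home ω)) := by
  constructor
  · rintro (⟨t, f, h⟩ | x) hu (⟨t', f', h'⟩ | x') hu' e <;>
      simp only [Finset.mem_coe, real_mem_items, pad_mem_items] at hu hu'
    · obtain ⟨h1, h2, rfl⟩ := hu
      obtain ⟨h1', h2', rfl⟩ := hu'
      obtain ⟨rfl, rfl⟩ := E.startPos_injective h1 h2 h1' h2' e
      rfl
    · obtain ⟨h1, h2, rfl⟩ := hu
      exact absurd e (hu'.2 t h1 f h2)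
    · obtain ⟨h1, h2, rfl⟩ := hu'
      exact absurd e.symm (hu.2 t' h1 f' h2)
    · exact congrArg _ e
  · rintro (⟨t, f, h⟩ | x) hu <;> simp only [real_mem_items, pad_mem_items] at hu
    · obtain ⟨h1, h2, rfl⟩ := hu
      exact E.startPos_lt h1 h2
    · exact hu.1

/-- Padding fills every slot that the copies leave free, so that the number of items is exactly the
number of positions, as the repair step of the sorting requires. -/
theorem Env.card_items (E : Env p L Bd q m n tuples home) (ω : Ω) :
    (items (q ^ m) (n ω) (tuples ω) (home ω)).card = q ^ m * n ω := by
  classical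
  unfold items
  rw [Finset.card_union_of_disjoint, Finset.card_image_of_injective _ (by
    intro a b h; simpa using h), Finset.card_sdiff_of_subset, Finset.card_image_of_injOn,
    Finset.card_range]
  · have : (copies (tuples ω) (home ω)).card ≤ q ^ m * n ω := by
      refine le_trans ?_ (E.card_tuples ω)
      refine Finset.card_image_le.trans ?_
      rw [Finset.card_product, Finset.card_range, mul_comm]
    omega
  · refine (E.placement ω).inj.mono ?_
    intro u hu
    simp only [items, Finset.coe_union]
    exact Or.inl hu
  · intro x hx
    obtain ⟨u, hu, rfl⟩ := Finset.mem_image.1 hx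
    exact Finset.mem_range.2 ((E.placement ω).lt u (Finset.mem_union_left _ hu))
  · rw [Finset.disjoint_left]
    intro u hu hu'
    obtain ⟨x, _, rfl⟩ := Finset.mem_image.1 hu'
    exact pad_notMem_copies hu

theorem Env.own_items (E : Env p L Bd q m n tuples home) (hR : R.Ready q m n tuples home) :
    R.Own (q ^ m) Item.car (fun ω => items (q ^ m) (n ω) (tuples ω) (home ω))
      (fun ω u => startPos (n ω) (tuples ω) (home ω) u / n ω)
      (fun ω => startPos (n ω) (tuples ω) (home ω)) := by
  have hidx : ∀ v < q ^ m, ∀ ω ω', R.vw ω v = R.vw ω' v → ∀ t,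
      localIndex (tuples ω) (home ω) t v = localIndex (tuples ω') (home ω') t v := by
    intro v hv ω ω' he t
    have h1 := hR.own.filter_eq hv he
    unfold localIndex
    rw [← Finset.filter_filter, ← Finset.filter_filter, h1]
  have hreal : ∀ v < q ^ m, ∀ ω ω', R.vw ω v = R.vw ω' v → ∀ t ∈ tuples ω, home ω t = v →
      (t ∈ tuples ω' ∧ home ω' t = v) ∧ ∀ f, startPos (n ω) (tuples ω) (home ω) (.real t f v) =
        startPos (n ω') (tuples ω') (home ω') (.real t f v) := by
    intro v hv ω ω' he t ht hh
    obtain ⟨h1, h2, -⟩ := hR.own.know v hv ω ω' he t ht hh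
    refine ⟨⟨h1, h2⟩, fun f => ?_⟩
    simp only [startPos]
    rw [hR.n v hv ω ω' he, hidx v hv ω ω' he]
  constructor
  · intro ω u hu
    have := E.n_pos ω
    rw [Nat.div_lt_iff_lt_mul (by omega)]
    exact (E.placement ω).lt u hu
  · intro v hv ω ω' he u hu ho
    have hn := hR.n v hv ω ω' he
    cases u with
    | real t f h =>
      rw [real_mem_items] at hu
      obtain ⟨h1, h2, rfl⟩ := hu
      rw [E.startPos_div h1 h2] at ho
      obtain ⟨⟨h3, h4⟩, h5⟩ := hreal v hv ω ω' he t h1 ho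
      rw [real_mem_items]
      refine ⟨⟨h3, h2, by rw [ho, h4]⟩, ?_, by rw [ho, h5]⟩
      rw [ho, ← h4, E.startPos_div h3 h2]
    -- Position `x` lies on server `x / n` and can be taken only by a tuple owned by this server.
    -- Hence every server can tell which of its slots are free.
    | pad x =>
      rw [pad_mem_items] at hu
      simp only [startPos] at ho ⊢
      rw [pad_mem_items, ← hn]
      refine ⟨⟨hu.1, ?_⟩, ho, trivial⟩
      intro t ht f hf hx
      rw [hn] at hx ho
      have h1 : home ω' t = v := by
        rw [← E.startPos_div ht hf, hx, ho]
      obtain ⟨⟨h3, h4⟩, h5⟩ := hreal v hv ω' ω he.symm t ht h1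
      refine hu.2 t h3 f hf ?_
      rw [h4, ← h5, ← h1]
      exact hx
  · intro ω u hu t ht
    cases u with
    | real t' f h =>
      rw [real_mem_items] at hu
      obtain ⟨h1, h2, rfl⟩ := hu
      simp only [Item.car, Set.mem_singleton_iff] at ht
      subst ht
      rw [E.startPos_div h1 h2]
      exact hR.own.has ω t h1 t rfl
    | pad x => simp [Item.car] at ht

/-- The common format of messages about tuples: the tuple, the index of the copy, and a fixed number
`c` of integers, hence `c + 2` units. -/
theorem copyCodec (α : Type*) (c : ℕ) (g : α → List ℕ) (hg : Function.Injective g)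
    (hlen : ∀ a, (g a).length = c) :
    IsCodec (fun x : T × ℕ => ({x.1} : Set T))
      (fun x a => Word.tuple x.1 :: Word.int x.2 :: (g a).map Word.int) (c + 2) where
  pos := by omega
  len := by intro i a; simp [hlen]
  inj := by
    rintro ⟨t, f⟩ a ⟨t', f'⟩ a' e
    simp only [List.cons.injEq, Word.tuple.injEq, Word.int.injEq] at e
    have h3 := List.map_injective_iff.2 (fun x y (h : Word.int (T := T) x = Word.int y) => by
      simpa using h) e.2.2
    exact ⟨by rw [e.1, e.2.1], hg h3⟩
  tup := by intro i a t; simp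

theorem Env.card_home (E : Env p L Bd q m n tuples home) (ω : Ω) (d : ℕ) :
    ((tuples ω ×ˢ Finset.range 3).filter (fun x => home ω x.1 = d)).card ≤ n ω := by
  refine le_trans (le_of_eq ?_) (E.card ω d)
  have : (tuples ω ×ˢ Finset.range 3).filter (fun x => home ω x.1 = d) =
      ((tuples ω).filter (fun t => home ω t = d)) ×ˢ Finset.range 3 := by
    ext x; simp; tauto
  rw [this, Finset.card_product, Finset.card_range, mul_comm]

/-- Every owner of a tuple learns its rank with respect to the key `k`. -/
theorem Env.ranks (E : Env p L Bd q m n tuples home) (k : T → κ)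
    (hR : R.Ready q m n tuples home) :
    ∃ R' : Run init L Bd, R.Ext (sortRounds m + 1) R' ∧
      R'.Own (q ^ m) (fun x : T × ℕ => ({x.1} : Set T)) (fun ω => tuples ω ×ˢ Finset.range 3)
        (fun ω x => home ω x.1) (fun ω x => rank (tuples ω) k x) := by
  let _ := Item.order k
  let S : Ω → Finset (Item T) := fun ω => items (q ^ m) (n ω) (tuples ω) (home ω)
  have s : SortSetting p L Bd q m 4 n S Item.car Item.enc :=
    { hq := E.hq
      hP := E.hP
      codec := Item.isCodec
      four_sq_le := E.four_sq_le
      dvd := E.dvd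
      card := E.card_items
      ints := by
        intro ω u hu x hx i hi
        have h1 := E.bd ω
        have h2 := E.le_bd ω
        have h3 := E.n_pos ω
        cases u with
        | real t f h =>
          obtain ⟨h4, h5, rfl⟩ := real_mem_items.1 hu
          have h6 := E.lt ω t h4
          simp only [Item.enc, List.mem_cons, Word.int.injEq, reduceCtorEq, false_or,
            List.not_mem_nil, or_false] at hi
          omega
        | pad y =>
          have h4 := pad_mem_items.1 hu
          simp only [Item.enc, List.mem_cons, Word.int.injEq, List.not_mem_nil, or_false] at hi
          omega
      two_le := fun ω => by
        have h2 := E.le_bd ω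
        have h3 := E.n_pos ω
        omega
      load := fun ω => by
        have := E.load ω
        omega }
  obtain ⟨R₁, e₁, h₁⟩ := s.sort_blocks m le_rfl R _ hR.n E.placement (E.own_items hR)
  have hlt : ∀ t f h t' f' h', (Item.real t f h < Item.real t' f' h' ↔
      Item.rankKey k (t, f) < Item.rankKey k (t', f') ∨
        Item.rankKey k (t, f) = Item.rankKey k (t', f') ∧ h < h') := by
    intro t f h t' f' h'
    show Item.key k _ < Item.key k _ ↔ _
    simp [Item.key, Prod.Lex.toLex_lt_toLex]
  -- Padding is sorted behind all copies, so it does not influence their ranks.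
  have hpad : ∀ x (t : T) f h, ¬ (Item.pad x < Item.real t f h) := by
    intro x t f h
    show ¬ (Item.key k _ < Item.key k _)
    simp [Item.key]
  have hrank : ∀ ω, ∀ x ∈ tuples ω ×ˢ Finset.range 3,
      sortPos (S ω) (q ^ m * n ω) (startPos (n ω) (tuples ω) (home ω))
        (.real x.1 x.2 (home ω x.1)) = rank (tuples ω) k x := by
    rintro ω ⟨t, f⟩ hx
    rw [Finset.mem_product, Finset.mem_range] at hx
    have hu : Item.real t f (home ω t) ∈ S ω := real_mem_items.2 ⟨hx.1, hx.2, rfl⟩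
    have h0 : ∀ u ∈ S ω, startPos (n ω) (tuples ω) (home ω) u / (q ^ m * n ω) = 0 := fun u hu =>
      Nat.div_eq_of_lt ((E.placement ω).lt u hu)
    rw [sortPos, h0 _ hu, zero_mul, zero_add, rank]
    symm
    refine Finset.card_bij (fun y _ => Item.real y.1 y.2 (home ω y.1)) ?_ ?_ ?_
    · rintro ⟨t', f'⟩ hy
      simp only [Finset.mem_filter, Finset.mem_product, Finset.mem_range] at hy ⊢
      have hm : Item.real t' f' (home ω t') ∈ S ω := real_mem_items.2 ⟨hy.1.1, hy.1.2, rfl⟩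
      exact ⟨hm, h0 _ hm, (hlt ..).2 (Or.inl hy.2)⟩
    · rintro ⟨t', f'⟩ _ ⟨t'', f''⟩ _ e
      simp only [Item.real.injEq] at e
      simp [e.1, e.2.1]
    · rintro (⟨t', f', h'⟩ | y) hy
      · simp only [Finset.mem_filter] at hy
        obtain ⟨h1, h2, rfl⟩ := real_mem_items.1 hy.1
        refine ⟨(t', f'), ?_, rfl⟩
        simp only [Finset.mem_filter, Finset.mem_product, Finset.mem_range]
        refine ⟨⟨h1, h2⟩, ?_⟩
        -- The owner stored in an item is a function of the tuple, so it never breaks a tie.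
        rcases (hlt ..).1 hy.2.2 with h3 | ⟨h3, h4⟩
        · exact h3
        · have := Item.rankKey_injective k h3
          simp only [Prod.mk.injEq] at this
          rw [this.1] at h4
          exact absurd h4 (lt_irrefl _)
      · simp only [Finset.mem_filter] at hy
        exact absurd hy.2.2 (hpad _ _ _ _)
  -- After sorting, the copy of rank `r` is on server `r / n`, which knows `r`; the stored owner is
  -- the return address.
  have h₂ : R₁.Own (q ^ m) (fun x : T × ℕ => ({x.1} : Set T))
      (fun ω => tuples ω ×ˢ Finset.range 3) (fun ω x => rank (tuples ω) k x / n ω)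
      (fun ω x => (home ω x.1, rank (tuples ω) k x)) := by
    have hmem : ∀ ω, ∀ x ∈ tuples ω ×ˢ Finset.range 3,
        Item.real x.1 x.2 (home ω x.1) ∈ S ω := by
      intro ω x hx
      rw [Finset.mem_product, Finset.mem_range] at hx
      exact real_mem_items.2 ⟨hx.1, hx.2, rfl⟩
    constructor
    · intro ω x hx
      rw [← hrank ω x hx]
      exact h₁.lt ω _ (hmem ω x hx)
    · intro v hv ω ω' he x hx ho
      rw [← hrank ω x hx] at ho
      obtain ⟨h1, h2, h3⟩ := h₁.know v hv ω ω' he _ (hmem ω x hx) ho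
      obtain ⟨a1, a2, a3⟩ := real_mem_items.1 h1
      have hx' : x ∈ tuples ω' ×ˢ Finset.range 3 := by
        rw [Finset.mem_product, Finset.mem_range]; exact ⟨a1, a2⟩
      rw [a3, hrank ω' x hx'] at h2
      rw [hrank ω x hx, a3, hrank ω' x hx'] at h3
      exact ⟨hx', h2, by rw [a3, h3]⟩
    · intro ω x hx t ht
      rw [← hrank ω x hx]
      exact h₁.has ω _ (hmem ω x hx) t ht
  obtain ⟨R₂, e₂, h₃⟩ := h₂.move E.hP (fun ω x => home ω x.1)
    (fun ω x hx => E.lt ω x.1 (Finset.mem_product.1 hx).1)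
    (by intro v hv ω ω' he x _ _ _ _ hf; exact (Prod.mk.inj hf).1)
    (copyCodec (T := T) (ℕ × ℕ) 2 (fun a => [a.1, a.2]) (by rintro ⟨a, b⟩ ⟨c, d⟩ h; simpa using h)
      (by intro a; rfl))
    (by
      intro ω x hx i hi
      have h1 := E.bd ω
      have h2 := E.le_bd ω
      have h3 := E.n_pos ω
      have h4 := E.card_tuples ω
      have h5 := rank_lt (k := k) hx
      rw [Finset.mem_product, Finset.mem_range] at hx
      have h6 := E.lt ω x.1 hx.1
      simp only [List.map_cons, List.map_nil, List.mem_cons, Word.int.injEq, reduceCtorEq,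
        false_or, List.not_mem_nil, or_false] at hi
      omega)
    (by
      intro ω d _
      have h1 := E.card_home ω d
      have h2 := E.load ω
      omega)
  refine ⟨R₂, e₁.trans e₂, h₃.map _ ?_⟩
  intro v hv ω ω' he x _ _ _ _ hf
  exact (Prod.mk.inj hf).2

end Run

end MPC

/-! ### Weighted counting queries -/

namespace MPC

set_option linter.unusedSectionVars false

namespace Run

variable {p : ℕ} {T Ω : Type*} {init : Ω → Fin p → Finset T} {L Bd : Ω → ℕ}
variable {κ : Type*} [LinearOrder T] [LinearOrder κ]
variable {q m : ℕ} {n : Ω → ℕ} {tuples : Ω → Finset T} {home : Ω → T → ℕ} {R R' : Run init L Bd}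

/-- The owners know the ranks of their tuples with respect to the key `k`. -/
def Ranked (R : Run init L Bd) (q m : ℕ) (tuples : Ω → Finset T) (home : Ω → T → ℕ)
    (k : T → κ) : Prop :=
  R.Own (q ^ m) (fun x : T × ℕ => ({x.1} : Set T)) (fun ω => tuples ω ×ˢ Finset.range 3)
    (fun ω x => home ω x.1) (fun ω x => rank (tuples ω) k x)

/-- The owners of the tuples know the values of `f`. -/
def HomeKnows {α : Type*} (R : Run init L Bd) (q m : ℕ) (tuples : Ω → Finset T)
    (home : Ω → T → ℕ) (f : Ω → T → α) : Prop :=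
  R.Own (q ^ m) (fun t => ({t} : Set T)) tuples home f

/-- The elements of rank less than `x` are those on earlier servers, covered by prefix sums over the
servers, and some on the own server, covered by a local sum. -/
theorem sum_split_div (A : Finset (T × ℕ)) (r w : T × ℕ → ℕ) (n x : ℕ) :
    ∑ v ∈ Finset.range (x / n), ∑ y ∈ A with r y / n = v, w y +
      ∑ y ∈ A with r y / n = x / n ∧ r y < x, w y = ∑ y ∈ A with r y < x, w y := by
  have h1 : ∑ v ∈ Finset.range (x / n), ∑ y ∈ A with r y / n = v, w y =
      ∑ y ∈ A with r y / n < x / n, w y := by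
    rw [← Finset.sum_fiberwise_of_maps_to (g := fun y => r y / n) (t := Finset.range (x / n))]
    · refine Finset.sum_congr rfl fun v hv => ?_
      rw [Finset.filter_filter]
      refine Finset.sum_congr (Finset.filter_congr fun y _ => ?_) fun _ _ => rfl
      rw [Finset.mem_range] at hv
      constructor
      · intro h; exact ⟨h ▸ hv, h⟩
      · exact fun h => h.2
    · intro y hy
      simpa using (Finset.mem_filter.1 hy).2
  rw [h1, ← Finset.sum_union]
  · refine Finset.sum_congr ?_ fun _ _ => rfl
    ext y
    simp only [Finset.mem_union, Finset.mem_filter]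
    constructor
    · rintro (⟨h1, h2⟩ | ⟨h1, _, h3⟩)
      · refine ⟨h1, ?_⟩
        by_contra hc
        exact h2.not_ge (Nat.div_le_div_right (not_lt.1 hc))
      · exact ⟨h1, h3⟩
    · rintro ⟨h1, h2⟩
      rcases (Nat.div_le_div_right (c := n) h2.le).lt_or_eq with h | h
      · exact Or.inl ⟨h1, h⟩
      · exact Or.inr ⟨h1, h, h2⟩
  · rw [Finset.disjoint_left]
    intro y hy hy'
    simp only [Finset.mem_filter] at hy hy'
    omega

/-- The owners of the tuples learn the weight below, before and up to every tuple. -/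
theorem Env.query (E : Env p L Bd q m n tuples home) {k : T → κ}
    (hR : R.Ready q m n tuples home) (hrk : R.Ranked q m tuples home k) {w : Ω → T → ℕ}
    (hw : R.HomeKnows q m tuples home w) (hBd : ∀ ω, ∑ t ∈ tuples ω, w ω t ≤ Bd ω) :
    ∃ R' : Run init L Bd, R.Ext (m + 2) R' ∧ R'.HomeKnows q m tuples home (fun ω t =>
      (below (tuples ω) k (w ω) (k t), before (tuples ω) k (w ω) t,
        upto (tuples ω) k (w ω) (k t))) := by
  let S : Ω → Finset (T × ℕ) := fun ω => tuples ω ×ˢ Finset.range 3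
  let rk : Ω → T × ℕ → ℕ := fun ω => rank (tuples ω) k
  let w' : Ω → T × ℕ → ℕ := fun ω x => if x.2 = 1 then w ω x.1 else 0
  have n_pos : ∀ ω, 0 < n ω := fun ω => by have := E.n_pos ω; omega
  have rk_lt : ∀ ω, ∀ x ∈ S ω, rk ω x < q ^ m * n ω := fun ω x hx =>
    (rank_lt hx).trans_le (E.card_tuples ω)
  have total : ∀ ω (Q : T × ℕ → Prop) [DecidablePred Q], ∑ y ∈ S ω with Q y, w' ω y ≤ Bd ω := by
    intro ω Q _
    simp only [S, w']
    rw [sum_flag_one]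
    exact (Finset.sum_le_sum_of_subset (Finset.filter_subset _ _)).trans (hBd ω)
  have w'_le : ∀ ω, ∀ x ∈ S ω, w' ω x ≤ Bd ω := by
    intro ω x hx
    have := total ω (fun y => y = x)
    rwa [Finset.filter_eq', if_pos hx, Finset.sum_singleton] at this
  have h₁ : R.Own (q ^ m) (fun x : T × ℕ => ({x.1} : Set T)) S (fun ω x => home ω x.1)
      (fun ω x => (home ω x.1, rk ω x, w' ω x)) := by
    refine Own.map hrk _ ?_
    intro v hv ω ω' he x hx hx' ho ho' hf
    have h1 := (hw.know v hv ω ω' he x.1 (Finset.mem_product.1 hx).1 ho).2.2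
    simp only [w', rk]
    rw [ho, ho', hf, h1]
  have load_rank : ∀ ω d, ((S ω).filter (fun x => rk ω x / n ω = d)).card ≤ n ω := by
    intro ω d
    exact IsPlacement.card_block_le (tot := q ^ m * n ω) ⟨rank_injOn, rk_lt ω⟩ (n_pos ω) d
  obtain ⟨R₁, e₁, h₂⟩ := h₁.move E.hP (fun ω x => rk ω x / n ω)
    (fun ω x hx => by rw [Nat.div_lt_iff_lt_mul (n_pos ω)]; exact rk_lt ω x hx)
    (by
      intro v hv ω ω' he x _ _ _ _ hf
      simp only [Prod.mk.injEq] at hf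
      rw [hf.2.1, hR.n v hv ω ω' he])
    (copyCodec (T := T) (ℕ × ℕ × ℕ) 3 (fun a => [a.1, a.2.1, a.2.2])
      (by rintro ⟨a, b, c⟩ ⟨a', b', c'⟩ h; simpa using h) (by intro a; rfl))
    (by
      intro ω x hx i hi
      have h1 := E.bd ω
      have h2 := E.le_bd ω
      have h3 := E.n_pos ω
      have h5 := rk_lt ω x hx
      have h7 := w'_le ω x hx
      simp only [S, Finset.mem_product, Finset.mem_range] at hx
      have h6 := E.lt ω x.1 hx.1
      simp only [List.map_cons, List.map_nil, List.mem_cons, Word.int.injEq, reduceCtorEq,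
        false_or, List.not_mem_nil, or_false] at hi
      omega)
    (by
      intro ω d _
      have h1 := load_rank ω d
      have h2 := E.load ω
      omega)
  have hn₁ := (hR.mono e₁).n
  -- One round has put the copies in the order of their ranks. The prefix sums take `m` rounds, and
  -- a last round carries the answers home, which makes `m + 2`; the ranks are reused for every
  -- weight.
  obtain ⟨R₂, e₂, h₃⟩ := R₁.cumulative_sums E.hq E.hP
    (fun ω v => ∑ y ∈ S ω with rk ω y / n ω = v, w' ω y)
    (by
      intro v hv ω ω' he
      show ∑ y ∈ S ω with rk ω y / n ω = v, w' ω y = ∑ y ∈ S ω' with rk ω' y / n ω' = v, w' ω' y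
      rw [h₂.filter_eq hv he]
      refine Finset.sum_congr rfl fun y hy => ?_
      rw [Finset.mem_filter] at hy
      have := (h₂.know v hv ω' ω he.symm y hy.1 hy.2).2.2
      simp only [Prod.mk.injEq] at this
      exact this.2.2.symm)
    (fun ω => by
      have h1 := E.four_sq_le ω
      have h2 := E.load ω
      have h3 : q ≤ q ^ 2 := Nat.le_self_pow (by norm_num) q
      omega)
    (fun ω => by
      rw [Finset.sum_fiberwise_of_maps_to (g := fun y => rk ω y / n ω)]
      · have := total ω (fun _ => True)
        simpa using this
      · intro y hy
        rw [Finset.mem_range, Nat.div_lt_iff_lt_mul (n_pos ω)]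
        exact rk_lt ω y hy)
  let ans : Ω → T × ℕ → ℕ := fun ω x => ∑ y ∈ S ω with rk ω y < rk ω x, w' ω y
  have h₄ : R₂.Own (q ^ m) (fun x : T × ℕ => ({x.1} : Set T)) S (fun ω x => rk ω x / n ω)
      (fun ω x => (home ω x.1, ans ω x)) := by
    refine (h₂.mono e₂).map _ ?_
    intro v hv ω ω' he x hx hx' ho ho' hf
    simp only [Prod.mk.injEq] at hf
    simp only [Prod.mk.injEq, hf.1, true_and, ans]
    rw [← sum_split_div _ _ _ (n ω) _, ← sum_split_div _ _ _ (n ω') _, ho, ho']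
    refine congrArg₂ _ ((h₃ v hv).1 ω ω' he) ?_
    have he₁ := e₂.know v ω ω' he
    rw [← Finset.filter_filter, ← Finset.filter_filter, h₂.filter_eq hv he₁]
    have hval : ∀ y ∈ (S ω').filter (fun y => rk ω' y / n ω' = v),
        rk ω y = rk ω' y ∧ w' ω y = w' ω' y := by
      intro y hy
      rw [Finset.mem_filter] at hy
      have := (h₂.know v hv ω' ω he₁.symm y hy.1 hy.2).2.2
      simp only [Prod.mk.injEq] at this
      exact ⟨this.2.1.symm, this.2.2.symm⟩
    refine Finset.sum_congr (Finset.filter_congr fun y hy => ?_) fun y hy => ?_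
    · rw [(hval y hy).1, hf.2.1]
    · exact (hval y (Finset.mem_filter.1 hy).1).2
  obtain ⟨R₃, e₃, h₅⟩ := h₄.move E.hP (fun ω x => home ω x.1)
    (fun ω x hx => E.lt ω x.1 (Finset.mem_product.1 hx).1)
    (by intro v hv ω ω' he x _ _ _ _ hf; exact (Prod.mk.inj hf).1)
    (copyCodec (T := T) (ℕ × ℕ) 2 (fun a => [a.1, a.2]) (by rintro ⟨a, b⟩ ⟨c, d⟩ h; simpa using h)
      (by intro a; rfl))
    (by
      intro ω x hx i hi
      have h2 := E.le_bd ω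
      have h3 := E.n_pos ω
      have h5 : ans ω x ≤ Bd ω := total ω _
      simp only [S, Finset.mem_product, Finset.mem_range] at hx
      have h6 := E.lt ω x.1 hx.1
      simp only [List.map_cons, List.map_nil, List.mem_cons, Word.int.injEq, reduceCtorEq,
        false_or, List.not_mem_nil, or_false] at hi
      omega)
    (by
      intro ω d _
      have h1 : ((S ω).filter (fun x => home ω x.1 = d)).card ≤ n ω := E.card_home ω d
      have h2 := E.load ω
      omega)
  have hext := (e₁.trans e₂).trans e₃
  have hans : ∀ ω, ∀ x ∈ S ω, ans ω x =
      ∑ u ∈ tuples ω with Item.rankKey k (u, 1) < Item.rankKey k x, w ω u := by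
    intro ω x hx
    rw [← sum_flag_one (w ω) (fun y => Item.rankKey k y < Item.rankKey k x)]
    refine Finset.sum_congr (Finset.filter_congr fun y hy => ?_) fun _ _ => rfl
    exact rank_lt_rank_iff hy hx
  have hval : ∀ ω, ∀ t ∈ tuples ω, ans ω (t, 0) = below (tuples ω) k (w ω) (k t) ∧
      ans ω (t, 1) = before (tuples ω) k (w ω) t ∧
      ans ω (t, 2) = upto (tuples ω) k (w ω) (k t) := by
    intro ω t ht
    have hm : ∀ i < 3, (t, i) ∈ S ω := fun i hi => by simp [S, ht, hi]
    rw [hans ω _ (hm 0 (by norm_num)), hans ω _ (hm 1 (by norm_num)), hans ω _ (hm 2 (by norm_num))]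
    simp only [rankKey_lt_iff, below, before, upto]
    refine ⟨?_, ?_, ?_⟩ <;>
      refine Finset.sum_congr (Finset.filter_congr fun u _ => ?_) fun _ _ => rfl
    · simp
    · simp
    · simp [le_iff_lt_or_eq]
  refine ⟨R₃, by rw [show m + 2 = 1 + m + 1 by omega]; exact hext, ?_⟩
  refine (hw.mono hext).map _ ?_
  intro v hv ω ω' he t ht ht' ho ho' hf
  have hm : ∀ i < 3, ans ω (t, i) = ans ω' (t, i) := fun i hi =>
    (Prod.mk.inj (h₅.know v hv ω ω' he (t, i) (by simp [S, ht, hi]) ho).2.2).2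
  rw [← (hval ω t ht).1, ← (hval ω t ht).2.1, ← (hval ω t ht).2.2, ← (hval ω' t ht').1,
    ← (hval ω' t ht').2.1, ← (hval ω' t ht').2.2, hm 0 (by norm_num), hm 1 (by norm_num),
    hm 2 (by norm_num)]

end Run

end MPC

/-! ### Packing the join groups into cells -/

namespace MPC

set_option linter.unusedSectionVars false

/-- The sub-problem of joining all tuples with one key: the intervals `[x0, x1)` and `[y0, y1)` of
positions of the two sides, and the number of cells reserved for smaller keys. -/
structure Group where
  x0 : ℕ
  x1 : ℕ
  y0 : ℕ
  y1 : ℕ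
  base : ℕ

namespace Group

/-- Both sides of the group are nonempty. -/
def Proper (g : Group) : Prop := g.x0 < g.x1 ∧ g.y0 < g.y1

/-- The number of multiples of `L` that separate the positions of the first side. -/
def dx (L : ℕ) (g : Group) : ℕ := (g.x1 - 1) / L - g.x0 / L

/-- The number of multiples of `L` that separate the positions of the second side. -/
def dy (L : ℕ) (g : Group) : ℕ := (g.y1 - 1) / L - g.y0 / L

open Classical in
/-- The number of cells of the group, without the first one. -/
noncomputable def extra (L : ℕ) (g : Group) : ℕ :=
  if g.Proper then (g.dx L + 1) * (g.dy L + 1) - 1 else 0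

/-- The number of the cell for block `I` of the first side and block `J` of the second side; the
first cell of a group may be shared with other groups. -/
def cell (Z L : ℕ) (g : Group) (I J : ℕ) : ℕ :=
  if I = g.x0 / L ∧ J = g.y0 / L then I + J
  else Z + g.base + ((I - g.x0 / L) * (g.dy L + 1) + (J - g.y0 / L) - 1)

/-- The blocks of length `L` that meet the first side. -/
def IsX (L : ℕ) (g : Group) (I : ℕ) : Prop := g.x0 / L ≤ I ∧ I ≤ (g.x1 - 1) / L

/-- The blocks of length `L` that meet the second side. -/
def IsY (L : ℕ) (g : Group) (J : ℕ) : Prop := g.y0 / L ≤ J ∧ J ≤ (g.y1 - 1) / L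

theorem isX_of_mem {L : ℕ} {g : Group} {x : ℕ} (h0 : g.x0 ≤ x) (h1 : x < g.x1) :
    g.IsX L (x / L) :=
  ⟨Nat.div_le_div_right h0, Nat.div_le_div_right (by omega)⟩

theorem isY_of_mem {L : ℕ} {g : Group} {y : ℕ} (h0 : g.y0 ≤ y) (h1 : y < g.y1) :
    g.IsY L (y / L) :=
  ⟨Nat.div_le_div_right h0, Nat.div_le_div_right (by omega)⟩

/-- All of `g` comes before all of `g'`. -/
structure Before (L : ℕ) (g g' : Group) : Prop where
  x : g.x1 ≤ g'.x0
  y : g.y1 ≤ g'.y0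
  base : g.base + g.extra L ≤ g'.base

theorem offset_le {L I J : ℕ} {g : Group} (hg : g.Proper) (hI : g.IsX L I) (hJ : g.IsY L J) :
    (I - g.x0 / L) * (g.dy L + 1) + (J - g.y0 / L) ≤ g.extra L := by
  rw [extra, if_pos hg]
  have h1 : I - g.x0 / L ≤ g.dx L := Nat.sub_le_sub_right hI.2 _
  have h2 : J - g.y0 / L ≤ g.dy L := Nat.sub_le_sub_right hJ.2 _
  have h3 := Nat.mul_le_mul_right (g.dy L + 1) h1
  have h4 : (g.dx L + 1) * (g.dy L + 1) = g.dx L * (g.dy L + 1) + (g.dy L + 1) := by ring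
  omega

theorem offset_pos {L I J : ℕ} {g : Group} (hI : g.IsX L I) (hJ : g.IsY L J)
    (hne : ¬ (I = g.x0 / L ∧ J = g.y0 / L)) :
    0 < (I - g.x0 / L) * (g.dy L + 1) + (J - g.y0 / L) := by
  have h1 := hI.1
  have h2 := hJ.1
  by_cases h : I = g.x0 / L
  · have : J ≠ g.y0 / L := fun h' => hne ⟨h, h'⟩
    have : 0 < J - g.y0 / L := Nat.sub_pos_of_lt (lt_of_le_of_ne h2 (Ne.symm this))
    omega
  · have h3 : 0 < I - g.x0 / L := Nat.sub_pos_of_lt (lt_of_le_of_ne h1 (Ne.symm h))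
    have := Nat.mul_pos h3 (Nat.succ_pos (g.dy L))
    simp only [Nat.succ_eq_add_one] at this
    omega

theorem cell_lt {Z L I J N : ℕ} {g : Group} (hg : g.Proper) (hI : g.IsX L I) (hJ : g.IsY L J)
    (hZ : g.x0 / L + g.y0 / L < Z) (hN : g.base + g.extra L ≤ N) : g.cell Z L I J < Z + N := by
  unfold cell
  split_ifs with h
  · rw [h.1, h.2]; omega
  · have h1 := offset_le hg hI hJ
    have h2 := offset_pos hI hJ h
    omega

/-- Different groups can share only the number of their first cells. Both corner indices are
monotone in the group, so equal sums force equal indices: groups with the same first number also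
share both blocks, and one block per side still bounds what the cell receives. The other numbers
start at `Z` and are separated by `base`. -/
theorem cell_ne_of_before {Z L I J I' J' : ℕ} {g g' : Group} (hg : g.Proper)
    (hI : g.IsX L I) (hJ : g.IsY L J) (hI' : g'.IsX L I') (hJ' : g'.IsY L J')
    (hZ : g.x0 / L + g.y0 / L < Z) (hZ' : g'.x0 / L + g'.y0 / L < Z) (hb : g.Before L g')
    (h : g.cell Z L I J = g'.cell Z L I' J') : I = I' ∧ J = J' := by
  have hx : g.x0 / L ≤ g'.x0 / L := Nat.div_le_div_right (hg.1.le.trans hb.x)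
  have hy : g.y0 / L ≤ g'.y0 / L := Nat.div_le_div_right (hg.2.le.trans hb.y)
  have hbase := hb.base
  unfold cell at h
  split_ifs at h with h1 h2 h2
  · rw [h1.1, h1.2, h2.1, h2.2] at h ⊢
    omega
  · rw [h1.1, h1.2] at h
    have := offset_pos hI' hJ' h2
    omega
  · rw [h2.1, h2.2] at h
    have := offset_pos hI hJ h1
    omega
  · have a1 := offset_le hg hI hJ
    have a2 := offset_pos hI hJ h1
    have a3 := offset_pos hI' hJ' h2
    omega

/-- Within a group the cells are numbered row by row with `dy + 1` cells in a row. -/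
theorem cell_injective {Z L I J I' J' : ℕ} {g : Group}
    (hI : g.IsX L I) (hJ : g.IsY L J) (hI' : g.IsX L I') (hJ' : g.IsY L J')
    (hZ : g.x0 / L + g.y0 / L < Z) (h : g.cell Z L I J = g.cell Z L I' J') : I = I' ∧ J = J' := by
  unfold cell at h
  split_ifs at h with h1 h2 h2
  · rw [h1.1, h1.2, h2.1, h2.2]; exact ⟨rfl, rfl⟩
  · rw [h1.1, h1.2] at h
    have := offset_pos hI' hJ' h2
    omega
  · rw [h2.1, h2.2] at h
    have := offset_pos hI hJ h1
    omega
  · have a2 := offset_pos hI hJ h1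
    have a3 := offset_pos hI' hJ' h2
    have b1 : J - g.y0 / L < g.dy L + 1 := Nat.lt_succ_of_le (Nat.sub_le_sub_right hJ.2 _)
    have b2 : J' - g.y0 / L < g.dy L + 1 := Nat.lt_succ_of_le (Nat.sub_le_sub_right hJ'.2 _)
    obtain ⟨c1, c2⟩ := mul_add_inj (a := I - g.x0 / L) (a' := I' - g.x0 / L) b1 b2 (by omega)
    have d1 := hI.1
    have d2 := hI'.1
    have d3 := hJ.1
    have d4 := hJ'.1
    exact ⟨by rw [← Nat.sub_add_cancel d1, c1, Nat.sub_add_cancel d2],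
      by rw [← Nat.sub_add_cancel d3, c2, Nat.sub_add_cancel d4]⟩

theorem extra_le {L : ℕ} (g : Group) : g.extra L ≤ g.dx L * g.dy L + g.dx L + g.dy L := by
  unfold extra
  split_ifs
  · have : (g.dx L + 1) * (g.dy L + 1) = g.dx L * g.dy L + g.dx L + g.dy L + 1 := by ring
    omega
  · exact Nat.zero_le _

theorem mul_div_sub_div_le {L a b : ℕ} (hL : 0 < L) : L * ((b - 1) / L - a / L) ≤ (b - a) + L := by
  have h1 := Nat.mul_div_le (b - 1) L
  have h2 := Nat.lt_mul_div_succ a hL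
  rw [Nat.mul_sub]
  rw [mul_add, mul_one] at h2
  omega

/-- An error `L ^ 2` per group would be too much, since the number of groups is not controlled.
Groups with `dx = 0` contribute nothing to the left side, so the error can be charged to `dx`, whose
sum is small. -/
theorem sq_mul_dx_mul_dy_le {L : ℕ} (hL : 0 < L) (g : Group) :
    L ^ 2 * (g.dx L * g.dy L) ≤ (g.x1 - g.x0) * (g.y1 - g.y0) + L * (g.x1 - g.x0) +
      L * (g.y1 - g.y0) + L ^ 2 * g.dx L := by
  rcases Nat.eq_zero_or_pos (g.dx L) with h | h
  · simp [h]
  · have h1 : L * g.dx L ≤ (g.x1 - g.x0) + L := mul_div_sub_div_le hL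
    have h2 : L * g.dy L ≤ (g.y1 - g.y0) + L := mul_div_sub_div_le hL
    calc L ^ 2 * (g.dx L * g.dy L) = (L * g.dx L) * (L * g.dy L) := by ring
      _ ≤ ((g.x1 - g.x0) + L) * ((g.y1 - g.y0) + L) := Nat.mul_le_mul h1 h2
      _ = (g.x1 - g.x0) * (g.y1 - g.y0) + L * (g.x1 - g.x0) +
          L * (g.y1 - g.y0) + L ^ 2 * 1 := by ring
      _ ≤ _ := by gcongr; exact h

end Group

section Plan

variable {T κ : Type*} [LinearOrder T] [LinearOrder κ] {S : Finset T} {k : T → κ} {w : T → ℕ}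

theorem upto_eq (g : κ) : upto S k w g = below S k w g + ∑ u ∈ S with k u = g, w u := by
  unfold upto below
  rw [← Finset.sum_union]
  · refine Finset.sum_congr ?_ fun _ _ => rfl
    ext u
    simp only [Finset.mem_filter, Finset.mem_union, le_iff_lt_or_eq]
    tauto
  · rw [Finset.disjoint_left]
    intro u hu hu'
    rw [Finset.mem_filter] at hu hu'
    exact hu.2.ne hu'.2

theorem below_le_upto (g : κ) : below S k w g ≤ upto S k w g := by rw [upto_eq]; omega

theorem upto_sub_below (g : κ) : upto S k w g - below S k w g = ∑ u ∈ S with k u = g, w u := by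
  rw [upto_eq]; omega

theorem upto_le_below {g g' : κ} (h : g < g') : upto S k w g ≤ below S k w g' := by
  refine Finset.sum_le_sum_of_subset fun u hu => ?_
  rw [Finset.mem_filter] at hu ⊢
  exact ⟨hu.1, hu.2.trans_lt h⟩

theorem upto_le_sum (g : κ) : upto S k w g ≤ ∑ u ∈ S, w u :=
  Finset.sum_le_sum_of_subset (Finset.filter_subset _ _)

theorem below_le_before (t : T) : below S k w (k t) ≤ before S k w t := by
  refine Finset.sum_le_sum_of_subset fun u hu => ?_
  rw [Finset.mem_filter] at hu ⊢
  exact ⟨hu.1, Or.inl hu.2⟩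

theorem before_add_le_upto {t : T} (ht : t ∈ S) : before S k w t + w t ≤ upto S k w (k t) := by
  unfold before upto
  rw [add_comm, ← Finset.sum_insert (by simp)]
  refine Finset.sum_le_sum_of_subset fun u hu => ?_
  rw [Finset.mem_insert, Finset.mem_filter] at hu
  rw [Finset.mem_filter]
  rcases hu with rfl | ⟨h1, h2 | h2⟩
  · exact ⟨ht, le_rfl⟩
  · exact ⟨h1, h2.le⟩
  · exact ⟨h1, h2.1.le⟩

theorem before_add_le_before {t t' : T} (ht : t ∈ S) (h : k t < k t' ∨ k t = k t' ∧ t < t') :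
    before S k w t + w t ≤ before S k w t' := by
  unfold before
  rw [add_comm, ← Finset.sum_insert (by simp)]
  refine Finset.sum_le_sum_of_subset fun u hu => ?_
  rw [Finset.mem_insert, Finset.mem_filter] at hu
  rw [Finset.mem_filter]
  rcases hu with rfl | ⟨h1, h2⟩
  · exact ⟨ht, h⟩
  · refine ⟨h1, ?_⟩
    rcases h2 with h2 | ⟨h2, h3⟩ <;> rcases h with h | ⟨h, h'⟩
    · exact Or.inl (h2.trans h)
    · exact Or.inl (h ▸ h2)
    · exact Or.inl (h2 ▸ h)
    · have hlt := h3.trans h'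
      exact Or.inr ⟨h2.trans h, hlt⟩

/-- The position intervals of different tuples are disjoint. -/
theorem before_disjoint {t t' : T} (ht : t ∈ S) (ht' : t' ∈ S) {x : ℕ}
    (h0 : before S k w t ≤ x) (h1 : x < before S k w t + w t)
    (h0' : before S k w t' ≤ x) (h1' : x < before S k w t' + w t') : t = t' := by
  by_contra hne
  have : (k t < k t' ∨ k t = k t' ∧ t < t') ∨ (k t' < k t ∨ k t' = k t ∧ t' < t) := by
    rcases lt_trichotomy (k t) (k t') with h | h | h
    · exact Or.inl (Or.inl h)
    · rcases lt_or_gt_of_ne hne with h' | h'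
      · exact Or.inl (Or.inr ⟨h, h'⟩)
      · exact Or.inr (Or.inr ⟨h.symm, h'⟩)
    · exact Or.inr (Or.inl h)
  rcases this with h | h
  · have := before_add_le_before (w := w) ht h; omega
  · have := before_add_le_before (w := w) ht' h; omega

/-- The group of a key, without the reserved cells. -/
def rawGroup (S : Finset T) (k : T → κ) (wX wY : T → ℕ) (g : κ) : Group :=
  ⟨below S k wX g, upto S k wX g, below S k wY g, upto S k wY g, 0⟩

open Classical in
/-- The extra cells of a group, as a weight of the first tuple of the first side. -/
noncomputable def cellWeight (S : Finset T) (k : T → κ) (wX wY : T → ℕ) (L : ℕ) (t : T) : ℕ :=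
  if 0 < wX t ∧ before S k wX t = below S k wX (k t) then (rawGroup S k wX wY (k t)).extra L else 0

/-- The group of a key. -/
noncomputable def groupOf (S : Finset T) (k : T → κ) (wX wY : T → ℕ) (L : ℕ) (g : κ) : Group :=
  ⟨below S k wX g, upto S k wX g, below S k wY g, upto S k wY g,
    below S k (cellWeight S k wX wY L) g⟩

variable {wX wY : T → ℕ} {L P : ℕ}

theorem extra_groupOf (g : κ) :
    (groupOf S k wX wY L g).extra L = (rawGroup S k wX wY g).extra L := rfl

/-- The extra cells of a group are charged to one of its tuples, the least one with positive first
weight. It exists if the group is proper, and summing `cellWeight` over smaller keys therefore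
reserves enough numbers. -/
theorem base_add_extra_le (g : κ) :
    (groupOf S k wX wY L g).base + (groupOf S k wX wY L g).extra L ≤
      upto S k (cellWeight S k wX wY L) g := by
  classical
  rw [extra_groupOf, upto_eq]
  refine Nat.add_le_add_left ?_ _
  by_cases hp : (rawGroup S k wX wY g).Proper
  · have hx : 0 < ∑ u ∈ S with k u = g, wX u := by
      rw [← upto_sub_below]
      exact Nat.sub_pos_of_lt hp.1
    have hne : (S.filter (fun u => k u = g ∧ 0 < wX u)).Nonempty := by
      by_contra hc
      rw [Finset.not_nonempty_iff_eq_empty, Finset.filter_eq_empty_iff] at hc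
      refine hx.ne' (Finset.sum_eq_zero fun u hu => ?_)
      rw [Finset.mem_filter] at hu
      have := hc hu.1
      by_contra h0
      exact this ⟨hu.2, Nat.pos_of_ne_zero h0⟩
    have hmem := Finset.min'_mem _ hne
    set t := (S.filter (fun u => k u = g ∧ 0 < wX u)).min' hne with htdef
    rw [Finset.mem_filter] at hmem
    -- Tuples with the same key that come before the least one of positive weight have weight 0.
    have hbef : before S k wX t = below S k wX (k t) := by
      refine le_antisymm ?_ (below_le_before t)
      unfold before below
      rw [← Finset.sum_filter_of_ne (p := fun u => k u < k t)]
      · rw [Finset.filter_filter]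
        refine Finset.sum_le_sum_of_subset fun u hu => ?_
        rw [Finset.mem_filter] at hu ⊢
        exact ⟨hu.1, hu.2.2⟩
      · intro u hu h0
        rw [Finset.mem_filter] at hu
        rcases hu.2 with h | ⟨h, h'⟩
        · exact h
        · have := Finset.min'_le (S.filter (fun u => k u = g ∧ 0 < wX u)) u
            (Finset.mem_filter.2 ⟨hu.1, h.trans hmem.2.1, Nat.pos_of_ne_zero h0⟩)
          exact absurd h' (not_lt.2 this)
    have hw : cellWeight S k wX wY L t = (rawGroup S k wX wY g).extra L := by
      rw [cellWeight, if_pos ⟨hmem.2.2, hbef⟩, hmem.2.1]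
    rw [← hw]
    exact Finset.single_le_sum (f := cellWeight S k wX wY L) (fun _ _ => Nat.zero_le _)
      (Finset.mem_filter.2 ⟨hmem.1, hmem.2.1⟩)
  · rw [Group.extra, if_neg hp]
    exact Nat.zero_le _

theorem groupOf_before {g g' : κ} (h : g < g') :
    (groupOf S k wX wY L g).Before L (groupOf S k wX wY L g') where
  x := upto_le_below h
  y := upto_le_below h
  base := (base_add_extra_le g).trans (upto_le_below h)

theorem sum_keys_le (A : Finset T) (hk : Set.InjOn k A) (f : T → ℕ) :
    ∑ t ∈ A, ∑ u ∈ S with k u = k t, f u ≤ ∑ u ∈ S, f u := by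
  rw [← Finset.sum_biUnion]
  · refine Finset.sum_le_sum_of_subset fun u hu => ?_
    rw [Finset.mem_biUnion] at hu
    obtain ⟨t, _, hu⟩ := hu
    exact (Finset.mem_filter.1 hu).1
  · intro t ht t' ht' hne
    rw [Function.onFun, Finset.disjoint_left]
    intro u hu hu'
    rw [Finset.mem_filter] at hu hu'
    exact hne (hk ht ht' (hu.2.symm.trans hu'.2))

/-- The intervals of different keys are disjoint and ordered, so each block boundary in the range of
length at most `P * L` is crossed by at most one key. -/
theorem sum_separators_le (A : Finset T) (hk : Set.InjOn k A) (hL : 0 < L)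
    (hw : ∑ u ∈ S, w u ≤ P * L) :
    ∑ t ∈ A, ((upto S k w (k t) - 1) / L - below S k w (k t) / L) ≤ P := by
  have h1 : ∀ t, ((upto S k w (k t) - 1) / L - below S k w (k t) / L) =
      (Finset.Ioc (below S k w (k t) / L) ((upto S k w (k t) - 1) / L)).card := by
    intro t; rw [Nat.card_Ioc]
  simp only [h1]
  have hlt : ∀ t t', k t < k t' → ∀ i, i ≤ (upto S k w (k t) - 1) / L →
      below S k w (k t') / L < i → False := by
    intro t t' h i h1 h2
    have : (upto S k w (k t) - 1) / L ≤ below S k w (k t') / L :=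
      Nat.div_le_div_right ((Nat.sub_le _ _).trans (upto_le_below h))
    exact absurd (h1.trans this) (not_le.2 h2)
  rw [← Finset.card_biUnion]
  · refine (Finset.card_le_card (t := Finset.Ioc 0 P) fun i hi => ?_).trans (by simp)
    rw [Finset.mem_biUnion] at hi
    obtain ⟨t, _, hi⟩ := hi
    rw [Finset.mem_Ioc] at hi ⊢
    refine ⟨Nat.zero_lt_of_lt hi.1, hi.2.trans ?_⟩
    have : (upto S k w (k t) - 1) / L ≤ P * L / L :=
      Nat.div_le_div_right ((Nat.sub_le _ _).trans ((upto_le_sum _).trans hw))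
    rwa [Nat.mul_div_cancel _ hL] at this
  · intro t ht t' ht' hne
    rw [Function.onFun, Finset.disjoint_left]
    intro i hi hi'
    rw [Finset.mem_Ioc] at hi hi'
    rcases lt_trichotomy (k t) (k t') with h | h | h
    · exact hlt t t' h i hi.2 hi'.1
    · exact hne (hk ht ht' h)
    · exact hlt t' t h i hi'.2 hi.1

/-- The sizes for which the plan fits on `P` servers with load `L`. -/
structure Fits (S : Finset T) (k : T → κ) (wX wY : T → ℕ) (P L : ℕ) : Prop where
  hP : 0 < P
  hL : 0 < L
  x : ∑ u ∈ S, wX u ≤ P * L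
  y : ∑ u ∈ S, wY u ≤ P * L
  xy : ∑ u ∈ S, wX u * ∑ u' ∈ S with k u' = k u, wY u' ≤ P * L ^ 2

/-- There are at most `(dx + 1) * (dy + 1) - 1 ≤ dx * dy + dx + dy` extra cells per group. The sums
of `dx` and of `dy` are at most `P` each. The products sum to at most `4 * P`: one `P` from the
result size, one from each side, and one from the error charged to `dx`. -/
theorem Fits.sum_cellWeight (h : Fits S k wX wY P L) :
    ∑ u ∈ S, cellWeight S k wX wY L u ≤ 6 * P := by
  classical
  set A := S.filter (fun t => 0 < wX t ∧ before S k wX t = below S k wX (k t)) with hA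
  -- Of the tuples with positive weight and the same key only the first starts at the beginning of
  -- the group, so `A` has at most one tuple per key.
  have hk : Set.InjOn k A := by
    intro t ht t' ht' e
    rw [Finset.mem_coe, hA, Finset.mem_filter] at ht ht'
    by_contra hne
    rcases lt_or_gt_of_ne hne with hl | hl
    · have := before_add_le_before (w := wX) ht.1 (Or.inr ⟨e, hl⟩)
      rw [ht.2.2, ht'.2.2, e] at this
      omega
    · have := before_add_le_before (w := wX) ht'.1 (Or.inr ⟨e.symm, hl⟩)
      rw [ht.2.2, ht'.2.2, e] at this
      omega
  let G : T → Group := fun t => rawGroup S k wX wY (k t)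
  have h1 : ∑ u ∈ S, cellWeight S k wX wY L u = ∑ t ∈ A, (G t).extra L := by
    rw [hA, Finset.sum_filter]
    rfl
  have hdx : ∑ t ∈ A, (G t).dx L ≤ P := sum_separators_le A hk h.hL h.x
  have hdy : ∑ t ∈ A, (G t).dy L ≤ P := sum_separators_le A hk h.hL h.y
  have hx : ∑ t ∈ A, ((G t).x1 - (G t).x0) ≤ P * L := by
    simp only [G, rawGroup, upto_sub_below]
    exact (sum_keys_le A hk wX).trans h.x
  have hy : ∑ t ∈ A, ((G t).y1 - (G t).y0) ≤ P * L := by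
    simp only [G, rawGroup, upto_sub_below]
    exact (sum_keys_le A hk wY).trans h.y
  have hxy : ∑ t ∈ A, ((G t).x1 - (G t).x0) * ((G t).y1 - (G t).y0) ≤ P * L ^ 2 := by
    simp only [G, rawGroup, upto_sub_below]
    refine le_trans (le_of_eq ?_) ((sum_keys_le A hk _).trans h.xy)
    refine Finset.sum_congr rfl fun t _ => ?_
    rw [Finset.sum_mul]
    refine Finset.sum_congr rfl fun u hu => ?_
    rw [(Finset.mem_filter.1 hu).2]
  have hprod : ∑ t ∈ A, (G t).dx L * (G t).dy L ≤ 4 * P := by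
    have hL2 : 0 < L ^ 2 := by have := h.hL; positivity
    refine Nat.le_of_mul_le_mul_left ?_ hL2
    rw [Finset.mul_sum]
    refine (Finset.sum_le_sum fun t _ => Group.sq_mul_dx_mul_dy_le h.hL (G t)).trans ?_
    rw [Finset.sum_add_distrib, Finset.sum_add_distrib, Finset.sum_add_distrib, ← Finset.mul_sum,
      ← Finset.mul_sum, ← Finset.mul_sum]
    have a1 := Nat.mul_le_mul_left L hx
    have a2 := Nat.mul_le_mul_left L hy
    have a3 := Nat.mul_le_mul_left (L ^ 2) hdx
    have a4 : L * (P * L) = P * L ^ 2 := by ring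
    have a5 : L ^ 2 * P = P * L ^ 2 := by ring
    have a6 : L ^ 2 * (4 * P) = 4 * (P * L ^ 2) := by ring
    rw [a4] at a1 a2
    rw [a5] at a3
    rw [a6]
    omega
  rw [h1]
  refine (Finset.sum_le_sum fun t _ => (G t).extra_le).trans ?_
  rw [Finset.sum_add_distrib, Finset.sum_add_distrib]
  omega

/-- The number of a cell. -/
noncomputable def cellOf (S : Finset T) (k : T → κ) (wX wY : T → ℕ) (P L : ℕ) (g : κ) (I J : ℕ) :
    ℕ :=
  (groupOf S k wX wY L g).cell (2 * P + 1) L I J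

theorem Fits.corner_lt (h : Fits S k wX wY P L) (g : κ) :
    (groupOf S k wX wY L g).x0 / L + (groupOf S k wX wY L g).y0 / L < 2 * P + 1 := by
  have h1 : (groupOf S k wX wY L g).x0 / L ≤ P := by
    have : below S k wX g / L ≤ P * L / L :=
      Nat.div_le_div_right ((below_le_upto g).trans ((upto_le_sum _).trans h.x))
    rwa [Nat.mul_div_cancel _ h.hL] at this
  have h2 : (groupOf S k wX wY L g).y0 / L ≤ P := by
    have : below S k wY g / L ≤ P * L / L :=
      Nat.div_le_div_right ((below_le_upto g).trans ((upto_le_sum _).trans h.y))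
    rwa [Nat.mul_div_cancel _ h.hL] at this
  omega

/-- There are `2 * P + 1` numbers for first cells, as either corner index is at most `P`, and at
most `6 * P` extra cells; `P ≥ 1` absorbs the 1. -/
theorem Fits.cellOf_lt (h : Fits S k wX wY P L) {g : κ} {I J : ℕ}
    (hg : (groupOf S k wX wY L g).Proper) (hI : (groupOf S k wX wY L g).IsX L I)
    (hJ : (groupOf S k wX wY L g).IsY L J) : cellOf S k wX wY P L g I J < 9 * P := by
  have h1 : cellOf S k wX wY P L g I J < 2 * P + 1 + 6 * P :=
    Group.cell_lt hg hI hJ (h.corner_lt g)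
      ((base_add_extra_le g).trans ((upto_le_sum g).trans h.sum_cellWeight))
  have := h.hP
  omega

/-- A cell number determines the two blocks, though not the group. This suffices to bound what a
cell receives by one block per side. -/
theorem Fits.cellOf_injective (h : Fits S k wX wY P L) {g g' : κ} {I J I' J' : ℕ}
    (hg : (groupOf S k wX wY L g).Proper) (hg' : (groupOf S k wX wY L g').Proper)
    (hI : (groupOf S k wX wY L g).IsX L I) (hJ : (groupOf S k wX wY L g).IsY L J)
    (hI' : (groupOf S k wX wY L g').IsX L I') (hJ' : (groupOf S k wX wY L g').IsY L J')
    (e : cellOf S k wX wY P L g I J = cellOf S k wX wY P L g' I' J') : I = I' ∧ J = J' := by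
  rcases lt_trichotomy g g' with hl | rfl | hl
  · exact Group.cell_ne_of_before hg hI hJ hI' hJ' (h.corner_lt g) (h.corner_lt g')
      (groupOf_before hl) e
  · exact Group.cell_injective hI hJ hI' hJ' (h.corner_lt g) e
  · have := Group.cell_ne_of_before hg' hI' hJ' hI hJ (h.corner_lt g') (h.corner_lt g)
      (groupOf_before hl) e.symm
    exact ⟨this.1.symm, this.2.symm⟩

/-- If every cell receives elements from only one block of `L` positions, and the cells are spread
over `P` servers, then every server receives at most `9 * L` elements. -/
theorem card_cell_le {ι : Type*} (A : Finset ι) (cell pos : ι → ℕ) {P L : ℕ} (hP : 0 < P)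
    (hL : 0 < L)
    (hlt : ∀ a ∈ A, cell a < 9 * P)
    (hblock : ∀ a ∈ A, ∀ b ∈ A, cell a = cell b → pos a / L = pos b / L)
    (hinj : ∀ a ∈ A, ∀ b ∈ A, cell a = cell b → pos a = pos b → a = b) (d : ℕ) :
    (A.filter (fun a => cell a % P = d)).card ≤ 9 * L := by
  rw [Finset.card_eq_sum_card_fiberwise (f := fun a => cell a / P) (t := Finset.range 9)]
  · refine (Finset.sum_le_card_nsmul _ _ L fun e _ => ?_).trans (by simp)
    refine (Finset.card_le_card_of_injOn (t := Finset.range L) (fun a => pos a % L) ?_ ?_).trans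
      (Finset.card_range L).le
    · intro a _
      simpa using Nat.mod_lt _ hL
    · intro a ha b hb hab
      simp only [Finset.coe_filter, Finset.mem_filter, Set.mem_ofPred_eq] at ha hb
      have hc : cell a = cell b := by
        rw [← Nat.div_add_mod (cell a) P, ha.2, ha.1.2, ← hb.2, ← hb.1.2, Nat.div_add_mod]
      refine hinj a ha.1.1 b hb.1.1 hc ?_
      have h1 := hblock a ha.1.1 b hb.1.1 hc
      simp only at hab
      rw [← Nat.div_add_mod (pos a) L, h1, hab, Nat.div_add_mod]
  · intro a ha
    simp only [Finset.coe_filter, Set.mem_ofPred_eq] at ha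
    simp only [Finset.coe_range, Set.mem_Iio]
    rw [Nat.div_lt_iff_lt_mul hP]
    exact hlt a ha.1

end Plan

end MPC

/-! ### Delivering tuples to the cells -/

namespace MPC

set_option linter.unusedSectionVars false

/-- The weight of the elements of a set. -/
def ind {T : Type*} [DecidableEq T] (F : Finset T) (t : T) : ℕ := if t ∈ F then 1 else 0

namespace Run

variable {p : ℕ} {T Ω : Type*} {init : Ω → Fin p → Finset T} {L Bd : Ω → ℕ}
variable {κ κ' : Type*} [LinearOrder T] [LinearOrder κ] [LinearOrder κ']
variable {q m : ℕ} {n : Ω → ℕ} {tuples : Ω → Finset T} {home : Ω → T → ℕ} {R R' : Run init L Bd}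

/-- The owners of the tuples learn the positions and the groups of their tuples. -/
theorem Env.plan (E : Env p L Bd q m n tuples home) {k : T → κ}
    (hR : R.Ready q m n tuples home) (hrk : R.Ranked q m tuples home k) {wX wY : Ω → T → ℕ}
    (hX : R.HomeKnows q m tuples home wX) (hY : R.HomeKnows q m tuples home wY) {l : Ω → ℕ}
    (hl : ∀ v < q ^ m, R.Knows v l)
    (hfit : ∀ ω, Fits (tuples ω) k (wX ω) (wY ω) (q ^ m) (l ω))
    (hBd : ∀ ω, q ^ m * l ω ≤ Bd ω) (hBd' : ∀ ω, 6 * q ^ m ≤ Bd ω) :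
    ∃ R' : Run init L Bd, R.Ext (3 * (m + 2)) R' ∧ R'.HomeKnows q m tuples home (fun ω t =>
      (before (tuples ω) k (wX ω) t, before (tuples ω) k (wY ω) t,
        groupOf (tuples ω) k (wX ω) (wY ω) (l ω) (k t))) := by
  obtain ⟨R₁, e₁, h₁⟩ := E.query hR hrk hX (fun ω => (hfit ω).x.trans (hBd ω))
  obtain ⟨R₂, e₂, h₂⟩ := E.query (hR.mono e₁) (hrk.mono e₁) (hY.mono e₁)
    (fun ω => (hfit ω).y.trans (hBd ω))
  have h₃ := Own.prod ((hX.mono e₁).mono e₂) (Own.prod (h₁.mono e₂) h₂)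
  -- The owner can compute `cellWeight` from the two queries at the tuple's own key. A third query
  -- adds it up to the bases of the groups.
  have hc : R₂.HomeKnows q m tuples home
      (fun ω => cellWeight (tuples ω) k (wX ω) (wY ω) (l ω)) := by
    refine Own.map h₃ _ ?_
    intro v hv ω ω' he t _ _ _ _ hf
    simp only [Prod.mk.injEq] at hf
    obtain ⟨a0, ⟨a1, a2, a3⟩, a4, a5, a6⟩ := hf
    have hll : l ω = l ω' := ((hl v hv).mono e₁).mono e₂ ω ω' he
    unfold cellWeight rawGroup
    rw [a0, a1, a2, a3, a4, a6, hll]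
  obtain ⟨R₃, e₃, h₄⟩ := E.query ((hR.mono e₁).mono e₂) ((hrk.mono e₁).mono e₂) hc
    (fun ω => (hfit ω).sum_cellWeight.trans (hBd' ω))
  refine ⟨R₃, by rw [show 3 * (m + 2) = m + 2 + (m + 2) + (m + 2) by ring]
                 exact (e₁.trans e₂).trans e₃, ?_⟩
  refine (Own.prod (h₃.mono e₃) h₄).map _ ?_
  intro v hv ω ω' he t _ _ _ _ hf
  simp only [Prod.mk.injEq] at hf
  obtain ⟨⟨a0, ⟨a1, a2, a3⟩, a4, a5, a6⟩, b1, b2, b3⟩ := hf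
  unfold groupOf
  rw [a1, a2, a3, a4, a5, a6, b1]

open Classical in
/-- The copies of the tuples of the first side for the cells in their rows. -/
noncomputable def sideX (tuples : Finset T) (k : T → κ) (wX wY : T → ℕ) (P l : ℕ) :
    Finset (T × ℕ) :=
  (tuples ×ˢ Finset.range (P + 1)).filter (fun x => wX x.1 = 1 ∧
    (groupOf tuples k wX wY l (k x.1)).Proper ∧ (groupOf tuples k wX wY l (k x.1)).IsY l x.2)

open Classical in
/-- The copies of the tuples of the second side for the cells in their columns. -/
noncomputable def sideY (tuples : Finset T) (k : T → κ) (wX wY : T → ℕ) (P l : ℕ) :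
    Finset (T × ℕ) :=
  (tuples ×ˢ Finset.range (P + 1)).filter (fun x => wY x.1 = 1 ∧
    (groupOf tuples k wX wY l (k x.1)).Proper ∧ (groupOf tuples k wX wY l (k x.1)).IsX l x.2)

/-- The bound `P + 1` on the block index is there only to get a finite set; `Fits` implies it. -/
theorem mem_sideX {S : Finset T} {k : T → κ} {wX wY : T → ℕ} {P l : ℕ}
    (hfit : Fits S k wX wY P l) {x : T × ℕ} : x ∈ sideX S k wX wY P l ↔ x.1 ∈ S ∧ wX x.1 = 1 ∧
      (groupOf S k wX wY l (k x.1)).Proper ∧ (groupOf S k wX wY l (k x.1)).IsY l x.2 := by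
  simp only [sideX, Finset.mem_filter, Finset.mem_product, Finset.mem_range]
  refine ⟨fun h => ⟨h.1.1, h.2⟩, fun h => ⟨⟨h.1, ?_⟩, h.2⟩⟩
  have h1 : (groupOf S k wX wY l (k x.1)).y1 - 1 ≤ P * l :=
    (Nat.sub_le _ _).trans ((upto_le_sum _).trans hfit.y)
  have h2 := h.2.2.2.2.trans (Nat.div_le_div_right (c := l) h1)
  rw [Nat.mul_div_cancel _ hfit.hL] at h2
  exact Nat.lt_succ_of_le h2

theorem mem_sideY {S : Finset T} {k : T → κ} {wX wY : T → ℕ} {P l : ℕ}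
    (hfit : Fits S k wX wY P l) {x : T × ℕ} : x ∈ sideY S k wX wY P l ↔ x.1 ∈ S ∧ wY x.1 = 1 ∧
      (groupOf S k wX wY l (k x.1)).Proper ∧ (groupOf S k wX wY l (k x.1)).IsX l x.2 := by
  simp only [sideY, Finset.mem_filter, Finset.mem_product, Finset.mem_range]
  refine ⟨fun h => ⟨h.1.1, h.2⟩, fun h => ⟨⟨h.1, ?_⟩, h.2⟩⟩
  have h1 : (groupOf S k wX wY l (k x.1)).x1 - 1 ≤ P * l :=
    (Nat.sub_le _ _).trans ((upto_le_sum _).trans hfit.x)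
  have h2 := h.2.2.2.2.trans (Nat.div_le_div_right (c := l) h1)
  rw [Nat.mul_div_cancel _ hfit.hL] at h2
  exact Nat.lt_succ_of_le h2

theorem isX_before {S : Finset T} {k : T → κ} {wX wY : T → ℕ} {l : ℕ} {t : T} (ht : t ∈ S)
    (hw : wX t = 1) : (groupOf S k wX wY l (k t)).IsX l (before S k wX t / l) := by
  have h1 := before_add_le_upto (w := wX) (k := k) ht
  exact Group.isX_of_mem (below_le_before t) (by rw [hw] at h1; exact h1)

theorem isY_before {S : Finset T} {k : T → κ} {wX wY : T → ℕ} {l : ℕ} {t : T} (ht : t ∈ S)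
    (hw : wY t = 1) : (groupOf S k wX wY l (k t)).IsY l (before S k wY t / l) := by
  have h1 := before_add_le_upto (w := wY) (k := k) ht
  exact Group.isY_of_mem (below_le_before t) (by rw [hw] at h1; exact h1)

theorem eq_of_before_eq {S : Finset T} {k : T → κ} {w : T → ℕ} {t t' : T} (ht : t ∈ S)
    (hw : w t = 1) (ht' : t' ∈ S) (hw' : w t' = 1) (e : before S k w t = before S k w t') :
    t = t' :=
  before_disjoint (k := k) (w := w) (x := before S k w t) ht ht' le_rfl (by omega) e.symm.le
    (by omega)

/-- The tuples of the first side are sent to the cells in their rows. -/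
theorem Env.deliverX (E : Env p L Bd q m n tuples home) {k : T → κ} {wX wY : Ω → T → ℕ} {l : Ω → ℕ}
    (hl : ∀ v < q ^ m, R.Knows v l)
    (hfit : ∀ ω, Fits (tuples ω) k (wX ω) (wY ω) (q ^ m) (l ω))
    (hX : R.HomeKnows q m tuples home wX)
    (hplan : R.HomeKnows q m tuples home (fun ω t =>
      (before (tuples ω) k (wX ω) t, before (tuples ω) k (wY ω) t,
        groupOf (tuples ω) k (wX ω) (wY ω) (l ω) (k t))))
    {α : Type*} {f : Ω → T → α} (hf : R.HomeKnows q m tuples home f)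
    {c : ℕ} {g : α → List ℕ} (hg : Function.Injective g) (hlen : ∀ a, (g a).length = c)
    (hbd : ∀ ω, ∀ t ∈ tuples ω, wX ω t = 1 → ∀ x ∈ g (f ω t), x ≤ Bd ω)
    (hL : ∀ ω, (c + 2) * (9 * l ω) ≤ L ω) :
    ∃ R' : Run init L Bd, R.Ext 1 R' ∧ R'.Own (q ^ m) (fun x : T × ℕ => ({x.1} : Set T))
      (fun ω => sideX (tuples ω) k (wX ω) (wY ω) (q ^ m) (l ω))
      (fun ω x => cellOf (tuples ω) k (wX ω) (wY ω) (q ^ m) (l ω) (k x.1)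
        (before (tuples ω) k (wX ω) x.1 / l ω) x.2 % q ^ m) (fun ω x => f ω x.1) := by
  have hP : 0 < q ^ m := by have := E.hq; positivity
  have h₁ := Own.prod hX (Own.prod hplan hf)
  have h₂ : R.Own (q ^ m) (fun x : T × ℕ => ({x.1} : Set T))
      (fun ω => sideX (tuples ω) k (wX ω) (wY ω) (q ^ m) (l ω)) (fun ω x => home ω x.1)
      (fun ω x => f ω x.1) := by
    constructor
    · intro ω x hx
      exact E.lt ω x.1 ((mem_sideX (hfit ω)).1 hx).1
    · intro v hv ω ω' he x hx ho
      rw [mem_sideX (hfit ω)] at hx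
      obtain ⟨b1, b2, b3⟩ := h₁.know v hv ω ω' he x.1 hx.1 ho
      simp only [Prod.mk.injEq] at b3
      obtain ⟨c1, ⟨c2, c3, c4⟩, c5⟩ := b3
      rw [mem_sideX (hfit ω'), ← c1, ← c4, ← hl v hv ω ω' he]
      exact ⟨⟨b1, hx.2⟩, b2, c5⟩
    · intro ω x hx t ht
      exact hX.has ω x.1 ((mem_sideX (hfit ω)).1 hx).1 t ht
  refine h₂.move E.hP _ (fun ω x _ => Nat.mod_lt _ hP) ?_ (copyCodec (T := T) α c g hg hlen) ?_ ?_
  · intro v hv ω ω' he x hx _ ho _ _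
    rw [mem_sideX (hfit ω)] at hx
    obtain ⟨b1, b2, b3⟩ := h₁.know v hv ω ω' he x.1 hx.1 ho
    simp only [Prod.mk.injEq] at b3
    obtain ⟨c1, ⟨c2, c3, c4⟩, c5⟩ := b3
    unfold cellOf
    rw [c2, c4, hl v hv ω ω' he]
  · intro ω x hx i hi
    have h2 := (E.le_bd ω).2
    have h3 : x.2 < q ^ m + 1 := by
      simp only [sideX, Finset.mem_filter, Finset.mem_product, Finset.mem_range] at hx
      exact hx.1.2
    rw [mem_sideX (hfit ω)] at hx
    simp only [List.mem_cons, reduceCtorEq, false_or, Word.int.injEq, List.mem_map,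
      exists_eq_right] at hi
    rcases hi with rfl | hi
    · omega
    · exact hbd ω x.1 hx.1 hx.2.1 i hi
  · intro ω d _
    refine le_trans (Nat.mul_le_mul_left _ ?_) (hL ω)
    -- The cell number determines the block of the tuple, so a cell receives one block of positions.
    -- It also determines the column, so position and cell determine the copy.
    refine card_cell_le _ _ (fun x => before (tuples ω) k (wX ω) x.1) hP (hfit ω).hL ?_ ?_ ?_ d
    · intro x hx
      rw [mem_sideX (hfit ω)] at hx
      exact (hfit ω).cellOf_lt hx.2.2.1 (isX_before hx.1 hx.2.1) hx.2.2.2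
    · intro x hx y hy e
      rw [mem_sideX (hfit ω)] at hx hy
      exact ((hfit ω).cellOf_injective hx.2.2.1 hy.2.2.1 (isX_before hx.1 hx.2.1) hx.2.2.2
        (isX_before hy.1 hy.2.1) hy.2.2.2 e).1
    · intro x hx y hy e e'
      rw [mem_sideX (hfit ω)] at hx hy
      have h1 := ((hfit ω).cellOf_injective hx.2.2.1 hy.2.2.1 (isX_before hx.1 hx.2.1) hx.2.2.2
        (isX_before hy.1 hy.2.1) hy.2.2.2 e).2
      have hxy := eq_of_before_eq hx.1 hx.2.1 hy.1 hy.2.1 e'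
      exact Prod.ext hxy h1

/-- The tuples of the second side are sent to the cells in their columns. -/
theorem Env.deliverY (E : Env p L Bd q m n tuples home) {k : T → κ} {wX wY : Ω → T → ℕ} {l : Ω → ℕ}
    (hl : ∀ v < q ^ m, R.Knows v l)
    (hfit : ∀ ω, Fits (tuples ω) k (wX ω) (wY ω) (q ^ m) (l ω))
    (hY : R.HomeKnows q m tuples home wY)
    (hplan : R.HomeKnows q m tuples home (fun ω t =>
      (before (tuples ω) k (wX ω) t, before (tuples ω) k (wY ω) t,
        groupOf (tuples ω) k (wX ω) (wY ω) (l ω) (k t))))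
    {α : Type*} {f : Ω → T → α} (hf : R.HomeKnows q m tuples home f)
    {c : ℕ} {g : α → List ℕ} (hg : Function.Injective g) (hlen : ∀ a, (g a).length = c)
    (hbd : ∀ ω, ∀ t ∈ tuples ω, wY ω t = 1 → ∀ x ∈ g (f ω t), x ≤ Bd ω)
    (hL : ∀ ω, (c + 2) * (9 * l ω) ≤ L ω) :
    ∃ R' : Run init L Bd, R.Ext 1 R' ∧ R'.Own (q ^ m) (fun x : T × ℕ => ({x.1} : Set T))
      (fun ω => sideY (tuples ω) k (wX ω) (wY ω) (q ^ m) (l ω))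
      (fun ω x => cellOf (tuples ω) k (wX ω) (wY ω) (q ^ m) (l ω) (k x.1) x.2
        (before (tuples ω) k (wY ω) x.1 / l ω) % q ^ m) (fun ω x => f ω x.1) := by
  have hP : 0 < q ^ m := by have := E.hq; positivity
  have h₁ := Own.prod hY (Own.prod hplan hf)
  have h₂ : R.Own (q ^ m) (fun x : T × ℕ => ({x.1} : Set T))
      (fun ω => sideY (tuples ω) k (wX ω) (wY ω) (q ^ m) (l ω)) (fun ω x => home ω x.1)
      (fun ω x => f ω x.1) := by
    constructor
    · intro ω x hx
      exact E.lt ω x.1 ((mem_sideY (hfit ω)).1 hx).1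
    · intro v hv ω ω' he x hx ho
      rw [mem_sideY (hfit ω)] at hx
      obtain ⟨b1, b2, b3⟩ := h₁.know v hv ω ω' he x.1 hx.1 ho
      simp only [Prod.mk.injEq] at b3
      obtain ⟨c1, ⟨c2, c3, c4⟩, c5⟩ := b3
      rw [mem_sideY (hfit ω'), ← c1, ← c4, ← hl v hv ω ω' he]
      exact ⟨⟨b1, hx.2⟩, b2, c5⟩
    · intro ω x hx t ht
      exact hY.has ω x.1 ((mem_sideY (hfit ω)).1 hx).1 t ht
  refine h₂.move E.hP _ (fun ω x _ => Nat.mod_lt _ hP) ?_ (copyCodec (T := T) α c g hg hlen) ?_ ?_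
  · intro v hv ω ω' he x hx _ ho _ _
    rw [mem_sideY (hfit ω)] at hx
    obtain ⟨b1, b2, b3⟩ := h₁.know v hv ω ω' he x.1 hx.1 ho
    simp only [Prod.mk.injEq] at b3
    obtain ⟨c1, ⟨c2, c3, c4⟩, c5⟩ := b3
    unfold cellOf
    rw [c3, c4, hl v hv ω ω' he]
  · intro ω x hx i hi
    have h2 := (E.le_bd ω).2
    have h3 : x.2 < q ^ m + 1 := by
      simp only [sideY, Finset.mem_filter, Finset.mem_product, Finset.mem_range] at hx
      exact hx.1.2
    rw [mem_sideY (hfit ω)] at hx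
    simp only [List.mem_cons, reduceCtorEq, false_or, Word.int.injEq, List.mem_map,
      exists_eq_right] at hi
    rcases hi with rfl | hi
    · omega
    · exact hbd ω x.1 hx.1 hx.2.1 i hi
  · intro ω d _
    refine le_trans (Nat.mul_le_mul_left _ ?_) (hL ω)
    refine card_cell_le _ _ (fun x => before (tuples ω) k (wY ω) x.1) hP (hfit ω).hL ?_ ?_ ?_ d
    · intro x hx
      rw [mem_sideY (hfit ω)] at hx
      exact (hfit ω).cellOf_lt hx.2.2.1 hx.2.2.2 (isY_before hx.1 hx.2.1)
    · intro x hx y hy e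
      rw [mem_sideY (hfit ω)] at hx hy
      exact ((hfit ω).cellOf_injective hx.2.2.1 hy.2.2.1 hx.2.2.2 (isY_before hx.1 hx.2.1)
        hy.2.2.2 (isY_before hy.1 hy.2.1) e).2
    · intro x hx y hy e e'
      rw [mem_sideY (hfit ω)] at hx hy
      have h1 := ((hfit ω).cellOf_injective hx.2.2.1 hy.2.2.1 hx.2.2.2 (isY_before hx.1 hx.2.1)
        hy.2.2.2 (isY_before hy.1 hy.2.1) e).1
      exact Prod.ext (eq_of_before_eq hx.1 hx.2.1 hy.1 hy.2.1 e') h1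

end Run

end MPC

/-! ### The two-step join -/

namespace MPC

set_option linter.unusedSectionVars false

/-- The number of elements of `F₃` that match an element of `F₂`. -/
def matchWeight {T κ : Type*} [DecidableEq T] [DecidableEq κ] (S : Finset T) (k : T → κ)
    (F₂ F₃ : Finset T) (t : T) : ℕ :=
  if t ∈ F₂ then ∑ u ∈ S with k u = k t, ind F₃ u else 0

namespace Run

variable {p : ℕ} {T Ω : Type*} {init : Ω → Fin p → Finset T} {L Bd : Ω → ℕ}
variable {κ κ' : Type*} [LinearOrder T] [LinearOrder κ] [LinearOrder κ']
variable {q m : ℕ} {n : Ω → ℕ} {tuples : Ω → Finset T} {home : Ω → T → ℕ} {R R' : Run init L Bd}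

/-- The index of a tuple of the second side in its group. -/
def indexInGroup (S : Finset T) (k : T → κ) (w : T → ℕ) (t : T) : ℕ :=
  before S k w t - below S k w (k t)

theorem indexInGroup_lt {S : Finset T} {k : T → κ} {w : T → ℕ} {t : T} (ht : t ∈ S)
    (hw : w t = 1) : indexInGroup S k w t < ∑ u ∈ S with k u = k t, w u := by
  have h1 := before_add_le_upto (k := k) (w := w) ht
  have h2 := below_le_before (S := S) (k := k) (w := w) t
  rw [upto_eq] at h1
  unfold indexInGroup
  omega

open Classical in
/-- The matching pairs of `F₂` and `F₃`, with the columns of cells to which they go. -/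
noncomputable def pairSide (S : Finset T) (k₁ : T → κ) (k₂ : T → κ') (F₁ F₂ F₃ : Finset T)
    (P l : ℕ) : Finset ((T × T) × ℕ) :=
  ((S ×ˢ S) ×ˢ Finset.range (P + 1)).filter (fun x => x.1.1 ∈ F₂ ∧ x.1.2 ∈ F₃ ∧
    k₂ x.1.1 = k₂ x.1.2 ∧
    (groupOf S k₁ (ind F₁) (matchWeight S k₂ F₂ F₃) l (k₁ x.1.1)).Proper ∧
    (groupOf S k₁ (ind F₁) (matchWeight S k₂ F₂ F₃) l (k₁ x.1.1)).IsX l x.2)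

theorem mem_pairSide {S : Finset T} {k₁ : T → κ} {k₂ : T → κ'} {F₁ F₂ F₃ : Finset T} {P l : ℕ}
    (hfit : Fits S k₁ (ind F₁) (matchWeight S k₂ F₂ F₃) P l) {x : (T × T) × ℕ} :
    x ∈ pairSide S k₁ k₂ F₁ F₂ F₃ P l ↔ x.1.1 ∈ S ∧ x.1.2 ∈ S ∧ x.1.1 ∈ F₂ ∧ x.1.2 ∈ F₃ ∧
      k₂ x.1.1 = k₂ x.1.2 ∧
      (groupOf S k₁ (ind F₁) (matchWeight S k₂ F₂ F₃) l (k₁ x.1.1)).Proper ∧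
      (groupOf S k₁ (ind F₁) (matchWeight S k₂ F₂ F₃) l (k₁ x.1.1)).IsX l x.2 := by
  simp only [pairSide, Finset.mem_filter, Finset.mem_product, Finset.mem_range]
  refine ⟨fun h => ⟨h.1.1.1, h.1.1.2, h.2⟩, fun h => ⟨⟨⟨h.1, h.2.1⟩, ?_⟩, h.2.2⟩⟩
  have h1 : (groupOf S k₁ (ind F₁) (matchWeight S k₂ F₂ F₃) l (k₁ x.1.1)).x1 - 1 ≤ P * l :=
    (Nat.sub_le _ _).trans ((upto_le_sum _).trans hfit.x)
  have h2 := h.2.2.2.2.2.2.2.trans (Nat.div_le_div_right (c := l) h1)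
  rw [Nat.mul_div_cancel _ hfit.hL] at h2
  exact Nat.lt_succ_of_le h2

theorem ind_eq_one {F : Finset T} {t : T} : ind F t = 1 ↔ t ∈ F := by
  unfold ind
  split_ifs with h <;> simp [h]

/-- Where a matching pair of `F₂` and `F₃` lies among all such pairs, sorted by `k₁`. -/
def pairPos (S : Finset T) (k₁ : T → κ) (k₂ : T → κ') (F₂ F₃ : Finset T) (t₂ t₃ : T) : ℕ :=
  before S k₁ (matchWeight S k₂ F₂ F₃) t₂ + indexInGroup S k₂ (ind F₃) t₃

theorem pairPos_lt {S : Finset T} {k₁ : T → κ} {k₂ : T → κ'} {F₂ F₃ : Finset T} {t₂ t₃ : T}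
    (ht₂ : t₂ ∈ F₂) (hS : t₃ ∈ S) (ht₃ : t₃ ∈ F₃) (hk : k₂ t₂ = k₂ t₃) :
    pairPos S k₁ k₂ F₂ F₃ t₂ t₃ < before S k₁ (matchWeight S k₂ F₂ F₃) t₂ +
      matchWeight S k₂ F₂ F₃ t₂ := by
  have := indexInGroup_lt (k := k₂) (w := ind F₃) hS (ind_eq_one.2 ht₃)
  rw [matchWeight, if_pos ht₂, hk]
  exact Nat.add_lt_add_left this _

theorem isY_pairPos {S : Finset T} {k₁ : T → κ} {k₂ : T → κ'} {F₁ F₂ F₃ : Finset T} {t₂ t₃ : T}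
    {l : ℕ} (hS' : t₂ ∈ S) (ht₂ : t₂ ∈ F₂) (hS : t₃ ∈ S) (ht₃ : t₃ ∈ F₃) (hk : k₂ t₂ = k₂ t₃) :
    (groupOf S k₁ (ind F₁) (matchWeight S k₂ F₂ F₃) l (k₁ t₂)).IsY l
      (pairPos S k₁ k₂ F₂ F₃ t₂ t₃ / l) := by
  have h1 := before_add_le_upto (k := k₁) (w := matchWeight S k₂ F₂ F₃) hS'
  have h2 := below_le_before (S := S) (k := k₁) (w := matchWeight S k₂ F₂ F₃) t₂
  have h3 := pairPos_lt (k₁ := k₁) ht₂ hS ht₃ hk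
  refine Group.isY_of_mem (h2.trans ?_) (h3.trans_le h1)
  exact Nat.le_add_right _ _

/-- In the order by `k₁`, the tuple `t₂` occupies an interval whose length is its number of
partners, and the index of `t₃` among these partners selects a slot. Thus a pair gets a global
position although no server ever sorts the pairs. -/
theorem pairPos_injective {S : Finset T} {k₁ : T → κ} {k₂ : T → κ'} {F₂ F₃ : Finset T}
    {t₂ t₃ t₂' t₃' : T} (hS₂ : t₂ ∈ S) (ht₂ : t₂ ∈ F₂) (hS₃ : t₃ ∈ S) (ht₃ : t₃ ∈ F₃)
    (hk : k₂ t₂ = k₂ t₃) (hS₂' : t₂' ∈ S) (ht₂' : t₂' ∈ F₂) (hS₃' : t₃' ∈ S) (ht₃' : t₃' ∈ F₃)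
    (hk' : k₂ t₂' = k₂ t₃')
    (e : pairPos S k₁ k₂ F₂ F₃ t₂ t₃ = pairPos S k₁ k₂ F₂ F₃ t₂' t₃') : t₂ = t₂' ∧ t₃ = t₃' := by
  have h : t₂ = t₂' := before_disjoint hS₂ hS₂' (Nat.le_add_right _ _)
    (pairPos_lt (k₁ := k₁) ht₂ hS₃ ht₃ hk)
    (by rw [← pairPos, e]; exact Nat.le_add_right _ _)
    (by rw [← pairPos, e]; exact pairPos_lt ht₂' hS₃' ht₃' hk')
  subst h
  refine ⟨rfl, ?_⟩
  have h1 : indexInGroup S k₂ (ind F₃) t₃ = indexInGroup S k₂ (ind F₃) t₃' := by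
    unfold pairPos at e
    omega
  have h2 := below_le_before (S := S) (k := k₂) (w := ind F₃) t₃
  have h3 := below_le_before (S := S) (k := k₂) (w := ind F₃) t₃'
  unfold indexInGroup at h1
  rw [← hk, hk'] at h1 h2
  exact eq_of_before_eq (k := k₂) hS₃ (ind_eq_one.2 ht₃) hS₃' (ind_eq_one.2 ht₃') (by omega)

theorem groupOf_proper {S : Finset T} {k : T → κ} {wX wY : T → ℕ} {l : ℕ} {t t' : T} (ht : t ∈ S)
    (ht' : t' ∈ S) (hw : 0 < wX t) (hw' : 0 < wY t') (hk : k t = k t') :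
    (groupOf S k wX wY l (k t)).Proper := by
  have h1 := before_add_le_upto (k := k) (w := wX) ht
  have h2 := below_le_before (S := S) (k := k) (w := wX) t
  have h3 := before_add_le_upto (k := k) (w := wY) ht'
  have h4 := below_le_before (S := S) (k := k) (w := wY) t'
  rw [← hk] at h3 h4
  constructor
  · show below S k wX (k t) < upto S k wX (k t)
    omega
  · show below S k wY (k t) < upto S k wY (k t)
    omega

theorem pairCodec : IsCodec (fun x : (T × T) × ℕ => ({x.1.1, x.1.2} : Set T))
    (fun x (_ : Unit) => [Word.tuple x.1.1, Word.tuple x.1.2, Word.int x.2]) 3 where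
  pos := by norm_num
  len := by intro i a; rfl
  inj := by
    rintro ⟨⟨a, b⟩, c⟩ _ ⟨⟨a', b'⟩, c'⟩ _ e
    simpa [and_assoc] using e
  tup := by intro i a t; simp

/-- The two-step join: first the pairs of `F₂` and `F₃` that match with respect to `k₂` meet, then
they meet the elements of `F₁` that match with respect to `k₁`. -/
theorem Env.join (E : Env p L Bd q m n tuples home) {k₁ : T → κ} {k₂ : T → κ'}
    (hR : R.Ready q m n tuples home) (hrk₁ : R.Ranked q m tuples home k₁)
    (hrk₂ : R.Ranked q m tuples home k₂) {F₁ F₂ F₃ : Ω → Finset T}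
    (hsub₁ : ∀ ω, F₁ ω ⊆ tuples ω) (hsub₂ : ∀ ω, F₂ ω ⊆ tuples ω) (hsub₃ : ∀ ω, F₃ ω ⊆ tuples ω)
    (hF₁ : R.HomeKnows q m tuples home (fun ω => ind (F₁ ω)))
    (hF₂ : R.HomeKnows q m tuples home (fun ω => ind (F₂ ω)))
    (hF₃ : R.HomeKnows q m tuples home (fun ω => ind (F₃ ω)))
    {l : Ω → ℕ} (hl : ∀ v < q ^ m, R.Knows v l)
    (hfit₂ : ∀ ω, Fits (tuples ω) k₂ (ind (F₂ ω)) (ind (F₃ ω)) (q ^ m) (l ω))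
    (hfit₁ : ∀ ω, Fits (tuples ω) k₁ (ind (F₁ ω)) (matchWeight (tuples ω) k₂ (F₂ ω) (F₃ ω))
      (q ^ m) (l ω))
    (hBd : ∀ ω, q ^ m * l ω ≤ Bd ω) (hBd' : ∀ ω, 6 * q ^ m ≤ Bd ω) (hL : ∀ ω, 72 * l ω ≤ L ω) :
    ∃ R' : Run init L Bd, R.Ext (6 * (m + 2) + 4) R' ∧
      ∀ ω, ∀ t₁ ∈ F₁ ω, ∀ t₂ ∈ F₂ ω, ∀ t₃ ∈ F₃ ω, k₁ t₁ = k₁ t₂ → k₂ t₂ = k₂ t₃ →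
        ∃ v < q ^ m, R'.Has ω v t₁ ∧ R'.Has ω v t₂ ∧ R'.Has ω v t₃ := by
  have hP : 0 < q ^ m := by have := E.hq; positivity
  obtain ⟨R₁, e₁, plan₂⟩ := E.plan hR hrk₂ hF₂ hF₃ hl hfit₂ hBd hBd'
  -- The number of partners of a tuple of `F₂` is the length of the second interval of its
  -- `k₂`-group, which the first plan has made known.
  have hmatch : R₁.HomeKnows q m tuples home
      (fun ω => matchWeight (tuples ω) k₂ (F₂ ω) (F₃ ω)) := by
    refine Own.map (Own.prod (hF₂.mono e₁) plan₂) _ ?_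
    intro v hv ω ω' he t ht ht' _ _ hf
    simp only [Prod.mk.injEq] at hf
    obtain ⟨a1, a2, a3, a4⟩ := hf
    unfold matchWeight
    rw [← upto_sub_below, ← upto_sub_below]
    have b1 := congrArg Group.y0 a4
    have b2 := congrArg Group.y1 a4
    simp only [groupOf] at b1 b2
    rw [b1, b2]
    have b3 : t ∈ F₂ ω ↔ t ∈ F₂ ω' := by rw [← ind_eq_one, a1, ind_eq_one]
    simp only [b3]
  obtain ⟨R₂, e₂, plan₁⟩ := E.plan (hR.mono e₁) (hrk₁.mono e₁) (hF₁.mono e₁) hmatch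
    (fun v hv => (hl v hv).mono e₁) hfit₁ hBd hBd'
  have e₁₂ := e₁.trans e₂
  have hl₂ : ∀ v < q ^ m, R₂.Knows v l := fun v hv => (hl v hv).mono e₁₂
  have plan₂' : R₂.HomeKnows q m tuples home _ := plan₂.mono e₂
  let G₁ : Ω → κ → Group := fun ω =>
    groupOf (tuples ω) k₁ (ind (F₁ ω)) (matchWeight (tuples ω) k₂ (F₂ ω) (F₃ ω)) (l ω)
  let y₁ : Ω → T → ℕ := fun ω => before (tuples ω) k₁ (matchWeight (tuples ω) k₂ (F₂ ω) (F₃ ω))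
  -- A tuple of `F₂` takes along its position in the second join and its `k₁`-group, six integers in
  -- all. This is the most expensive delivery, with load `(6 + 2) * 9 * l = 72 * l`.
  obtain ⟨R₃, e₃, hA⟩ := E.deliverX (f := fun ω t => (y₁ ω t, G₁ ω (k₁ t))) (c := 6)
    (g := fun a => [a.1, a.2.x0, a.2.x1, a.2.y0, a.2.y1, a.2.base]) hl₂ hfit₂ (hF₂.mono e₁₂) plan₂'
    (Own.map plan₁ _ (by
      intro v hv ω ω' he t _ _ _ _ hf
      exact (Prod.mk.inj hf).2))
    (by
      rintro ⟨a, ⟨b1, b2, b3, b4, b5⟩⟩ ⟨a', ⟨b1', b2', b3', b4', b5'⟩⟩ h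
      simp only [List.cons.injEq, and_true] at h
      simp [h])
    (by intro a; rfl)
    (by
      intro ω t ht _ x hx
      have hx0 : below (tuples ω) k₁ (ind (F₁ ω)) (k₁ t) ≤ _ := below_le_upto _
      have hx1 : upto (tuples ω) k₁ (ind (F₁ ω)) (k₁ t) ≤ _ := (upto_le_sum _).trans (hfit₁ ω).x
      have hy0 : below (tuples ω) k₁ (matchWeight (tuples ω) k₂ (F₂ ω) (F₃ ω)) (k₁ t) ≤ _ :=
        below_le_upto _
      have hy1 : upto (tuples ω) k₁ (matchWeight (tuples ω) k₂ (F₂ ω) (F₃ ω)) (k₁ t) ≤ _ :=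
        (upto_le_sum _).trans (hfit₁ ω).y
      have hyb : y₁ ω t + _ ≤ _ := before_add_le_upto ht
      have hb : (G₁ ω (k₁ t)).base + _ ≤ 6 * q ^ m :=
        (base_add_extra_le _).trans ((upto_le_sum _).trans (hfit₁ ω).sum_cellWeight)
      have hbd := hBd ω
      have hbd' := hBd' ω
      simp only [List.mem_cons, List.not_mem_nil, or_false, G₁, groupOf] at hx hb
      rcases hx with rfl | rfl | rfl | rfl | rfl | rfl <;> omega)
    (fun ω => by have := hL ω; omega)
  have hl₃ : ∀ v < q ^ m, R₃.Knows v l := fun v hv => (hl₂ v hv).mono e₃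
  -- A tuple of `F₃` takes along its index in its `k₂`-group, the part of `pairPos` that its partner
  -- does not know, and its position, which identifies the cell where the pair meets.
  obtain ⟨R₄, e₄, hB⟩ := E.deliverY
    (f := fun ω t => (before (tuples ω) k₂ (ind (F₃ ω)) t,
      indexInGroup (tuples ω) k₂ (ind (F₃ ω)) t)) (c := 2)
    (g := fun a => [a.1, a.2]) hl₃ hfit₂ ((hF₃.mono e₁₂).mono e₃) (plan₂'.mono e₃)
    (Own.map (plan₂'.mono e₃) _ (by
      intro v hv ω ω' he t _ _ _ _ hf
      simp only [Prod.mk.injEq] at hf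
      have b1 := congrArg Group.y0 hf.2.2
      simp only [groupOf] at b1
      unfold indexInGroup
      rw [hf.2.1, b1]))
    (by rintro ⟨a, b⟩ ⟨c, d⟩ h; simpa using h)
    (by intro a; rfl)
    (by
      intro ω t ht _ x hx
      have h1 := before_add_le_upto (k := k₂) (w := ind (F₃ ω)) ht
      have h2 : upto (tuples ω) k₂ (ind (F₃ ω)) (k₂ t) ≤ _ := (upto_le_sum _).trans (hfit₂ ω).y
      have hbd := hBd ω
      simp only [List.mem_cons, List.not_mem_nil, or_false, indexInGroup] at hx
      rcases hx with rfl | rfl <;> omega)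
    (fun ω => by have := hL ω; omega)
  have hl₄ : ∀ v < q ^ m, R₄.Knows v l := fun v hv => (hl₃ v hv).mono e₄
  have hA' := hA.mono e₄
  let x₂ : Ω → T → ℕ := fun ω => before (tuples ω) k₂ (ind (F₂ ω))
  let y₂ : Ω → T → ℕ := fun ω => before (tuples ω) k₂ (ind (F₃ ω))
  let SC : Ω → Finset ((T × T) × ℕ) := fun ω =>
    pairSide (tuples ω) k₁ k₂ (F₁ ω) (F₂ ω) (F₃ ω) (q ^ m) (l ω)
  -- The pair belongs to the server of the cell where its tuples meet. There everything needed for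
  -- its destinations in the second join is at hand. A pair counts once for every block of `F₁` that
  -- it has to meet.
  have hC : R₄.Own (q ^ m) (fun x : (T × T) × ℕ => ({x.1.1, x.1.2} : Set T)) SC
      (fun ω x => cellOf (tuples ω) k₂ (ind (F₂ ω)) (ind (F₃ ω)) (q ^ m) (l ω) (k₂ x.1.1)
        (x₂ ω x.1.1 / l ω) (y₂ ω x.1.2 / l ω) % q ^ m)
      (fun ω x => (y₁ ω x.1.1, G₁ ω (k₁ x.1.1), indexInGroup (tuples ω) k₂ (ind (F₃ ω)) x.1.2)) := by
    have hmA : ∀ ω, ∀ x ∈ SC ω, (x.1.1, y₂ ω x.1.2 / l ω) ∈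
        sideX (tuples ω) k₂ (ind (F₂ ω)) (ind (F₃ ω)) (q ^ m) (l ω) := by
      intro ω x hx
      obtain ⟨h1, h2, h3, h4, h5, -⟩ := (mem_pairSide (hfit₁ ω)).1 hx
      refine (mem_sideX (hfit₂ ω)).2 ⟨h1, ind_eq_one.2 h3, ?_, ?_⟩
      · exact groupOf_proper h1 h2 (by rw [ind_eq_one.2 h3]; norm_num)
          (by rw [ind_eq_one.2 h4]; norm_num) h5
      · simp only
        rw [h5]
        exact isY_before h2 (ind_eq_one.2 h4)
    have hmB : ∀ ω, ∀ x ∈ SC ω, (x.1.2, x₂ ω x.1.1 / l ω) ∈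
        sideY (tuples ω) k₂ (ind (F₂ ω)) (ind (F₃ ω)) (q ^ m) (l ω) := by
      intro ω x hx
      obtain ⟨h1, h2, h3, h4, h5, -⟩ := (mem_pairSide (hfit₁ ω)).1 hx
      refine (mem_sideY (hfit₂ ω)).2 ⟨h2, ind_eq_one.2 h4, ?_, ?_⟩
      · simp only
        rw [← h5]
        exact groupOf_proper h1 h2 (by rw [ind_eq_one.2 h3]; norm_num)
          (by rw [ind_eq_one.2 h4]; norm_num) h5
      · simp only
        rw [← h5]
        exact isX_before h1 (ind_eq_one.2 h3)
    constructor
    · intro ω x _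
      exact Nat.mod_lt _ hP
    · intro v hv ω ω' he x hx ho
      obtain ⟨h1, h2, h3, h4, h5, h6, h7⟩ := (mem_pairSide (hfit₁ ω)).1 hx
      obtain ⟨a1, a2, a3⟩ := hA'.know v hv ω ω' he _ (hmA ω x hx) ho
      obtain ⟨b1, b2, b3⟩ := hB.know v hv ω ω' he _ (hmB ω x hx) (by
        simp only
        rw [← h5]
        exact ho)
      have hll := hl₄ v hv ω ω' he
      rw [mem_sideX (hfit₂ ω')] at a1
      rw [mem_sideY (hfit₂ ω')] at b1
      simp only [Prod.mk.injEq] at a3 b3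
      simp only [ind_eq_one] at a1 b1
      refine ⟨(mem_pairSide (hfit₁ ω')).2 ⟨a1.1, b1.1, a1.2.1, b1.2.1, h5, ?_, ?_⟩, ?_, ?_⟩
      · have := a3.2
        simp only [G₁] at this
        rw [← this]
        exact h6
      · have := a3.2
        simp only [G₁] at this
        rw [← this, ← hll]
        exact h7
      · have e : y₂ ω x.1.2 / l ω = y₂ ω' x.1.2 / l ω' := by
          simp only [y₂]
          rw [b3.1, hll]
        simp only at a2
        rw [e] at a2
        exact a2
      · rw [a3.1, a3.2, b3.2]
    · intro ω x hx t ht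
      obtain ⟨h1, h2, h3, h4, h5, -⟩ := (mem_pairSide (hfit₁ ω)).1 hx
      rcases ht with rfl | ht
      · exact hA'.has ω _ (hmA ω x hx) _ rfl
      · rw [Set.mem_singleton_iff] at ht
        subst ht
        have := hB.has ω _ (hmB ω x hx) _ rfl
        simp only at this
        rw [← h5] at this
        exact this
  have hC' : R₄.Own (q ^ m) (fun x : (T × T) × ℕ => ({x.1.1, x.1.2} : Set T)) SC
      (fun ω x => cellOf (tuples ω) k₂ (ind (F₂ ω)) (ind (F₃ ω)) (q ^ m) (l ω) (k₂ x.1.1)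
        (x₂ ω x.1.1 / l ω) (y₂ ω x.1.2 / l ω) % q ^ m) (fun _ _ => ()) :=
    hC.map _ (fun _ _ _ _ _ _ _ _ _ _ _ => rfl)
  -- Pairs go straight from the cells of the first join to those of the second; the load is at most
  -- `3 * 9 * l`, again because a cell receives only one block of pair positions.
  obtain ⟨R₅, e₅, hD⟩ := hC'.move E.hP
    (fun ω x => cellOf (tuples ω) k₁ (ind (F₁ ω)) (matchWeight (tuples ω) k₂ (F₂ ω) (F₃ ω)) (q ^ m)
      (l ω) (k₁ x.1.1) x.2
      (pairPos (tuples ω) k₁ k₂ (F₂ ω) (F₃ ω) x.1.1 x.1.2 / l ω) % q ^ m)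
    (fun ω x _ => Nat.mod_lt _ hP)
    (by
      intro v hv ω ω' he x hx _ ho _ _
      obtain ⟨-, -, a3⟩ := hC.know v hv ω ω' he x hx ho
      simp only [Prod.mk.injEq, y₁, G₁] at a3
      unfold cellOf pairPos
      rw [a3.1, a3.2.1, a3.2.2, hl₄ v hv ω ω' he])
    (pairCodec (T := T))
    (by
      intro ω x hx i hi
      have h2 := (E.le_bd ω).2
      have h3 : x.2 < q ^ m + 1 := by
        simp only [SC, pairSide, Finset.mem_filter, Finset.mem_product, Finset.mem_range] at hx
        exact hx.1.2
      simp only [List.mem_cons, reduceCtorEq, false_or, Word.int.injEq, List.not_mem_nil,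
        or_false] at hi
      omega)
    (by
      intro ω d _
      have hcard : ((SC ω).filter (fun x => cellOf (tuples ω) k₁ (ind (F₁ ω))
          (matchWeight (tuples ω) k₂ (F₂ ω) (F₃ ω)) (q ^ m) (l ω) (k₁ x.1.1) x.2
          (pairPos (tuples ω) k₁ k₂ (F₂ ω) (F₃ ω) x.1.1 x.1.2 / l ω) % q ^ m = d)).card ≤
          9 * l ω := by
        refine card_cell_le _ _
          (fun x => pairPos (tuples ω) k₁ k₂ (F₂ ω) (F₃ ω) x.1.1 x.1.2) hP (hfit₁ ω).hL ?_ ?_ ?_ d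
        · intro x hx
          obtain ⟨h1, h2, h3, h4, h5, h6, h7⟩ := (mem_pairSide (hfit₁ ω)).1 hx
          exact (hfit₁ ω).cellOf_lt h6 h7 (isY_pairPos h1 h3 h2 h4 h5)
        · intro x hx y hy e
          obtain ⟨h1, h2, h3, h4, h5, h6, h7⟩ := (mem_pairSide (hfit₁ ω)).1 hx
          obtain ⟨g1, g2, g3, g4, g5, g6, g7⟩ := (mem_pairSide (hfit₁ ω)).1 hy
          exact ((hfit₁ ω).cellOf_injective h6 g6 h7 (isY_pairPos h1 h3 h2 h4 h5) g7
            (isY_pairPos g1 g3 g2 g4 g5) e).2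
        · intro x hx y hy e e'
          obtain ⟨h1, h2, h3, h4, h5, h6, h7⟩ := (mem_pairSide (hfit₁ ω)).1 hx
          obtain ⟨g1, g2, g3, g4, g5, g6, g7⟩ := (mem_pairSide (hfit₁ ω)).1 hy
          have hI := ((hfit₁ ω).cellOf_injective h6 g6 h7 (isY_pairPos h1 h3 h2 h4 h5) g7
            (isY_pairPos g1 g3 g2 g4 g5) e).1
          have hp := pairPos_injective h1 h3 h2 h4 h5 g1 g3 g2 g4 g5 e'
          exact Prod.ext (Prod.ext hp.1 hp.2) hI
      have := hL ω
      omega)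
  have e₃₅ := (e₃.trans e₄).trans e₅
  obtain ⟨R₆, e₆, hX⟩ := E.deliverX (f := fun _ _ => ()) (c := 0) (g := fun _ : Unit => [])
    (fun v hv => (hl₂ v hv).mono e₃₅) hfit₁ ((hF₁.mono e₁₂).mono e₃₅) (plan₁.mono e₃₅)
    (Own.map ((hF₁.mono e₁₂).mono e₃₅) _ (fun _ _ _ _ _ _ _ _ _ _ _ => rfl))
    (fun _ _ _ => rfl) (fun _ => rfl) (by intro ω t _ _ x hx; simp at hx)
    (fun ω => by have := hL ω; omega)
  refine ⟨R₆, ?_, ?_⟩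
  · have := (e₁₂.trans e₃₅).trans e₆
    rw [show 6 * (m + 2) + 4 = 3 * (m + 2) + 3 * (m + 2) + (1 + 1 + 1) + 1 by ring]
    exact this
  · intro ω t₁ ht₁ t₂ ht₂ t₃ ht₃ hk₁ hk₂
    have s₁ := hsub₁ ω ht₁
    have s₂ := hsub₂ ω ht₂
    have s₃ := hsub₃ ω ht₃
    have hprop : (groupOf (tuples ω) k₁ (ind (F₁ ω)) (matchWeight (tuples ω) k₂ (F₂ ω) (F₃ ω)) (l ω)
        (k₁ t₁)).Proper := by
      refine groupOf_proper s₁ s₂ (by rw [ind_eq_one.2 ht₁]; norm_num) ?_ hk₁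
      have := pairPos_lt (k₁ := k₁) ht₂ s₃ ht₃ hk₂
      unfold pairPos at this
      omega
    have hY := isY_pairPos (k₁ := k₁) (F₁ := F₁ ω) (l := l ω) s₂ ht₂ s₃ ht₃ hk₂
    have hX' := isX_before (k := k₁) (wY := matchWeight (tuples ω) k₂ (F₂ ω) (F₃ ω)) (l := l ω) s₁
      (ind_eq_one.2 ht₁)
    -- All three tuples meet in the cell given by the block of `t₁` and the block of the pair: the
    -- copy of `t₁` is indexed by the latter, the copy of the pair by the former.
    have m₁ : (t₁, pairPos (tuples ω) k₁ k₂ (F₂ ω) (F₃ ω) t₂ t₃ / l ω) ∈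
        sideX (tuples ω) k₁ (ind (F₁ ω)) (matchWeight (tuples ω) k₂ (F₂ ω) (F₃ ω)) (q ^ m) (l ω) := by
      refine (mem_sideX (hfit₁ ω)).2 ⟨s₁, ind_eq_one.2 ht₁, hprop, ?_⟩
      simp only
      rw [hk₁]
      exact hY
    have m₂ : ((t₂, t₃), before (tuples ω) k₁ (ind (F₁ ω)) t₁ / l ω) ∈ SC ω := by
      refine (mem_pairSide (hfit₁ ω)).2 ⟨s₂, s₃, ht₂, ht₃, hk₂, ?_, ?_⟩
      · simp only
        rw [← hk₁]
        exact hprop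
      · simp only
        rw [← hk₁]
        exact hX'
    have f₁ := hX.has ω _ m₁ t₁ rfl
    have f₂ := e₆.has _ _ _ (hD.has ω _ m₂ t₂ (Or.inl rfl))
    have f₃ := e₆.has _ _ _ (hD.has ω _ m₂ t₃ (Or.inr rfl))
    simp only at f₁ f₂ f₃
    rw [hk₁] at f₁
    exact ⟨_, Nat.mod_lt _ hP, f₁, f₂, f₃⟩

end Run

end MPC

/-! ### Heavy and light tuples: sizes of the intermediate results -/

namespace MPC

set_option linter.unusedSectionVars false

section Sizes

/-- Every `a t` is at least √(O/N), so the sum of `d t` is at most √(N/O) times the sum of `a t * d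
t`. When `O = 0`, the condition `0 < a t` forces all `d t` to vanish. -/
theorem sq_sum_le_of_heavy {ι : Type*} (A : Finset ι) (a d : ι → ℕ) {N O : ℕ}
    (hO : ∑ t ∈ A, a t * d t ≤ O) (h : ∀ t ∈ A, 0 < a t ∧ O ≤ a t ^ 2 * N) :
    (∑ t ∈ A, d t) ^ 2 ≤ N * O := by
  rcases Nat.eq_zero_or_pos O with rfl | hpos
  · have : ∑ t ∈ A, d t = 0 := by
      refine Finset.sum_eq_zero fun t ht => ?_
      have h1 := Finset.sum_eq_zero_iff.1 (Nat.le_zero.1 hO) t ht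
      rcases Nat.mul_eq_zero.1 h1 with h2 | h2
      · have := (h t ht).1; omega
      · exact h2
    simp [this]
  · have hs : 0 < Real.sqrt O := Real.sqrt_pos.2 (by exact_mod_cast hpos)
    have h1 : ∀ t ∈ A, Real.sqrt O ≤ a t * Real.sqrt N := by
      intro t ht
      have h2 : ((O : ℕ) : ℝ) ≤ (a t : ℝ) ^ 2 * N := by exact_mod_cast (h t ht).2
      calc Real.sqrt O ≤ Real.sqrt ((a t : ℝ) ^ 2 * N) := Real.sqrt_le_sqrt h2
        _ = a t * Real.sqrt N := by
          rw [Real.sqrt_mul (by positivity), Real.sqrt_sq (by positivity)]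
    have h2 : (∑ t ∈ A, (d t : ℝ)) * Real.sqrt O ≤ Real.sqrt N * O := by
      rw [Finset.sum_mul]
      calc ∑ t ∈ A, (d t : ℝ) * Real.sqrt O ≤ ∑ t ∈ A, (d t : ℝ) * (a t * Real.sqrt N) :=
            Finset.sum_le_sum fun t ht => mul_le_mul_of_nonneg_left (h1 t ht) (by positivity)
        _ = Real.sqrt N * ∑ t ∈ A, (a t : ℝ) * d t := by
          rw [Finset.mul_sum]; exact Finset.sum_congr rfl fun t _ => by ring
        _ ≤ Real.sqrt N * O := by
          refine mul_le_mul_of_nonneg_left ?_ (by positivity)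
          exact_mod_cast hO
    have h3 : (∑ t ∈ A, (d t : ℝ)) ≤ Real.sqrt N * Real.sqrt O := by
      have h4 : (O : ℝ) = Real.sqrt O * Real.sqrt O := (Real.mul_self_sqrt (by positivity)).symm
      rw [h4, ← mul_assoc] at h2
      rw [Real.sqrt_mul_self (by positivity)] at h2
      exact le_of_mul_le_mul_right h2 hs
    have h5 : (∑ t ∈ A, (d t : ℝ)) ^ 2 ≤ N * O := by
      calc (∑ t ∈ A, (d t : ℝ)) ^ 2 ≤ (Real.sqrt N * Real.sqrt O) ^ 2 :=
            pow_le_pow_left₀ (Finset.sum_nonneg fun _ _ => by positivity) h3 2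
        _ = N * O := by
          rw [mul_pow, Real.sq_sqrt (by positivity), Real.sq_sqrt (by positivity)]
    exact_mod_cast h5

/-- At most `N` terms, each at most √(O/N); Cauchy–Schwarz avoids the square roots. -/
theorem sq_sum_le_of_light {ι : Type*} (A : Finset ι) (a : ι → ℕ) {N O : ℕ} (hA : A.card ≤ N)
    (h : ∀ t ∈ A, ¬ (0 < a t ∧ O ≤ a t ^ 2 * N)) : (∑ t ∈ A, a t) ^ 2 ≤ N * O := by
  rcases Nat.eq_zero_or_pos N with rfl | hpos
  · have : A = ∅ := Finset.card_eq_zero.1 (Nat.le_zero.1 hA)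
    simp [this]
  · have h1 : ∀ t ∈ A, a t ^ 2 * N ≤ O := by
      intro t ht
      rcases Nat.eq_zero_or_pos (a t) with h0 | h0
      · simp [h0]
      · by_contra hc
        exact h t ht ⟨h0, (not_le.1 hc).le⟩
    have h2 : (∑ t ∈ A, a t) ^ 2 ≤ A.card * ∑ t ∈ A, a t ^ 2 := sq_sum_le_card_mul_sum_sq
    have h3 : (∑ t ∈ A, a t ^ 2) * N ≤ A.card * O := by
      rw [Finset.sum_mul]
      exact (Finset.sum_le_card_nsmul A _ O h1).trans (by simp)
    refine Nat.le_of_mul_le_mul_right ?_ hpos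
    calc (∑ t ∈ A, a t) ^ 2 * N ≤ A.card * (∑ t ∈ A, a t ^ 2) * N := Nat.mul_le_mul_right _ h2
      _ = A.card * ((∑ t ∈ A, a t ^ 2) * N) := by ring
      _ ≤ A.card * (A.card * O) := Nat.mul_le_mul_left _ h3
      _ ≤ N * (N * O) := Nat.mul_le_mul hA (Nat.mul_le_mul_right _ hA)
      _ = N * O * N := by ring

variable {T κ κ' : Type*} [LinearOrder T] [LinearOrder κ] [LinearOrder κ']
variable {k₂ : T → κ'} {S : Finset T} {k₁ : T → κ}

/-- The number of elements of `F` with the same key as `t`. -/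
def deg (S : Finset T) (k : T → κ) (F : Finset T) (t : T) : ℕ := ∑ u ∈ S with k u = k t, ind F u

theorem sum_ind_mul {F : Finset T} (hF : F ⊆ S) (f : T → ℕ) :
    ∑ u ∈ S, ind F u * f u = ∑ u ∈ F, f u := by
  simp only [ind, ite_mul, one_mul, zero_mul]
  rw [← Finset.sum_filter]
  congr 1
  ext u
  simp only [Finset.mem_filter]
  exact ⟨fun h => h.2, fun h => ⟨hF h, h⟩⟩

theorem sum_ind {F : Finset T} (hF : F ⊆ S) : ∑ u ∈ S, ind F u = F.card := by
  have := sum_ind_mul hF (fun _ => 1)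
  simpa using this

/-- Pairs with equal keys are counted from either side. -/
theorem sum_mul_sum_swap (w w' : T → ℕ) (k : T → κ) :
    ∑ u ∈ S, w u * ∑ u' ∈ S with k u' = k u, w' u' =
      ∑ u ∈ S, w' u * ∑ u' ∈ S with k u' = k u, w u' := by
  simp only [Finset.mul_sum, Finset.sum_filter]
  rw [Finset.sum_comm]
  refine Finset.sum_congr rfl fun u _ => Finset.sum_congr rfl fun u' _ => ?_
  by_cases h : k u = k u'
  · simp [h, mul_comm]
  · simp [h, Ne.symm h]

theorem sum_matchWeight_mul {F₂ F₃ : Finset T} (hF₂ : F₂ ⊆ S) (f : T → ℕ) :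
    ∑ u ∈ S, matchWeight S k₂ F₂ F₃ u * f u = ∑ u ∈ F₂, deg S k₂ F₃ u * f u := by
  rw [← sum_ind_mul hF₂]
  refine Finset.sum_congr rfl fun u _ => ?_
  unfold matchWeight ind deg
  split_ifs <;> simp [ind]

/-- Reduces the feasibility of both steps of a join to two numbers: the size of the intermediate
result, at most `P * l`, and that of the final result, at most `P * l ^ 2`. -/
theorem fits_of_sums {F₁ F₂ F₃ : Finset T} (h₁ : F₁ ⊆ S) (h₂ : F₂ ⊆ S) (h₃ : F₃ ⊆ S) {P l : ℕ}
    (hP : 0 < P) (hl : 0 < l) (hS : S.card ≤ P * l)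
    (hM : ∑ t ∈ F₂, deg S k₂ F₃ t ≤ P * l)
    (hO : ∑ t ∈ F₂, deg S k₂ F₃ t * deg S k₁ F₁ t ≤ P * l ^ 2) :
    Fits S k₂ (ind F₂) (ind F₃) P l ∧ Fits S k₁ (ind F₁) (matchWeight S k₂ F₂ F₃) P l := by
  have hcard : ∀ F ⊆ S, ∑ u ∈ S, ind F u ≤ P * l := fun F hF => by
    rw [sum_ind hF]; exact (Finset.card_le_card hF).trans hS
  refine ⟨⟨hP, hl, hcard _ h₂, hcard _ h₃, ?_⟩, ⟨hP, hl, hcard _ h₁, ?_, ?_⟩⟩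
  · rw [sum_ind_mul h₂]
    refine hM.trans (Nat.mul_le_mul_left _ ?_)
    exact Nat.le_self_pow (by norm_num) l
  · have := sum_matchWeight_mul (k₂ := k₂) (F₃ := F₃) h₂ (fun _ => 1)
    simp only [mul_one] at this
    rw [this]
    exact hM
  · rw [sum_mul_sum_swap]
    exact (sum_matchWeight_mul (k₂ := k₂) (F₃ := F₃) h₂ (fun u => deg S k₁ F₁ u)).trans_le hO

open Classical in
/-- The elements of `F₂` with many partners in `F₁`. -/
noncomputable def heavy (S : Finset T) (k₁ : T → κ) (F₁ F₂ : Finset T) (O : ℕ) : Finset T :=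
  F₂.filter (fun t => 0 < deg S k₁ F₁ t ∧ O ≤ deg S k₁ F₁ t ^ 2 * S.card)

/-- The size of the three-way join. -/
def joinSize (S : Finset T) (k₁ : T → κ) (k₂ : T → κ') (F₁ F₂ F₃ : Finset T) : ℕ :=
  ∑ t ∈ F₂, deg S k₁ F₁ t * deg S k₂ F₃ t

/-- Heavy tuples meet `F₃` first and light ones `F₁` first; either intermediate result has size at
most √(N O) ≤ `P * l`. The final result fits because `P * O ≤ N * O ≤ (P * l) ^ 2`, which uses `P ≤
N`. -/
theorem fits_heavy_light {F₁ F₂ F₃ : Finset T} (h₁ : F₁ ⊆ S) (h₂ : F₂ ⊆ S) (h₃ : F₃ ⊆ S) {P l : ℕ}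
    (hP : 0 < P) (hl : 0 < l) (hPS : P ≤ S.card) (hS : S.card ≤ P * l)
    (hSO : S.card * joinSize S k₁ k₂ F₁ F₂ F₃ ≤ (P * l) ^ 2) :
    let H := heavy S k₁ F₁ F₂ (joinSize S k₁ k₂ F₁ F₂ F₃)
    (Fits S k₂ (ind H) (ind F₃) P l ∧ Fits S k₁ (ind F₁) (matchWeight S k₂ H F₃) P l) ∧
    (Fits S k₁ (ind (F₂ \ H)) (ind F₁) P l ∧
      Fits S k₂ (ind F₃) (matchWeight S k₁ (F₂ \ H) F₁) P l) := by
  intro H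
  set O := joinSize S k₁ k₂ F₁ F₂ F₃ with hO
  have hH : H ⊆ F₂ := Finset.filter_subset _ _
  have hOle : O ≤ P * l ^ 2 := by
    refine Nat.le_of_mul_le_mul_left ?_ hP
    calc P * O ≤ S.card * O := Nat.mul_le_mul_right _ hPS
      _ ≤ (P * l) ^ 2 := hSO
      _ = P * (P * l ^ 2) := by ring
  have hsub : ∀ F ⊆ F₂, ∑ t ∈ F, deg S k₁ F₁ t * deg S k₂ F₃ t ≤ O := fun F hF =>
    Finset.sum_le_sum_of_subset hF
  constructor
  · refine fits_of_sums h₁ (hH.trans h₂) h₃ hP hl hS ?_ ?_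
    · refine le_of_sq_le_sq ?_
      refine le_trans (sq_sum_le_of_heavy H (deg S k₁ F₁) _ (hsub H hH) ?_) hSO
      intro t ht
      exact (Finset.mem_filter.1 ht).2
    · simp only [mul_comm (deg S k₂ F₃ _)]
      exact (hsub H hH).trans hOle
  · refine fits_of_sums h₃ (Finset.sdiff_subset.trans h₂) h₁ hP hl hS ?_ ?_
    · refine le_of_sq_le_sq ?_
      refine le_trans (sq_sum_le_of_light (F₂ \ H) (deg S k₁ F₁) (N := S.card) (O := O) ?_ ?_) hSO
      · exact Finset.card_le_card (Finset.sdiff_subset.trans h₂)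
      · intro t ht hc
        rw [Finset.mem_sdiff] at ht
        exact ht.2 (Finset.mem_filter.2 ⟨ht.1, hc⟩)
    · exact (hsub _ Finset.sdiff_subset).trans hOle
where
  le_of_sq_le_sq {a b : ℕ} (h : a ^ 2 ≤ b ^ 2) : a ≤ b := (Nat.pow_le_pow_iff_left two_ne_zero).1 h

end Sizes

end MPC

/-! ### Moving the input to the working servers, and global sums -/

namespace MPC

set_option linter.unusedSectionVars false

namespace Run

variable {p : ℕ} {T Ω : Type*} {init : Ω → Fin p → Finset T} {L Bd : Ω → ℕ}

theorem card_filter_mod_le {p P c : ℕ} (hp : p ≤ c * P) (v : ℕ) :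
    (Finset.univ.filter (fun s : Fin p => (s : ℕ) % P = v)).card ≤ c := by
  rw [← Finset.card_range c]
  refine Finset.card_le_card_of_injOn (fun s => (s : ℕ) / P) ?_ ?_
  · intro s _
    simpa using Nat.div_lt_of_lt_mul (by rw [mul_comm]; exact s.2.trans_le hp)
  · intro s hs s' hs' e
    simp only [Finset.coe_filter, Finset.mem_univ, true_and, Set.mem_ofPred_eq] at hs hs'
    refine Fin.ext ?_
    simp only at e
    rw [← Nat.div_add_mod (s : ℕ) P, ← Nat.div_add_mod (s' : ℕ) P, hs, hs', e]

open Classical in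
/-- In one round the input is moved to the first `P` servers. -/
theorem exists_own {tuples : Ω → Finset T} (hcover : ∀ ω t, t ∈ tuples ω ↔ ∃ s, t ∈ init ω s)
    (hdisj : ∀ ω s s', s ≠ s' → Disjoint (init ω s) (init ω s')) {P c : ℕ} (hP : 0 < P)
    (hPp : P ≤ p) (hp : p ≤ c * P) {D : Ω → ℕ} (hD : ∀ ω s, (init ω s).card ≤ D ω)
    (hL : ∀ ω, c * D ω ≤ L ω) :
    ∃ (home : Ω → T → ℕ) (R : Run init L Bd), R.rounds = 1 ∧
      R.Own P (fun t => {t}) tuples home (fun _ _ => ()) ∧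
      ∀ ω v, ((tuples ω).filter (fun t => home ω t = v)).card ≤ c * D ω := by
  have hsrc : ∀ ω t, ∃ s : ℕ, t ∈ tuples ω → ∃ h : s < p, t ∈ init ω ⟨s, h⟩ := by
    intro ω t
    by_cases ht : t ∈ tuples ω
    · obtain ⟨s, hs⟩ := (hcover ω t).1 ht
      exact ⟨s, fun _ => ⟨s.2, hs⟩⟩
    · exact ⟨0, fun h => absurd h ht⟩
  -- The new owner is the source modulo `P`; since `p ≤ c * P`, each working server takes over the
  -- input of at most `c` servers.
  choose src hsrc using hsrc
  have src_eq : ∀ ω t (s : Fin p), t ∈ init ω s → src ω t = s := by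
    intro ω t s hs
    obtain ⟨h, h'⟩ := hsrc ω t ((hcover ω t).2 ⟨s, hs⟩)
    by_contra hne
    exact Finset.disjoint_left.1 (hdisj ω ⟨src ω t, h⟩ s (fun e => hne (congrArg Fin.val e))) h' hs
  have hcard : ∀ ω v, ((tuples ω).filter (fun t => src ω t % P = v)).card ≤ c * D ω := by
    intro ω v
    calc _ ≤ ((Finset.univ.filter (fun s : Fin p => (s : ℕ) % P = v)).biUnion (init ω)).card := by
          refine Finset.card_le_card fun t ht => ?_
          rw [Finset.mem_filter] at ht
          obtain ⟨h, h'⟩ := hsrc ω t ht.1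
          exact Finset.mem_biUnion.2 ⟨⟨_, h⟩, by simp [ht.2], h'⟩
      _ ≤ _ := (Finset.card_biUnion_le_card_mul _ _ (D ω) fun s _ => hD ω s)
      _ ≤ _ := Nat.mul_le_mul_right _ (card_filter_mod_le hp v)
  let part : Ω → ℕ → Finset T := fun ω v => if h : v < p then init ω ⟨v, h⟩ else ∅
  have hpart : ∀ ω (s : Fin p), part ω s = init ω s := fun ω s => by simp [part]
  let M : ℕ → ℕ → Ω → List (Word T) := fun v d ω =>
    if v % P = d then (part ω v).toList.map Word.tuple else []
  have memM : ∀ v d ω t, Word.tuple t ∈ M v d ω ↔ v % P = d ∧ t ∈ part ω v := by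
    intro v d ω t
    by_cases h : v % P = d <;> simp [M, h]
  have vw_start : ∀ ω v (h : v < p), (start init L Bd).vw ω v = ⟨init ω ⟨v, h⟩, []⟩ := by
    intro ω v h
    simp only [vw, h, dif_pos]
    rfl
  obtain ⟨R, e, hk, hh⟩ := (start init L Bd).step M
    (by
      intro v hv d _ ω ω' he
      rw [vw_start ω v hv, vw_start ω' v hv, View.mk.injEq] at he
      have : part ω v = part ω' v := by simp only [part, hv, dif_pos, he.1]
      simp only [M, this])
    (by
      intro v hv d _ ω t ht
      have := ((memM v d ω t).1 ht).2
      rw [Has, vw_start ω v hv]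
      simp only [part, hv, dif_pos] at this
      exact Or.inl this)
    (by
      intro v _ d _ ω n hn
      by_cases h : v % P = d <;> simp [M, h] at hn)
    (by
      intro d _ ω
      refine le_trans ?_ (hL ω)
      have h1 : ∀ s : Fin p, (M s d ω).length ≤ if (s : ℕ) % P = d then D ω else 0 := by
        intro s
        by_cases h : (s : ℕ) % P = d
        · simpa [M, h, hpart] using hD ω s
        · simp [M, h]
      rw [Finset.sum_range]
      refine (Finset.sum_le_sum fun s _ => h1 s).trans ?_
      rw [← Finset.sum_filter, Finset.sum_const, smul_eq_mul]
      exact Nat.mul_le_mul_right _ (card_filter_mod_le hp d))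
  refine ⟨fun ω t => src ω t % P, R, e.rounds_eq, ⟨fun _ _ _ => Nat.mod_lt _ hP, ?_, ?_⟩, hcard⟩
  · intro d hd ω ω' he t ht hdt
    obtain ⟨h, h'⟩ := hsrc ω t ht
    have h1 : Word.tuple t ∈ M (src ω t) d ω :=
      (memM _ _ _ _).2 ⟨hdt, by simpa only [part, h, dif_pos] using h'⟩
    rw [hk _ h d (hd.trans_le hPp) ω ω' he] at h1
    have h2 := ((memM _ _ _ _).1 h1).2
    simp only [part, h, dif_pos] at h2
    refine ⟨(hcover ω' t).2 ⟨_, h2⟩, ?_, rfl⟩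
    rw [src_eq ω' t _ h2]
    exact hdt
  · intro ω t ht t' ht'
    rw [show t' = t from ht']
    obtain ⟨h, h'⟩ := hsrc ω t ht
    refine hh (src ω t) h _ ((Nat.mod_lt _ hP).trans_le hPp) ω t ((memM _ _ _ _).2 ⟨rfl, ?_⟩)
    simpa only [part, h, dif_pos] using h'

variable {κ κ' : Type*} [LinearOrder T] [LinearOrder κ] [LinearOrder κ']
variable {q m : ℕ} {n : Ω → ℕ} {tuples : Ω → Finset T} {home : Ω → T → ℕ} {R R' : Run init L Bd}

/-- The servers learn a sum over all tuples. -/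
theorem HomeKnows.total {g : Ω → T → ℕ} (h : R.HomeKnows q m tuples home g) (hq : 0 < q)
    (hP : q ^ m ≤ p) (hL : ∀ ω, q ≤ L ω) (hBd : ∀ ω, ∑ t ∈ tuples ω, g ω t ≤ Bd ω) :
    ∃ R' : Run init L Bd, R.Ext m R' ∧
      ∀ v < q ^ m, R'.Knows v (fun ω => ∑ t ∈ tuples ω, g ω t) := by
  have hsum : ∀ ω, ∑ v ∈ Finset.range (q ^ m), ∑ t ∈ tuples ω with home ω t = v, g ω t =
      ∑ t ∈ tuples ω, g ω t := fun ω =>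
    Finset.sum_fiberwise_of_maps_to (fun t ht => Finset.mem_range.2 (h.lt ω t ht)) _
  obtain ⟨R', e, hk⟩ := R.cumulative_sums hq hP
    (fun ω v => ∑ t ∈ tuples ω with home ω t = v, g ω t) (by
      intro v hv ω ω' he
      simp only
      rw [Own.filter_eq h hv he]
      refine Finset.sum_congr rfl fun t ht => ?_
      rw [Finset.mem_filter] at ht
      exact (h.know v hv ω' ω he.symm t ht.1 ht.2).2.2.symm) hL
    (fun ω => (hsum ω).trans_le (hBd ω))
  refine ⟨R', e, fun v hv => ?_⟩
  have := (hk v hv).2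
  simpa only [hsum] using this

/-- The owners learn the numbers of partners of their tuples. -/
theorem Env.degrees (E : Env p L Bd q m n tuples home) {k : T → κ}
    (hR : R.Ready q m n tuples home) (hrk : R.Ranked q m tuples home k) {F : Ω → Finset T}
    (hsub : ∀ ω, F ω ⊆ tuples ω) (hF : R.HomeKnows q m tuples home (fun ω => ind (F ω))) :
    ∃ R' : Run init L Bd, R.Ext (m + 2) R' ∧
      R'.HomeKnows q m tuples home (fun ω => deg (tuples ω) k (F ω)) := by
  obtain ⟨R', e, h⟩ := E.query hR hrk hF (by
    intro ω
    rw [sum_ind (hsub ω)]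
    have h1 := Finset.card_le_card (hsub ω)
    have h2 := E.card_tuples ω
    have h3 := E.bd ω
    omega)
  refine ⟨R', e, Own.map h _ ?_⟩
  intro v hv ω ω' he t _ _ _ _ hf
  simp only [Prod.mk.injEq] at hf
  unfold deg
  rw [← upto_sub_below, ← upto_sub_below, hf.1, hf.2.2]

end Run

end MPC

/-! ### The line-3 join on `q ^ m` servers -/

namespace MPC

set_option linter.unusedSectionVars false

namespace Run

variable {p : ℕ} {T Ω : Type*} {init : Ω → Fin p → Finset T} {L Bd : Ω → ℕ}
variable {κ κ' : Type*} [LinearOrder T] [LinearOrder κ] [LinearOrder κ']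
variable {q m : ℕ} {n : Ω → ℕ} {tuples : Ω → Finset T} {home : Ω → T → ℕ} {R R' : Run init L Bd}

/-- The number of rounds of the line-3 join on `q ^ m` servers. -/
def lineRounds (m : ℕ) : ℕ :=
  1 + m + (2 * (sortRounds m + 1) + 2 * (m + 2) + m + 2 * (6 * (m + 2) + 4))

/-- The room for elements on every server, a multiple of `q` with `3 * c * D` and `4 * q ^ 2` as
lower bounds. -/
def room (q c D : ℕ) : ℕ := q * (3 * c * D / q + 1 + 4 * q)

/-- The unit of load of the join proper. -/
def unitLoad (P N O : ℕ) : ℕ := N / P + Nat.sqrt (N * O) / P + 2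

theorem le_room {q : ℕ} (hq : 0 < q) (c D : ℕ) : 3 * (c * D) ≤ room q c D := by
  have h1 : 3 * c * D < q * (3 * c * D / q + 1) := by
    rw [Nat.mul_add, mul_one]
    exact Nat.lt_mul_div_succ _ hq
  unfold room
  rw [Nat.mul_add]
  rw [← mul_assoc]
  omega

theorem four_sq_le_room (q c D : ℕ) : 4 * q ^ 2 ≤ room q c D := by
  unfold room
  calc 4 * q ^ 2 = q * (4 * q) := by ring
    _ ≤ _ := Nat.mul_le_mul_left _ (Nat.le_add_left _ _)

/-- The summand 2 in `unitLoad` makes up for rounding down two quotients, and the integer square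
root loses less than 1. -/
theorem le_mul_unitLoad {P : ℕ} (hP : 0 < P) (N O : ℕ) :
    N ≤ P * unitLoad P N O ∧ N * O ≤ (P * unitLoad P N O) ^ 2 := by
  have h1 := Nat.lt_mul_div_succ N hP
  have h2 := Nat.lt_mul_div_succ (Nat.sqrt (N * O)) hP
  have h3 : P * unitLoad P N O = P * (N / P + 1) + P * (Nat.sqrt (N * O) / P + 1) := by
    unfold unitLoad; ring
  rw [h3]
  refine ⟨by omega, ?_⟩
  refine (Nat.lt_succ_sqrt' (N * O)).le.trans (Nat.pow_le_pow_left ?_ 2)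
  omega

/-- The line-3 join, if the input is already on the first `q ^ m` servers. -/
theorem Env.lineJoin (E : Env p L Bd q m n tuples home) (k₁ : T → κ) (k₂ : T → κ')
    (hR : R.Ready q m n tuples home) (cls : T → ℕ)
    (hN : ∀ v < q ^ m, R.Knows v (fun ω => (tuples ω).card))
    {F : ℕ → Ω → Finset T} (hF : ∀ i ω, F i ω = (tuples ω).filter (fun t => cls t = i))
    {O l : Ω → ℕ} (hO : ∀ ω, O ω = joinSize (tuples ω) k₁ k₂ (F 0 ω) (F 1 ω) (F 2 ω))
    (hl : ∀ ω, l ω = unitLoad (q ^ m) (tuples ω).card (O ω))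
    (hcard : ∀ ω, q ^ m ≤ (tuples ω).card) (hOBd : ∀ ω, O ω ≤ Bd ω)
    (hBd : ∀ ω, q ^ m * l ω ≤ Bd ω) (hBd' : ∀ ω, 6 * q ^ m ≤ Bd ω) (hL : ∀ ω, 72 * l ω ≤ L ω) :
    ∃ R' : Run init L Bd,
      R.Ext (2 * (sortRounds m + 1) + 2 * (m + 2) + m + 2 * (6 * (m + 2) + 4)) R' ∧
      ∀ ω, ∀ t₁ ∈ F 0 ω, ∀ t₂ ∈ F 1 ω, ∀ t₃ ∈ F 2 ω, k₁ t₁ = k₁ t₂ → k₂ t₂ = k₂ t₃ →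
        ∃ v < p, R'.Has ω v t₁ ∧ R'.Has ω v t₂ ∧ R'.Has ω v t₃ := by
  have hP : 0 < q ^ m := by have := E.hq; positivity
  have hqL : ∀ ω, q ≤ L ω := by
    intro ω
    have h1 := E.load ω
    have h2 := E.four_sq_le ω
    have h3 := Nat.le_self_pow two_ne_zero q
    omega
  have hsub : ∀ i ω, F i ω ⊆ tuples ω := fun i ω => by
    rw [hF]; exact Finset.filter_subset _ _
  have hFk : ∀ i, R.HomeKnows q m tuples home (fun ω => ind (F i ω)) := by
    intro i
    refine Own.map hR.own _ ?_
    intro v hv ω ω' he t ht ht' _ _ _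
    simp [ind, hF, ht, ht']
  obtain ⟨R₁, e₁, rk₁⟩ := E.ranks k₁ hR
  obtain ⟨R₂, e₂, rk₂⟩ := E.ranks k₂ (hR.mono e₁)
  have e₁₂ := e₁.trans e₂
  obtain ⟨R₃, e₃, d₁⟩ := E.degrees (hR.mono e₁₂) (Own.mono rk₁ e₂) (hsub 0) (Own.mono (hFk 0) e₁₂)
  have e₁₃ := e₁₂.trans e₃
  obtain ⟨R₄, e₄, d₃⟩ := E.degrees (hR.mono e₁₃) (Own.mono rk₂ e₃) (hsub 2) (Own.mono (hFk 2) e₁₃)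
  have e₁₄ := e₁₃.trans e₄
  have hO' : ∀ ω, ∑ t ∈ tuples ω, ind (F 1 ω) t *
      (deg (tuples ω) k₁ (F 0 ω) t * deg (tuples ω) k₂ (F 2 ω) t) = O ω := fun ω => by
    rw [sum_ind_mul (hsub 1 ω), hO]; rfl
  have hprod : R₄.HomeKnows q m tuples home (fun ω t => ind (F 1 ω) t *
      (deg (tuples ω) k₁ (F 0 ω) t * deg (tuples ω) k₂ (F 2 ω) t)) := by
    refine Own.map (Own.prod (Own.mono (hFk 1) e₁₄) (Own.prod (Own.mono d₁ e₄) d₃)) _ ?_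
    intro v hv ω ω' he t _ _ _ _ hf
    simp only [Prod.mk.injEq] at hf
    rw [hf.1, hf.2.1, hf.2.2]
  obtain ⟨R₅, e₅, kO⟩ := hprod.total E.hq E.hP hqL (fun ω => (hO' ω).trans_le (hOBd ω))
  simp only [hO'] at kO
  have e₁₅ := e₁₄.trans e₅
  -- All working servers know the input size and the output size, hence agree on the load unit and
  -- on the threshold for heavy tuples.
  have kl : ∀ v < q ^ m, R₅.Knows v l := by
    intro v hv ω ω' he
    have h1 := kO v hv ω ω' he
    have h2 := (hN v hv).mono e₁₅ ω ω' he
    simp only at h1 h2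
    rw [hl, hl, h1, h2]
  let H : Ω → Finset T := fun ω => heavy (tuples ω) k₁ (F 0 ω) (F 1 ω) (O ω)
  have hH : ∀ ω, H ω ⊆ F 1 ω := fun ω => Finset.filter_subset _ _
  have memH : ∀ v < q ^ m, ∀ ω ω', R₅.vw ω v = R₅.vw ω' v → ∀ t ∈ tuples ω, home ω t = v →
      (t ∈ H ω ↔ t ∈ H ω') ∧ (t ∈ F 1 ω ↔ t ∈ F 1 ω') := by
    intro v hv ω ω' he t ht hv'
    have h1 := ((Own.mono (hFk 1) e₁₅).know v hv ω ω' he t ht hv').2.2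
    have h2 := ((Own.mono (Own.mono d₁ e₄) e₅).know v hv ω ω' he t ht hv').2.2
    have h3 := kO v hv ω ω' he
    have h4 := (hN v hv).mono e₁₅ ω ω' he
    have h5 : t ∈ F 1 ω ↔ t ∈ F 1 ω' := by rw [← ind_eq_one, h1, ind_eq_one]
    simp only at h3 h4
    refine ⟨?_, h5⟩
    simp only [H, heavy, Finset.mem_filter, h5, h2, h3, h4]
  have kH : R₅.HomeKnows q m tuples home (fun ω => ind (H ω)) := by
    refine Own.map (hR.own.mono e₁₅) _ ?_
    intro v hv ω ω' he t ht _ hv' _ _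
    simp only [ind, (memH v hv ω ω' he t ht hv').1]
  have kH' : R₅.HomeKnows q m tuples home (fun ω => ind (F 1 ω \ H ω)) := by
    refine Own.map (hR.own.mono e₁₅) _ ?_
    intro v hv ω ω' he t ht _ hv' _ _
    simp only [ind, Finset.mem_sdiff, (memH v hv ω ω' he t ht hv').1,
      (memH v hv ω ω' he t ht hv').2]
  have fits : ∀ ω, (Fits (tuples ω) k₂ (ind (H ω)) (ind (F 2 ω)) (q ^ m) (l ω) ∧
      Fits (tuples ω) k₁ (ind (F 0 ω)) (matchWeight (tuples ω) k₂ (H ω) (F 2 ω)) (q ^ m) (l ω)) ∧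
      (Fits (tuples ω) k₁ (ind (F 1 ω \ H ω)) (ind (F 0 ω)) (q ^ m) (l ω) ∧
      Fits (tuples ω) k₂ (ind (F 2 ω)) (matchWeight (tuples ω) k₁ (F 1 ω \ H ω) (F 0 ω))
        (q ^ m) (l ω)) := by
    intro ω
    have h1 := le_mul_unitLoad hP (tuples ω).card (O ω)
    rw [← hl] at h1
    have h2 : 0 < l ω := by rw [hl]; exact Nat.succ_pos _
    have h3 := fits_heavy_light (k₁ := k₁) (k₂ := k₂) (hsub 0 ω) (hsub 1 ω) (hsub 2 ω) hP h2
      (hcard ω) h1.1 (by rw [← hO]; exact h1.2)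
    rw [← hO] at h3
    exact h3
  -- Results with a heavy middle tuple are produced here; the next join treats the light ones with
  -- the two ends of the line exchanged.
  obtain ⟨R₆, e₆, join₆⟩ := E.join (hR.mono e₁₅) (Own.mono rk₁ ((e₂.trans e₃).trans (e₄.trans e₅)))
    (Own.mono rk₂ (e₃.trans (e₄.trans e₅))) (hsub 0) (fun ω => (hH ω).trans (hsub 1 ω)) (hsub 2)
    (Own.mono (hFk 0) e₁₅) kH (Own.mono (hFk 2) e₁₅) kl (fun ω => (fits ω).1.1)
    (fun ω => (fits ω).1.2) hBd hBd' hL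
  have e₁₆ := e₁₅.trans e₆
  obtain ⟨R₇, e₇, join₇⟩ := E.join (hR.mono e₁₆)
    (Own.mono rk₂ (e₃.trans (e₄.trans (e₅.trans e₆))))
    (Own.mono rk₁ ((e₂.trans e₃).trans (e₄.trans (e₅.trans e₆)))) (hsub 2)
    (fun ω => Finset.sdiff_subset.trans (hsub 1 ω)) (hsub 0)
    (Own.mono (hFk 2) e₁₆) (Own.mono kH' e₆) (Own.mono (hFk 0) e₁₆)
    (fun v hv => (kl v hv).mono e₆) (fun ω => (fits ω).2.1)
    (fun ω => (fits ω).2.2) hBd hBd' hL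
  have e₁₇ := e₁₆.trans e₇
  refine ⟨R₇, ?_, ?_⟩
  · convert e₁₇ using 1
    ring
  · intro ω t₁ h₁ t₂ h₂ t₃ h₃ h₁₂ h₂₃
    by_cases ht : t₂ ∈ H ω
    · obtain ⟨v, hv, a₁, a₂, a₃⟩ := join₆ ω t₁ h₁ t₂ ht t₃ h₃ h₁₂ h₂₃
      exact ⟨v, hv.trans_le E.hP, e₇.has _ _ _ a₁, e₇.has _ _ _ a₂, e₇.has _ _ _ a₃⟩
    · obtain ⟨v, hv, a₃, a₂, a₁⟩ := join₇ ω t₃ h₃ t₂ (Finset.mem_sdiff.2 ⟨h₂, ht⟩) t₁ h₁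
        h₂₃.symm h₁₂.symm
      exact ⟨v, hv.trans_le E.hP, a₁, a₂, a₃⟩

/-- The line-3 join, from any balanced initial distribution. -/
theorem exists_lineJoin (k₁ : T → κ) (k₂ : T → κ') (cls : T → ℕ)
    (hcover : ∀ ω t, t ∈ tuples ω ↔ ∃ s, t ∈ init ω s)
    (hdisj : ∀ ω s s', s ≠ s' → Disjoint (init ω s) (init ω s'))
    (heven : ∀ ω s, (init ω s).card ≤ (tuples ω).card / p + 1)
    {c : ℕ} (hq : 0 < q) (hPp : q ^ m ≤ p) (hp : p ≤ c * q ^ m)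
    {F : ℕ → Ω → Finset T} (hF : ∀ i ω, F i ω = (tuples ω).filter (fun t => cls t = i))
    {O : Ω → ℕ} (hO : ∀ ω, O ω = joinSize (tuples ω) k₁ k₂ (F 0 ω) (F 1 ω) (F 2 ω))
    (hcard : ∀ ω, q ^ m ≤ (tuples ω).card) (hOBd : ∀ ω, O ω ≤ Bd ω)
    (hroom : ∀ ω, q ^ m * room q c ((tuples ω).card / p + 1) ≤ Bd ω)
    (hunit : ∀ ω, q ^ m * unitLoad (q ^ m) (tuples ω).card (O ω) ≤ Bd ω)
    (hBd : ∀ ω, 6 * q ^ m ≤ Bd ω)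
    (hL : ∀ ω, 15 * room q c ((tuples ω).card / p + 1) +
      72 * unitLoad (q ^ m) (tuples ω).card (O ω) ≤ L ω) :
    ∃ R : Run init L Bd, R.rounds = lineRounds m ∧
      ∀ ω, ∀ t₁ ∈ F 0 ω, ∀ t₂ ∈ F 1 ω, ∀ t₃ ∈ F 2 ω, k₁ t₁ = k₁ t₂ → k₂ t₂ = k₂ t₃ →
        ∃ v < p, R.Has ω v t₁ ∧ R.Has ω v t₂ ∧ R.Has ω v t₃ := by
  have hP : 0 < q ^ m := by positivity
  have hle := fun ω => le_room hq c ((tuples ω).card / p + 1)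
  have hfour := fun ω => four_sq_le_room q c ((tuples ω).card / p + 1)
  have hq2 := Nat.le_self_pow two_ne_zero q
  obtain ⟨home, R₀, r₀, own, hc⟩ := exists_own (L := L) (Bd := Bd) hcover hdisj hP hPp hp heven
    (fun ω => by have := hL ω; have := hle ω; omega)
  have E : Env p L Bd q m (fun ω => room q c ((tuples ω).card / p + 1)) tuples home :=
    { hq := hq
      hP := hPp
      four_sq_le := hfour
      dvd := fun ω => Dvd.intro _ rfl
      lt := own.lt
      card := fun ω v => (Nat.mul_le_mul_left 3 (hc ω v)).trans (hle ω)
      bd := hroom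
      load := fun ω => by have := hL ω; omega }
  have one : R₀.HomeKnows q m tuples home (fun _ _ => 1) :=
    Own.map own _ fun _ _ _ _ _ _ _ _ _ _ _ => rfl
  -- Summing the constant 1 makes the input size known, and with it the room per server.
  obtain ⟨R₁, e₁, hN⟩ := one.total hq hPp
    (fun ω => by have := hL ω; have := hfour ω; omega)
    (fun ω => by
      have h1 := E.card_tuples ω
      have h2 := E.bd ω
      rw [← Finset.card_eq_sum_ones]
      omega)
  simp only [← Finset.card_eq_sum_ones] at hN
  obtain ⟨R₂, e₂, hjoin⟩ := E.lineJoin k₁ k₂ (R := R₁) ⟨own.mono e₁, fun v hv ω ω' he => by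
      have := hN v hv ω ω' he
      simp only at this ⊢
      rw [this]⟩ cls hN hF hO (fun _ => rfl) hcard hOBd hunit hBd
    (fun ω => by have := hL ω; omega)
  refine ⟨R₂, ?_, hjoin⟩
  rw [e₂.rounds_eq, e₁.rounds_eq, r₀, lineRounds]

end Run

end MPC

/-! ### Constants and the passage to instances -/

namespace MPC

namespace Run

/-- Rounding and the requirement `4 * q ^ 2` cost only a constant factor once `q ^ 2 ≤ D`. This is
what the lower bound on the input size is for. -/
theorem room_le {q c D : ℕ} (hD : q ^ 2 ≤ D) (hD' : 0 < D) : room q c (D + 1) ≤ (6 * c + 5) * D := by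
  have h1 : q * (3 * c * (D + 1) / q) ≤ 3 * c * (D + 1) := Nat.mul_div_le _ _
  have h2 : q ≤ q ^ 2 := Nat.le_self_pow two_ne_zero q
  have h3 : 3 * c * (D + 1) ≤ 3 * c * (2 * D) := Nat.mul_le_mul_left _ (by omega)
  calc room q c (D + 1) = q * (3 * c * (D + 1) / q) + (q + 4 * q ^ 2) := by unfold room; ring
    _ ≤ 3 * c * (2 * D) + 5 * D := by omega
    _ = _ := by ring

theorem unitLoad_mono {P N O O' : ℕ} (h : O ≤ O') : unitLoad P N O ≤ unitLoad P N O' := by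
  unfold unitLoad
  gcongr

theorem mul_unitLoad_le {P N O : ℕ} (hP : P ≤ N) (hO : O ≤ N ^ 3) :
    P * unitLoad P N O ≤ 4 * N ^ 2 := by
  have h1 : P * (N / P) ≤ N := Nat.mul_div_le _ _
  have h2 : P * (Nat.sqrt (N * O) / P) ≤ Nat.sqrt (N * O) := Nat.mul_div_le _ _
  have h3 : Nat.sqrt (N * O) ≤ N ^ 2 := by
    calc Nat.sqrt (N * O) ≤ Nat.sqrt (N ^ 2 * N ^ 2) := by
          refine Nat.sqrt_le_sqrt ?_
          calc N * O ≤ N * N ^ 3 := Nat.mul_le_mul_left _ hO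
            _ = N ^ 2 * N ^ 2 := by ring
      _ = N ^ 2 := Nat.sqrt_eq _
  have h4 : N ≤ N ^ 2 := Nat.le_self_pow two_ne_zero N
  calc P * unitLoad P N O = P * (N / P) + P * (Nat.sqrt (N * O) / P) + 2 * P := by
        unfold unitLoad; ring
    _ ≤ 4 * N ^ 2 := by omega

/-- Using `P` servers instead of `p` costs the factor `c`; the summand 2 is at most `2 * N / p`
because `p ≤ N`. -/
theorem unitLoad_le {p P N O c : ℕ} (hP : 0 < P) (hp : 0 < p) (hpc : p ≤ c * P) (hpN : p ≤ N) :
    (unitLoad P N O : ℝ) ≤ (c + 2) * ((N : ℝ) / p + Real.sqrt ((N : ℝ) * O) / p) := by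
  have hP' : (0 : ℝ) < P := by exact_mod_cast hP
  have hp' : (0 : ℝ) < p := by exact_mod_cast hp
  have hpc' : (p : ℝ) ≤ c * P := by exact_mod_cast hpc
  have key : ∀ x : ℝ, 0 ≤ x → x / P ≤ c * (x / p) := by
    intro x hx
    rw [div_le_iff₀ hP']
    calc x = x / p * p := by field_simp
      _ ≤ x / p * (c * P) := by gcongr
      _ = _ := by ring
  have h1 : ((N / P : ℕ) : ℝ) ≤ c * ((N : ℝ) / p) := Nat.cast_div_le.trans (key _ (by positivity))
  have h2 : ((Nat.sqrt (N * O) / P : ℕ) : ℝ) ≤ c * (Real.sqrt ((N : ℝ) * O) / p) := by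
    refine Nat.cast_div_le.trans (le_trans ?_ (key _ (Real.sqrt_nonneg _)))
    gcongr
    have := Real.nat_sqrt_le_real_sqrt (a := N * O)
    simpa using this
  have h3 : (1 : ℝ) ≤ (N : ℝ) / p := by
    rw [le_div_iff₀ hp']
    simpa using (show (p : ℝ) ≤ N by exact_mod_cast hpN)
  have h4 : 0 ≤ Real.sqrt ((N : ℝ) * O) / p := by positivity
  unfold unitLoad
  push_cast
  nlinarith

end Run

section Line

variable {A B C D : Type*}

/-- The relation to which a tuple belongs. -/
def lineClass : LineTuple A B C D → ℕ
  | .inl _ => 0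
  | .inr (.inl _) => 1
  | .inr (.inr _) => 2

/-- The value of the first join attribute. -/
def lineKeyB : LineTuple A B C D → Option B
  | .inl t => some t.2
  | .inr (.inl t) => some t.1
  | .inr (.inr _) => none

/-- The value of the second join attribute. -/
def lineKeyC : LineTuple A B C D → Option C
  | .inl _ => none
  | .inr (.inl t) => some t.2
  | .inr (.inr t) => some t.1

theorem LineInstance.card_tuples (I : LineInstance A B C D) : I.tuples.card = I.IN := by
  simp [LineInstance.tuples, LineInstance.IN, Finset.card_disjSum, add_assoc]

open Classical in
theorem LineInstance.OUT_le (I : LineInstance A B C D) : I.OUT ≤ I.IN ^ 3 := by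
  refine (Finset.card_filter_le _ _).trans ?_
  rw [Finset.card_product, Finset.card_product]
  have h1 : I.R₁.card ≤ I.IN := by unfold LineInstance.IN; omega
  have h2 : I.R₂.card ≤ I.IN := by unfold LineInstance.IN; omega
  have h3 : I.R₃.card ≤ I.IN := by unfold LineInstance.IN; omega
  calc _ ≤ I.IN * (I.IN * I.IN) := Nat.mul_le_mul h1 (Nat.mul_le_mul h2 h3)
    _ = _ := by ring

theorem deg_eq_card {T κ : Type*} [LinearOrder T] [LinearOrder κ] {S F : Finset T} (hF : F ⊆ S)
    (k : T → κ) (t : T) : deg S k F t = (F.filter (fun u => k u = k t)).card := by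
  unfold deg ind
  rw [← Finset.sum_filter, ← Finset.card_eq_sum_ones, Finset.filter_filter]
  congr 1
  ext u
  simp only [Finset.mem_filter]
  exact ⟨fun h => ⟨h.2.2, h.2.1⟩, fun h => ⟨hF h.1, h.2, h.1⟩⟩

/-- Each counted triple comes from a join result. The key `none` does no harm, because degrees count
only tuples of a relation that has the attribute in question. The inequality suffices, as the load
bound is monotone in the output size. -/
theorem joinSize_le_OUT [LinearOrder (LineTuple A B C D)] [LinearOrder (Option B)]
    [LinearOrder (Option C)] (I : LineInstance A B C D) :
    joinSize I.tuples lineKeyB lineKeyC (I.tuples.filter (fun t => lineClass t = 0))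
      (I.tuples.filter (fun t => lineClass t = 1)) (I.tuples.filter (fun t => lineClass t = 2)) ≤
      I.OUT := by
  unfold joinSize
  simp only [deg_eq_card (Finset.filter_subset _ _), ← Finset.card_product]
  rw [← Finset.card_sigma]
  refine Finset.card_le_card_of_surjOn
    (fun t => ⟨.inr (.inl t.2.1), (.inl t.1, .inr (.inr t.2.2))⟩) ?_
  rintro ⟨t, u, u'⟩ h
  simp only [Finset.coe_sigma, Set.mem_sigma_iff, Finset.mem_coe, Finset.mem_product,
    Finset.mem_filter] at h
  obtain ⟨⟨ht, ct⟩, ⟨⟨hu, cu⟩, ku⟩, ⟨hu', cu'⟩, ku'⟩ := h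
  rcases t with t | t | t <;> simp only [lineClass] at ct <;> try omega
  rcases u with u | u | u <;> simp only [lineClass] at cu <;> try omega
  rcases u' with u' | u' | u' <;> simp only [lineClass] at cu' <;> try omega
  refine ⟨(u, t, u'), ?_, rfl⟩
  simp only [LineInstance.tuples, Finset.inl_mem_disjSum, Finset.inr_mem_disjSum] at ht hu hu'
  simp only [lineKeyB, lineKeyC, Option.some.injEq] at ku ku'
  simp [hu, hu', ku, ku', ht, LineInstance.results]

/-- A linear order on an arbitrary type. -/
noncomputable abbrev someLinearOrder (α : Type*) : LinearOrder α :=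
  IsWellOrder.linearOrder WellOrderingRel

theorem IsEvenDistribution.card_le {p : ℕ} {T : Type*} {S : Finset T} {init : Fin p → Finset T}
    (h : IsEvenDistribution S init) (hp : 0 < p) (s : Fin p) :
    (init s).card ≤ S.card / p + 1 := by
  refine (h.even s).trans (Nat.ceil_le.2 ?_)
  rw [div_le_iff₀ (by exact_mod_cast hp)]
  have := (Nat.lt_mul_div_succ S.card hp).le
  rw [mul_comm] at this
  exact_mod_cast this

/-- Since `C ≤ 2 ^ C ≤ N ^ C`, constant factors can be moved into the exponent that bounds the
integers. -/
theorem mul_pow_le_pow {N C k : ℕ} (hN : 2 ≤ N) (j : ℕ) (hk : C + k ≤ j) : C * N ^ k ≤ N ^ j :=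
  calc C * N ^ k ≤ N ^ C * N ^ k := Nat.mul_le_mul_right _
        (Nat.lt_two_pow_self.le.trans (Nat.pow_le_pow_left hN C))
    _ = N ^ (C + k) := (pow_add ..).symm
    _ ≤ N ^ j := Nat.pow_le_pow_right (by omega) hk

theorem exists_lineAlgorithm (A B C D : Type*) {p q m c : ℕ} (hp : 2 ≤ p) (hq : 0 < q)
    (hPp : q ^ m ≤ p) (hpc : p ≤ c * q ^ m) :
    ∃ alg : Algorithm p (LineTuple A B C D), ∀ I : LineInstance A B C D, p * q ^ 2 ≤ I.IN →
      ∀ init : Fin p → Finset (LineTuple A B C D), IsEvenDistribution I.tuples init →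
        ComputesLineJoin alg I init (Run.lineRounds m) ∧
        alg.IntsBounded init (Run.lineRounds m) (I.IN ^ (6 * c + 8)) ∧
        alg.load init (Run.lineRounds m) ≤
          15 * ((6 * c + 5) * (I.IN / p)) + 72 * Run.unitLoad (q ^ m) I.IN I.OUT := by
  let _ := someLinearOrder (LineTuple A B C D)
  let _ := someLinearOrder (Option B)
  let _ := someLinearOrder (Option C)
  -- An input is an instance together with its initial distribution. A run over all inputs contains
  -- a single algorithm, which therefore depends on neither.
  let Ω := {x : LineInstance A B C D × (Fin p → Finset (LineTuple A B C D)) //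
    p * q ^ 2 ≤ x.1.IN ∧ IsEvenDistribution x.1.tuples x.2}
  let F : ℕ → Ω → Finset (LineTuple A B C D) := fun i ω =>
    ω.1.1.tuples.filter (fun t => lineClass t = i)
  let O : Ω → ℕ := fun ω => joinSize ω.1.1.tuples lineKeyB lineKeyC (F 0 ω) (F 1 ω) (F 2 ω)
  have hO : ∀ ω : Ω, O ω ≤ ω.1.1.OUT := fun ω => joinSize_le_OUT ω.1.1
  have hq2 : 1 ≤ q ^ 2 := Nat.one_le_pow _ _ hq
  have hpN : ∀ ω : Ω, p ≤ ω.1.1.IN := fun ω => (Nat.le_mul_of_pos_right p hq2).trans ω.2.1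
  have hdiv : ∀ ω : Ω, q ^ 2 ≤ ω.1.1.IN / p := fun ω =>
    (Nat.le_div_iff_mul_le (by omega)).2 (by rw [mul_comm]; exact ω.2.1)
  have hroom : ∀ ω : Ω, Run.room q c (ω.1.1.IN / p + 1) ≤ (6 * c + 5) * (ω.1.1.IN / p) :=
    fun ω => Run.room_le (hdiv ω) (hq2.trans (hdiv ω))
  obtain ⟨R, hr, hjoin⟩ := Run.exists_lineJoin
    (L := fun ω : Ω => 15 * ((6 * c + 5) * (ω.1.1.IN / p)) +
      72 * Run.unitLoad (q ^ m) ω.1.1.IN ω.1.1.OUT)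
    (Bd := fun ω : Ω => ω.1.1.IN ^ (6 * c + 8)) (init := fun ω : Ω => ω.1.2)
    (tuples := fun ω : Ω => ω.1.1.tuples) (F := F) (O := O) (q := q) (m := m) (c := c)
    lineKeyB lineKeyC lineClass (fun ω => ω.2.2.cover) (fun ω => ω.2.2.disjoint)
    (fun ω => ω.2.2.card_le (by omega)) hq hPp hpc (fun _ _ => rfl) (fun _ => rfl)
    (fun ω => by
      rw [LineInstance.card_tuples]
      exact hPp.trans (hpN ω))
    (fun ω => (hO ω).trans (ω.1.1.OUT_le.trans
      (Nat.pow_le_pow_right (by have := hpN ω; omega) (by omega))))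
    (fun ω => by
      rw [LineInstance.card_tuples]
      have h2 : 2 ≤ ω.1.1.IN := hp.trans (hpN ω)
      calc q ^ m * Run.room q c (ω.1.1.IN / p + 1) ≤ p * ((6 * c + 5) * (ω.1.1.IN / p)) :=
            Nat.mul_le_mul hPp (hroom ω)
        _ = (6 * c + 5) * (p * (ω.1.1.IN / p)) := by ring
        _ ≤ (6 * c + 5) * ω.1.1.IN ^ 1 := by
            rw [pow_one]; exact Nat.mul_le_mul_left _ (Nat.mul_div_le _ _)
        _ ≤ _ := mul_pow_le_pow h2 _ (by omega))
    (fun ω => by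
      rw [LineInstance.card_tuples]
      exact (Run.mul_unitLoad_le (hPp.trans (hpN ω)) ((hO ω).trans ω.1.1.OUT_le)).trans
        (mul_pow_le_pow (hp.trans (hpN ω)) _ (by omega)))
    (fun ω => by
      refine le_trans ?_ (mul_pow_le_pow (C := 6) (k := 1) (hp.trans (hpN ω)) _ (by omega))
      rw [pow_one]
      exact Nat.mul_le_mul_left _ (hPp.trans (hpN ω)))
    (fun ω => by
      rw [LineInstance.card_tuples]
      exact Nat.add_le_add (Nat.mul_le_mul_left _ (hroom ω))
        (Nat.mul_le_mul_left _ (Run.unitLoad_mono (hO ω))))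
  refine ⟨R.alg, fun I hI init hinit => ?_⟩
  let ω : Ω := ⟨(I, init), hI, hinit⟩
  refine ⟨?_, ?_, ?_⟩
  · rintro ⟨t₁, t₂, t₃⟩ ht
    simp only [LineInstance.results, Finset.mem_filter, Finset.mem_product] at ht
    obtain ⟨⟨h₁, h₂, h₃⟩, h₁₂, h₂₃⟩ := ht
    obtain ⟨v, hv, hh⟩ := hjoin ω (.inl t₁) (Finset.mem_filter.2 ⟨by simp [ω, LineInstance.tuples, h₁], rfl⟩)
      (.inr (.inl t₂)) (Finset.mem_filter.2 ⟨by simp [ω, LineInstance.tuples, h₂], rfl⟩)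
      (.inr (.inr t₃)) (Finset.mem_filter.2 ⟨by simp [ω, LineInstance.tuples, h₃], rfl⟩)
      (by simp [lineKeyB, h₁₂]) (by simp [lineKeyC, h₂₃])
    simp only [Run.Has, Run.vw, hv, dif_pos, hr] at hh
    exact ⟨⟨v, hv⟩, hh⟩
  · have := R.ints_le ω
    rw [hr] at this
    exact this
  · refine Finset.sup_le fun k hk => Finset.sup_le fun d _ => ?_
    refine R.load_le ω k ?_ d
    rw [hr]
    exact Finset.mem_range.1 hk

/-- Take the integer part of the `m`-th root: `p < (q + 1) ^ m ≤ (2 * q) ^ m`. -/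
theorem exists_root {m p : ℕ} (hm : m ≠ 0) (hp : 0 < p) :
    ∃ q, 0 < q ∧ q ^ m ≤ p ∧ p ≤ 2 ^ m * q ^ m := by
  refine ⟨Nat.findGreatest (fun q => q ^ m ≤ p) p, ?_, ?_, ?_⟩
  · exact Nat.le_findGreatest hp ((one_pow m).trans_le hp)
  · exact Nat.findGreatest_spec (P := fun q => q ^ m ≤ p) hp ((one_pow m).trans_le hp)
  · set q := Nat.findGreatest (fun q => q ^ m ≤ p) p with hq
    have h1 : 0 < q := Nat.le_findGreatest hp ((one_pow m).trans_le hp)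
    have h2 : p < (q + 1) ^ m := by
      by_contra hc
      have h3 : q + 1 ≤ p := (Nat.le_self_pow hm _).trans (not_lt.1 hc)
      have := Nat.le_findGreatest (P := fun q => q ^ m ≤ p) h3 (not_lt.1 hc)
      omega
    rw [← mul_pow]
    exact h2.le.trans (Nat.pow_le_pow_left (by omega) m)

/-- Here the exponent `1 + ε` is spent: `q ^ 2 ≤ p ^ (2 / m) ≤ p ^ ε`. -/
theorem mul_sq_le_rpow {ε : ℝ} {m p q : ℕ} (hm : 2 ≤ m * ε) (hm' : m ≠ 0) (hp : 0 < p)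
    (hq : q ^ m ≤ p) : ((p * q ^ 2 : ℕ) : ℝ) ≤ (p : ℝ) ^ (1 + ε) := by
  have hp' : (1 : ℝ) ≤ p := by exact_mod_cast hp
  have hm0 : (0 : ℝ) < m := by exact_mod_cast Nat.pos_of_ne_zero hm'
  have h1 : (q : ℝ) ^ m ≤ p := by exact_mod_cast hq
  rw [Real.rpow_add (by linarith), Real.rpow_one]
  push_cast
  refine mul_le_mul_of_nonneg_left ?_ (by linarith)
  calc (q : ℝ) ^ 2 = ((q : ℝ) ^ m) ^ (2 / (m : ℝ)) := by
        rw [← Real.rpow_natCast, ← Real.rpow_natCast, ← Real.rpow_mul (by positivity)]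
        congr 1
        field_simp
        norm_num
    _ ≤ (p : ℝ) ^ (2 / (m : ℝ)) := Real.rpow_le_rpow (by positivity) h1 (by positivity)
    _ ≤ (p : ℝ) ^ ε := Real.rpow_le_rpow_of_exponent_le hp' (by
        rw [div_le_iff₀ hm0]; linarith)

/-- On one server nothing has to be sent. -/
theorem exists_lineAlgorithm_one (A B C D : Type*) (r : ℕ) :
    ∃ alg : Algorithm 1 (LineTuple A B C D), ∀ I : LineInstance A B C D,
      ∀ init : Fin 1 → Finset (LineTuple A B C D), IsEvenDistribution I.tuples init →
        ComputesLineJoin alg I init r ∧ (∀ M, alg.IntsBounded init r M) ∧ alg.load init r = 0 := by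
  refine ⟨⟨fun _ _ _ => [], by simp⟩, fun I init hinit => ⟨?_, ?_, ?_⟩⟩
  · rintro ⟨t₁, t₂, t₃⟩ ht
    simp only [LineInstance.results, Finset.mem_filter, Finset.mem_product] at ht
    obtain ⟨⟨h₁, h₂, h₃⟩, -⟩ := ht
    have key : ∀ (alg : Algorithm 1 (LineTuple A B C D)), ∀ t ∈ I.tuples,
        (alg.view init r 0).Holds t := by
      intro alg t ht
      obtain ⟨s, hs⟩ := (hinit.cover t).1 ht
      rw [Subsingleton.elim s 0] at hs
      left
      cases r <;> exact hs
    exact ⟨0, key _ _ (by simp [LineInstance.tuples, h₁]), key _ _ (by simp [LineInstance.tuples, h₂]),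
      key _ _ (by simp [LineInstance.tuples, h₃])⟩
  · intro M k _ s d n hn
    simp [Algorithm.message] at hn
  · simp [Algorithm.load, Algorithm.loadAt, Algorithm.message]

end Line

end MPC

theorem mainTheorem6 (ε : ℝ) (hε : 0 < ε) :
    ∃ (r c : ℕ) (K : ℝ), ∀ (A B C D : Type*) (p : ℕ), 0 < p →
      ∃ alg : MPC.Algorithm p (MPC.LineTuple A B C D),
        ∀ I : MPC.LineInstance A B C D, (p : ℝ) ^ (1 + ε) ≤ (I.IN : ℝ) →
          ∀ init : Fin p → Finset (MPC.LineTuple A B C D),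
            MPC.IsEvenDistribution I.tuples init →
              MPC.ComputesLineJoin alg I init r ∧
              alg.IntsBounded init r (I.IN ^ c) ∧
              (alg.load init r : ℝ) ≤
                K * ((I.IN : ℝ) / p + Real.sqrt ((I.IN : ℝ) * (I.OUT : ℝ)) / p) := by
  obtain ⟨m, hm⟩ := exists_nat_ge (2 / ε)
  rw [div_le_iff₀ hε] at hm
  have hm' : m ≠ 0 := by
    rintro rfl
    simp at hm
    linarith
  -- The constants are those of `exists_lineAlgorithm` with `c = 2 ^ m`, the loss from rounding the
  -- root.
  refine ⟨MPC.Run.lineRounds m, 6 * 2 ^ m + 8,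
    15 * (6 * 2 ^ m + 5) + 72 * (2 ^ m + 2), fun A B C D p hp => ?_⟩
  -- For `p = 1` the input may consist of a single tuple, and then powers of `IN` cannot absorb
  -- constants; this case needs no communication.
  rcases Nat.lt_or_ge p 2 with h | h
  · obtain rfl : p = 1 := by omega
    obtain ⟨alg, halg⟩ := MPC.exists_lineAlgorithm_one A B C D (MPC.Run.lineRounds m)
    refine ⟨alg, fun I _ init hinit => ?_⟩
    obtain ⟨h1, h2, h3⟩ := halg I init hinit
    refine ⟨h1, h2 _, ?_⟩
    rw [h3, Nat.cast_zero]
    positivity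
  · obtain ⟨q, hq, hPp, hpc⟩ := MPC.exists_root hm' hp
    obtain ⟨alg, halg⟩ := MPC.exists_lineAlgorithm A B C D h hq hPp hpc
    refine ⟨alg, fun I hI init hinit => ?_⟩
    have hN : p * q ^ 2 ≤ I.IN := by
      exact_mod_cast (MPC.mul_sq_le_rpow hm hm' hp hPp).trans hI
    have hpN : p ≤ I.IN := (Nat.le_mul_of_pos_right p (by positivity)).trans hN
    obtain ⟨h1, h2, h3⟩ := halg I hN init hinit
    refine ⟨h1, h2, (Nat.cast_le.2 h3).trans ?_⟩
    have h4 := MPC.Run.unitLoad_le (O := I.OUT) (pow_pos hq m) hp hpc hpN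
    have h5 : ((I.IN / p : ℕ) : ℝ) ≤ (I.IN : ℝ) / p := Nat.cast_div_le
    have h6 : 0 ≤ Real.sqrt ((I.IN : ℝ) * I.OUT) / p := by positivity
    push_cast at h4 ⊢
    set x := (I.IN : ℝ) / p
    set y := Real.sqrt ((I.IN : ℝ) * I.OUT) / p
    have h7 : (6 * 2 ^ m + 5 : ℝ) * ((I.IN / p : ℕ) : ℝ) ≤ (6 * 2 ^ m + 5) * (x + y) := by
      gcongr
      linarith
    linarith
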